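/- Let $G$ be a finite connected bridgeless cubic graph (parallel edges allowed) with $n\ge 4$ vertices, cellularly embedded (that is, every face is an open disk) in a closed surface, orientable or not, of Euler characteristic $\chi$. The representativity of the embedding is the least number of points of the embedded graph that lie on a simple closed curve in the surface whose complement is connected (it is $\infty$ if the surface is a sphere, where there is no such curve). Suppose that the representativity is at least $4$. A circuit double cover of $G$ is a multiset of circuits (connected $2$-regular subgraphs) of $G$ such that every edge of $G$ is contained in exactly two of its elements, counted with multiplicity. Then $G$ has at least $$2^{\sqrt[3]{n+2\chi}\,/100}$$ circuit double covers. -/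

import Mathlib

open scoped Graph

namespace Graph

variable {α β : Type*}

/-- A graph (loops and parallel edges allowed) is connected if it has a vertex and any two
vertices are joined by a walk. -/
def IsConnected (G : Graph α β) : Prop :=
  V(G).Nonempty ∧ ∀ x ∈ V(G), ∀ y ∈ V(G), Relation.ReflTransGen G.Adj x y

/-- The degree of a vertex: the number of edge ends at it (a loop counts twice). -/
noncomputable def deg (G : Graph α β) (x : α) : ℕ∞ :=
  (G.incidenceSet x).encard + (G.loopSet x).encard

/-- Every vertex has degree `3`. -/
def IsCubic (G : Graph α β) : Prop :=
  ∀ x ∈ V(G), G.deg x = 3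

/-- An edge is a bridge if its ends are in different components after its deletion. -/
def IsBridge (G : Graph α β) (e : β) : Prop :=
  ∃ x y, G.IsLink e x y ∧ ¬ Relation.ReflTransGen (G.deleteEdges {e}).Adj x y

/-- No edge is a bridge. -/
def IsBridgeless (G : Graph α β) : Prop :=
  ∀ e, ¬ G.IsBridge e

/-- A circuit of `G`: a finite connected subgraph in which every vertex has degree `2`. -/
structure IsCircuitOf (C G : Graph α β) : Prop where
  le : C ≤ G
  finite : V(C).Finite
  connected : C.IsConnected
  deg_eq_two : ∀ x ∈ V(C), C.deg x = 2

open Classical in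
/-- A circuit double cover of `G`: a multiset of circuits of `G` such that every edge of `G` is
contained in exactly two elements of it (counted with multiplicity). -/
def IsCircuitDoubleCover (G : Graph α β) (𝒞 : Multiset (Graph α β)) : Prop :=
  (∀ C ∈ 𝒞, C.IsCircuitOf G) ∧ ∀ e ∈ E(G), 𝒞.countP (fun C => e ∈ E(C)) = 2

/-- The number of circuit double covers of `G`. -/
noncomputable def numCircuitDoubleCovers (G : Graph α β) : ℕ :=
  {𝒞 : Multiset (Graph α β) | G.IsCircuitDoubleCover 𝒞}.ncard

end Graph

/-- A cellular embedding of a graph `G` (without isolated vertices) in a closed surface,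
orientable or not, given by its flags. A flag is a triangle of the barycentric subdivision of the
surface; its three corners are a vertex, (the midpoint of) an edge and (the centre of) a face.
Every flag has exactly one neighbour across each of its three sides:
* `flipVert x` has the same edge and the same face as `x`, and the other end of the edge,
* `flipEdge x` has the same vertex and the same face as `x`, and the next edge of the face there,
* `flipFace x` has the same vertex and the same edge as `x`, and the other side of the edge.
The four flags around an edge are `x`, `flipVert x`, `flipFace x`, `flipVert (flipFace x)`; the
flags around a vertex form an orbit of `flipEdge` and `flipFace`, and the flags of a face form an
orbit of `flipVert` and `flipEdge`. -/
structure SurfaceEmbedding {α β : Type*} (G : Graph α β) (F : Type*) where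
  /-- the vertex of a flag -/
  vert : F → α
  /-- the edge of a flag -/
  edge : F → β
  /-- the neighbour across the side from the edge to the face -/
  flipVert : F → F
  /-- the neighbour across the side from the vertex to the face -/
  flipEdge : F → F
  /-- the neighbour across the side from the vertex to the edge -/
  flipFace : F → F
  flipVert_invol : Function.Involutive flipVert
  flipEdge_invol : Function.Involutive flipEdge
  flipFace_invol : Function.Involutive flipFace
  flipVert_ne : ∀ x, flipVert x ≠ x
  flipEdge_ne : ∀ x, flipEdge x ≠ x
  flipFace_ne : ∀ x, flipFace x ≠ x
  flipVert_flipFace : ∀ x, flipVert (flipFace x) = flipFace (flipVert x)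
  flipVert_flipFace_ne : ∀ x, flipVert (flipFace x) ≠ x
  /-- the edge of a flag joins the vertices of the two flags along it -/
  isLink : ∀ x, G.IsLink (edge x) (vert x) (vert (flipVert x))
  /-- every vertex of `G` is drawn -/
  exists_vert : ∀ v ∈ V(G), ∃ x, vert x = v
  /-- every edge of `G` is drawn -/
  exists_edge : ∀ e ∈ E(G), ∃ x, edge x = e
  /-- the flags at a vertex of `G` are those around one point of the surface -/
  vert_eq_iff : ∀ x y, vert x = vert y ↔
    Relation.EqvGen (fun a b => b = flipEdge a ∨ b = flipFace a) x y
  /-- the flags at an edge of `G` are the four flags around one edge of the drawing -/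
  edge_eq_iff : ∀ x y, edge x = edge y ↔
    y = x ∨ y = flipVert x ∨ y = flipFace x ∨ y = flipVert (flipFace x)

namespace SurfaceEmbedding

variable {α β F : Type*} {G : Graph α β}

/-- The faces of the embedding: the orbits of flags under `flipVert` and `flipEdge`. -/
def Face (M : SurfaceEmbedding G F) : Type _ :=
  Quot (fun x y : F => y = M.flipVert x ∨ y = M.flipEdge x)

/-- The face of a flag. -/
def face (M : SurfaceEmbedding G F) (x : F) : M.Face :=
  Quot.mk _ x

/-- The Euler characteristic of the surface, `|V| - |E| + |faces|` (for a finite graph). -/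
noncomputable def eulerChar (M : SurfaceEmbedding G F) : ℤ :=
  (V(G).ncard : ℤ) - (E(G).ncard : ℤ) + (Nat.card M.Face : ℤ)

lemma face_flipVert (M : SurfaceEmbedding G F) (x : F) : M.face (M.flipVert x) = M.face x :=
  Eq.symm (Quot.sound (r := fun x y : F => y = M.flipVert x ∨ y = M.flipEdge x) (Or.inl rfl))

lemma face_flipEdge (M : SurfaceEmbedding G F) (x : F) : M.face (M.flipEdge x) = M.face x :=
  Eq.symm (Quot.sound (r := fun x y : F => y = M.flipVert x ∨ y = M.flipEdge x) (Or.inr rfl))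

lemma edge_flipVert (M : SurfaceEmbedding G F) (x : F) : M.edge (M.flipVert x) = M.edge x :=
  ((M.edge_eq_iff x _).2 (Or.inr (Or.inl rfl))).symm

lemma vert_flipEdge (M : SurfaceEmbedding G F) (x : F) : M.vert (M.flipEdge x) = M.vert x :=
  ((M.vert_eq_iff x _).2 (Relation.EqvGen.rel _ _ (Or.inl rfl))).symm

/-- The segments of which curves are made. `IsSegment M s p f` says that, for some flag `x` of the
face `f`, `s` is either the segment from the centre of `f` to the midpoint `p` of the edge of `x`
(the common side of `x` and `flipVert x`), or the segment from the centre of `f` to the vertex `p`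
of `x` (the common side of `x` and `flipEdge x`). -/
inductive IsSegment (M : SurfaceEmbedding G F) : Sym2 F ⊕ Sym2 F → α ⊕ β → M.Face → Prop
  | toEdge (x : F) : IsSegment M (Sum.inl s(x, M.flipVert x)) (Sum.inr (M.edge x)) (M.face x)
  | toVert (x : F) : IsSegment M (Sum.inr s(x, M.flipEdge x)) (Sum.inl (M.vert x)) (M.face x)

lemma IsSegment.unique {M : SurfaceEmbedding G F} {s : Sym2 F ⊕ Sym2 F} {p q : α ⊕ β}
    {f g : M.Face} (h : M.IsSegment s p f) (h' : M.IsSegment s q g) : p = q ∧ f = g := by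
  cases h with
  | toEdge x =>
    generalize hs : (Sum.inl s(x, M.flipVert x) : Sym2 F ⊕ Sym2 F) = s at h'
    cases h' with
    | toEdge y =>
      rcases Sym2.eq_iff.1 (Sum.inl.inj hs) with ⟨rfl, -⟩ | ⟨rfl, -⟩
      · exact ⟨rfl, rfl⟩
      · exact ⟨by rw [edge_flipVert], by rw [face_flipVert]⟩
    | toVert y => simp at hs
  | toVert x =>
    generalize hs : (Sum.inr s(x, M.flipEdge x) : Sym2 F ⊕ Sym2 F) = s at h'
    cases h' with
    | toEdge y => simp at hs
    | toVert y =>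
      rcases Sym2.eq_iff.1 (Sum.inr.inj hs) with ⟨rfl, -⟩ | ⟨rfl, -⟩
      · exact ⟨rfl, rfl⟩
      · exact ⟨by rw [vert_flipEdge], by rw [face_flipEdge]⟩

/-- The graph drawn on the surface whose vertices are the vertices of `G`, the midpoints of the
edges of `G` and the centres of the faces, and whose edges are the segments joining the centre of
a face to the vertices and to the edge midpoints on its boundary, one for each time that the
boundary of the face passes through them. -/
def segmentGraph (M : SurfaceEmbedding G F) :
    Graph ((α ⊕ β) ⊕ M.Face) (Sym2 F ⊕ Sym2 F) where
  vertexSet := {a | ∃ s p f, M.IsSegment s p f ∧ (a = Sum.inl p ∨ a = Sum.inr f)}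
  IsLink s a b := ∃ p f, M.IsSegment s p f ∧
    ((a = Sum.inl p ∧ b = Sum.inr f) ∨ (a = Sum.inr f ∧ b = Sum.inl p))
  isLink_symm := by
    intro s _
    refine ⟨fun a b => ?_⟩
    rintro ⟨p, f, h, h'⟩
    exact ⟨p, f, h, by tauto⟩
  eq_or_eq_of_isLink_of_isLink := by
    rintro s a b c d ⟨p, f, h, h'⟩ ⟨q, g, k, k'⟩
    obtain ⟨rfl, rfl⟩ := h.unique k
    rcases h' with ⟨rfl, rfl⟩ | ⟨rfl, rfl⟩ <;> rcases k' with ⟨rfl, rfl⟩ | ⟨rfl, rfl⟩ <;> simp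
  left_mem_of_isLink := by
    rintro s a b ⟨p, f, h, h'⟩
    exact ⟨s, p, f, h, by tauto⟩

/-- A simple closed curve on the surface that meets the drawing of `G` in finitely many points,
up to a deformation that does not increase the number of these points: a circuit of segments. In
each face that it visits, it runs from the boundary to the centre and back to the boundary, and
it passes from face to face through an edge or a vertex of `G`. -/
def IsSimpleClosedCurve (M : SurfaceEmbedding G F)
    (C : Graph ((α ⊕ β) ⊕ M.Face) (Sym2 F ⊕ Sym2 F)) : Prop :=
  C.IsCircuitOf M.segmentGraph

/-- Two flags are adjacent on the surface cut open along the curve `C`: they have a common side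
that is not a segment of `C`. -/
def AdjOff (M : SurfaceEmbedding G F)
    (C : Graph ((α ⊕ β) ⊕ M.Face) (Sym2 F ⊕ Sym2 F)) (x y : F) : Prop :=
  (y = M.flipVert x ∧ Sum.inl s(x, y) ∉ E(C)) ∨
  (y = M.flipEdge x ∧ Sum.inr s(x, y) ∉ E(C)) ∨
  y = M.flipFace x

/-- The curve does not split the surface: the complement of the curve is connected. -/
def IsNonseparating (M : SurfaceEmbedding G F)
    (C : Graph ((α ⊕ β) ⊕ M.Face) (Sym2 F ⊕ Sym2 F)) : Prop :=
  ∀ x y : F, Relation.EqvGen (M.AdjOff C) x y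

/-- The number of points of the drawing of `G` that the curve meets. -/
noncomputable def numPoints (M : SurfaceEmbedding G F)
    (C : Graph ((α ⊕ β) ⊕ M.Face) (Sym2 F ⊕ Sym2 F)) : ℕ∞ :=
  {p : α ⊕ β | Sum.inl p ∈ V(C)}.encard

/-- The representativity of the embedding: the least number of points of the drawing of `G` on a
simple closed curve that does not split the surface (`⊤` if there is no such curve, which is the
case of the sphere). -/
noncomputable def representativity (M : SurfaceEmbedding G F) : ℕ∞ :=
  ⨅ (C : Graph ((α ⊕ β) ⊕ M.Face) (Sym2 F ⊕ Sym2 F)) (_ : M.IsSimpleClosedCurve C)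
    (_ : M.IsNonseparating C), M.numPoints C

end SurfaceEmbedding

/-!
The face boundaries of the embedding form a family of even edge sets that covers every edge twice,
and since a curve through at most three edges separates the surface, a set of two or three edges
that meets every boundary evenly is an edge cut. This last property survives the contraction of one
side of a cut of three edges, and circuit double covers of the two contractions glue to circuit
double covers of the graph: their numbers multiply, while cube roots of face numbers are
subadditive. So we may assume that every cut of three edges is the star of a vertex. A cut of two
edges then leaves only the four-vertex necklace; otherwise two faces share at most one edge.

Colour the boundary edges of a face `Q` with three colours so that consecutive edges differ, and
replace `Q` and its neighbours by three sums modulo 2, one per colour: `Q` plus the neighbours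
across the edges of that colour. Splitting the sums into circuits gives a new circuit double cover.
If all `f` faces have length at most `d`, a greedy choice yields at least `f / (2 * d) ^ 2` faces
that can be recombined or left alone independently, while a single face of length `d` has at least
`2 ^ (d / 27)` colourings with different results. One of the two exponents is of order
`f ^ (1 / 3)`, and `n + 2 * χ = 2 * f` by Euler's formula and the handshake lemma.
-/

section

open scoped Classical

section FiniteSets

variable {ι E κ : Type*}

/-- The elements of `U` that lie in an odd number of the sets `A i` with `i ∈ I`, i.e. the sum
modulo two of these sets. Edge cuts are sums of vertex stars, and new double covers are made of
sums of face boundaries. -/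
noncomputable def oddPart (U : Finset E) (I : Finset ι) (A : ι → Finset E) : Finset E :=
  U.filter fun e => Odd (I.filter fun i => e ∈ A i).card

lemma mem_oddPart {U : Finset E} {I : Finset ι} {A : ι → Finset E} {e : E} :
    e ∈ oddPart U I A ↔ e ∈ U ∧ Odd (I.filter fun i => e ∈ A i).card := by
  simp [oddPart]

lemma even_card_inter_oddPart_iff {U C : Finset E} {I : Finset ι} {A : ι → Finset E}
    (hC : C ⊆ U) :
    Even (C ∩ oddPart U I A).card ↔ Even (∑ i ∈ I, (A i ∩ C).card) := by
  have double_count : ∑ i ∈ I, (A i ∩ C).card = ∑ e ∈ C, (I.filter fun i => e ∈ A i).card := by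
    simp only [Finset.inter_comm _ C, ← Finset.filter_mem_eq_inter]
    exact Finset.sum_card_bipartiteAbove_eq_sum_card_bipartiteBelow (fun i e => e ∈ A i)
  have inter_eq : C ∩ oddPart U I A =
      C.filter fun e => Odd (I.filter fun i => e ∈ A i).card := by
    rw [oddPart, Finset.inter_filter, Finset.inter_eq_left.2 hC]
  rw [double_count, inter_eq, ← Nat.not_odd_iff_even, ← Nat.not_odd_iff_even,
    Finset.odd_sum_iff_odd_card_odd]

lemma even_card_inter_oddPart {U C : Finset E} {I : Finset ι} {A : ι → Finset E}
    (hC : C ⊆ U) (h : ∀ i ∈ I, Even (A i ∩ C).card) : Even (C ∩ oddPart U I A).card :=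
  (even_card_inter_oddPart_iff hC).2 (Finset.even_sum _ h)

lemma sum_card_eq_mul_of_card_filter_eq {U : Finset E} {I : Finset ι} {A : ι → Finset E} {k : ℕ}
    (hA : ∀ i ∈ I, A i ⊆ U) (h : ∀ e ∈ U, (I.filter fun i => e ∈ A i).card = k) :
    ∑ i ∈ I, (A i).card = U.card * k := by
  have card_eq : ∀ i ∈ I, (A i).card = (U.filter (· ∈ A i)).card := fun i hi => by
    rw [Finset.filter_mem_eq_inter, Finset.inter_eq_right.2 (hA i hi)]
  rw [Finset.sum_congr rfl card_eq, ← Finset.sum_const_nat h]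
  exact Finset.sum_card_bipartiteAbove_eq_sum_card_bipartiteBelow (fun i e => e ∈ A i)

lemma even_card_inter_triple_iff {A : Finset E} {a b c : E} (hab : a ≠ b) (hac : a ≠ c)
    (hbc : b ≠ c) : Even (A ∩ {a, b, c}).card ↔
      (a ∈ A ∧ b ∈ A ∧ c ∉ A) ∨ (a ∈ A ∧ b ∉ A ∧ c ∈ A) ∨ (a ∉ A ∧ b ∈ A ∧ c ∈ A) ∨
        (a ∉ A ∧ b ∉ A ∧ c ∉ A) := by
  rw [Finset.inter_comm, ← Finset.filter_mem_eq_inter]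
  by_cases ha : a ∈ A <;> by_cases hb : b ∈ A <;> by_cases hc : c ∈ A <;>
    simp [Finset.filter_insert, Finset.filter_singleton, *, Nat.even_iff]

lemma card_filter_pair_eq_one {I : Finset ι} {A : ι → Finset E} {a b c : E} (hab : a ≠ b)
    (hac : a ≠ c) (hbc : b ≠ c) (heven : ∀ i ∈ I, Even (A i ∩ {a, b, c}).card)
    (ha : (I.filter fun i => a ∈ A i).card = 2) (hb : (I.filter fun i => b ∈ A i).card = 2)
    (hc : (I.filter fun i => c ∈ A i).card = 2) :
    (I.filter fun i => a ∈ A i ∧ b ∈ A i).card = 1 := by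
  have count : 2 * (I.filter fun i => a ∈ A i ∧ b ∈ A i).card + (I.filter fun i => c ∈ A i).card =
      (I.filter fun i => a ∈ A i).card + (I.filter fun i => b ∈ A i).card := by
    simp only [Finset.card_filter, Finset.mul_sum, ← Finset.sum_add_distrib]
    refine Finset.sum_congr rfl fun i hi => ?_
    rcases (even_card_inter_triple_iff hab hac hbc).1 (heven i hi) with h | h | h | h <;> simp [h]
  omega

lemma even_card_sdiff {C D : Finset E} (hDC : D ⊆ C) (hC : Even C.card) (hD : Even D.card) :
    Even (C \ D).card := by
  rw [Finset.card_sdiff_of_subset hDC, Nat.even_sub (Finset.card_le_card hDC)]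
  exact iff_of_true hC hD

lemma exists_independent_subset (A : Finset ι) (r : ι → ι → Prop) [DecidableRel r] (d : ℕ)
    (hsymm : ∀ a b, r a b → r b a) (hrefl : ∀ a ∈ A, r a a)
    (hd : ∀ a ∈ A, (A.filter (r a)).card ≤ d) :
    ∃ W ⊆ A, (∀ a ∈ W, ∀ b ∈ W, r a b → a = b) ∧ A.card ≤ W.card * d := by
  obtain ⟨W, hW, hmax⟩ := (A.powerset.filter fun W => ∀ a ∈ W, ∀ b ∈ W, r a b → a = b)
    |>.exists_max_image Finset.card ⟨∅, by simp⟩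
  simp only [Finset.mem_filter, Finset.mem_powerset] at hW hmax
  have covered : A ⊆ W.biUnion fun w => A.filter (r w) := by
    intro a ha
    by_contra hcon
    simp only [Finset.mem_biUnion, Finset.mem_filter, not_exists, not_and] at hcon
    have haW : a ∉ W := fun h => hcon a h ha (hrefl a ha)
    have hle := hmax (insert a W) ⟨Finset.insert_subset ha hW.1, by grind⟩
    rw [Finset.card_insert_of_notMem haW] at hle
    omega
  refine ⟨W, hW.1, hW.2, ?_⟩
  calc A.card ≤ _ := Finset.card_le_card covered
    _ ≤ ∑ w ∈ W, (A.filter (r w)).card := Finset.card_biUnion_le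
    _ ≤ W.card * d := Finset.sum_le_card_nsmul _ _ _ fun w hw => hd w (hW.1 hw)

lemma exists_coloring_extension [Fintype κ] (adj : E → E → Prop) [DecidableRel adj]
    (hsymm : ∀ a b, adj a b → adj b a) (hirrefl : ∀ a, ¬ adj a a) {P Q : Finset E} (hP : P ⊆ Q)
    (hdeg : ∀ a ∈ Q, (Q.filter (adj a)).card < Fintype.card κ) (c₀ : E → κ)
    (hc₀ : ∀ a ∈ P, ∀ b ∈ P, adj a b → c₀ a ≠ c₀ b) :
    ∃ c : E → κ, (∀ a ∈ P, c a = c₀ a) ∧ ∀ a ∈ Q, ∀ b ∈ Q, adj a b → c a ≠ c b := by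
  suffices extend : ∀ R ⊆ Q, ∃ c : E → κ, (∀ a ∈ P, c a = c₀ a) ∧
      ∀ a ∈ P ∪ R, ∀ b ∈ P ∪ R, adj a b → c a ≠ c b by
    simpa only [Finset.union_eq_right.2 hP] using extend Q subset_rfl
  intro R
  induction R using Finset.induction_on with
  | empty => exact fun _ => ⟨c₀, fun _ _ => rfl, by simpa using hc₀⟩
  | insert q R _ ih =>
    intro hR
    obtain ⟨hq, hRQ⟩ := Finset.insert_subset_iff.1 hR
    obtain ⟨c, hcP, hc⟩ := ih hRQ
    rw [Finset.union_insert]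
    by_cases hqPR : q ∈ P ∪ R
    · exact ⟨c, hcP, by rwa [Finset.insert_eq_of_mem hqPR]⟩
    obtain ⟨i, -, hi⟩ : ∃ i ∈ Finset.univ, i ∉ (Q.filter (adj q)).image c :=
      Finset.exists_mem_notMem_of_card_lt_card (Finset.card_image_le.trans_lt (hdeg q hq))
    have hfree : ∀ b ∈ P ∪ R, adj q b → c b ≠ i := fun b hb hqb hbi =>
      hi (Finset.mem_image.2 ⟨b, by simp [Finset.union_subset hP hRQ hb, hqb], hbi⟩)
    refine ⟨Function.update c q i, fun a ha => ?_, ?_⟩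
    · rw [Function.update_of_ne (by grind), hcP a ha]
    · grind

/-- The elements of `I` that satisfy `p` are exactly `x` and `y`, and these are different. This is
the common form of the ends of an edge and the two faces along an edge. -/
structure IsPairOf (I : Finset ι) (p : ι → Prop) (x y : ι) : Prop where
  left_mem : x ∈ I
  right_mem : y ∈ I
  ne : x ≠ y
  iff : ∀ v ∈ I, p v ↔ v = x ∨ v = y

namespace IsPairOf

variable {I X : Finset ι} {p : ι → Prop} {x y : ι}

lemma symm (h : IsPairOf I p x y) : IsPairOf I p y x :=
  ⟨h.right_mem, h.left_mem, h.ne.symm, fun v hv => (h.iff v hv).trans or_comm⟩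

lemma left (h : IsPairOf I p x y) : p x := (h.iff x h.left_mem).2 (.inl rfl)

lemma right (h : IsPairOf I p x y) : p y := (h.iff y h.right_mem).2 (.inr rfl)

lemma right_unique {z : ι} (h : IsPairOf I p x y) (h' : IsPairOf I p x z) : y = z :=
  ((h'.iff y h.right_mem).1 h.right).resolve_left h.ne.symm

lemma odd_card_filter_iff [DecidablePred p] (h : IsPairOf I p x y) (hX : X ⊆ I) :
    Odd (X.filter p).card ↔ (x ∈ X ↔ y ∉ X) := by
  have filter_eq : X.filter p = ({x, y} : Finset ι).filter (· ∈ X) := by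
    ext v
    simp only [Finset.mem_filter, Finset.mem_insert, Finset.mem_singleton, and_comm (a := v ∈ X)]
    exact and_congr_left fun hv => h.iff v (hX hv)
  rw [filter_eq]
  by_cases hx : x ∈ X <;> by_cases hy : y ∈ X <;>
    simp [Finset.filter_insert, Finset.filter_singleton, hx, hy, h.ne, Nat.odd_iff]

lemma card_filter [DecidablePred p] (h : IsPairOf I p x y) : (I.filter p).card = 2 := by
  refine Finset.card_eq_two.2 ⟨x, y, h.ne, ?_⟩
  ext v
  simp only [Finset.mem_filter, Finset.mem_insert, Finset.mem_singleton]
  exact ⟨fun hv => (h.iff v hv.1).1 hv.2, by rintro (rfl | rfl); exacts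
    [⟨h.left_mem, h.left⟩, ⟨h.right_mem, h.right⟩]⟩

end IsPairOf

lemma exists_isPairOf {I : Finset ι} {p : ι → Prop} [DecidablePred p]
    (h : (I.filter p).card = 2) : ∃ x y, IsPairOf I p x y := by
  obtain ⟨x, y, hxy, hpair⟩ := Finset.card_eq_two.1 h
  have hmem : ∀ v, v ∈ I ∧ p v ↔ v = x ∨ v = y := fun v => by
    rw [← Finset.mem_filter, hpair, Finset.mem_insert, Finset.mem_singleton]
  exact ⟨x, y, ((hmem x).2 (.inl rfl)).1, ((hmem y).2 (.inr rfl)).1, hxy, fun v hv => by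
    rw [← hmem v, and_iff_right hv]⟩

lemma exists_isPairOf_left {I : Finset ι} {p : ι → Prop} [DecidablePred p] {x : ι}
    (h : (I.filter p).card = 2) (hx : x ∈ I) (hpx : p x) : ∃ y, IsPairOf I p x y := by
  obtain ⟨a, b, hab⟩ := exists_isPairOf h
  rcases (hab.iff x hx).1 hpx with rfl | rfl
  exacts [⟨b, hab⟩, ⟨a, hab.symm⟩]

lemma card_filter_exists_le {α β : Type*} {B : Finset α} {C : Finset β} {r : α → Prop}
    {s : α → β → Prop} [DecidablePred r] [∀ x, DecidablePred (s x)]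
    [DecidablePred fun y => ∃ x ∈ B, r x ∧ s x y] {m n : ℕ} (hr : (B.filter r).card ≤ m)
    (hs : ∀ x ∈ B, (C.filter (s x)).card ≤ n) :
    (C.filter fun y => ∃ x ∈ B, r x ∧ s x y).card ≤ m * n :=
  calc (C.filter fun y => ∃ x ∈ B, r x ∧ s x y).card
      ≤ ((B.filter r).biUnion fun x => C.filter (s x)).card :=
        Finset.card_le_card fun y hy => by
          obtain ⟨hyC, x, hx, hrx, hxy⟩ := Finset.mem_filter.1 hy
          exact Finset.mem_biUnion.2
            ⟨x, Finset.mem_filter.2 ⟨hx, hrx⟩, Finset.mem_filter.2 ⟨hyC, hxy⟩⟩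
    _ ≤ (B.filter r).card * n :=
        Finset.card_biUnion_le_card_mul _ _ n fun x hx => hs x (Finset.mem_filter.1 hx).1
    _ ≤ m * n := Nat.mul_le_mul_right n hr

end FiniteSets

section EvenSets

variable {ι E : Type*} {I : Finset ι} {A : ι → Finset E} {D D' : Finset E}

lemma two_le_card_inter_of_even {B : Finset E} (h : Even (B ∩ D).card) (hne : (B ∩ D).Nonempty) :
    2 ≤ (B ∩ D).card := by
  have := hne.card_pos
  obtain ⟨r, hr⟩ := h
  omega

lemma card_inter_eq_two_of_even {B : Finset E} (hD : D.card ≤ 3) (h : Even (B ∩ D).card)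
    (hne : (B ∩ D).Nonempty) : (B ∩ D).card = 2 := by
  have hge := two_le_card_inter_of_even h hne
  have hle := (Finset.card_le_card (Finset.inter_subset_right (s₁ := B))).trans hD
  obtain ⟨r, hr⟩ := h
  omega

-- Otherwise the four sets through `e` or `g` have at least eight incidences with `D`, but there
-- are at most six.
lemma exists_mem_and_mem_of_even (hD : D.card ≤ 3)
    (hcard : ∀ e ∈ D, (I.filter fun i => e ∈ A i).card = 2)
    (heven : ∀ i ∈ I, Even (A i ∩ D).card) {e g : E} (he : e ∈ D) (hg : g ∈ D) :
    ∃ i ∈ I, e ∈ A i ∧ g ∈ A i := by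
  by_contra! hdisj
  set J := I.filter fun i => e ∈ A i ∨ g ∈ A i
  have card_J : J.card = 4 := by
    simp only [J]
    rw [Finset.filter_or, Finset.card_union_of_disjoint (Finset.disjoint_filter.2 hdisj),
      hcard e he, hcard g hg]
  have two_le : ∀ i ∈ J, 2 ≤ (A i ∩ D).card := by
    intro i hi
    obtain ⟨hi, hmem⟩ := Finset.mem_filter.1 hi
    refine two_le_card_inter_of_even (heven i hi) (hmem.elim (fun h => ⟨e, ?_⟩) fun h => ⟨g, ?_⟩)
    exacts [Finset.mem_inter.2 ⟨h, he⟩, Finset.mem_inter.2 ⟨h, hg⟩]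
  have incidences : ∑ i ∈ I, (A i ∩ D).card = D.card * 2 :=
    sum_card_eq_mul_of_card_filter_eq (fun _ _ => Finset.inter_subset_right) fun e he => by
      simpa only [Finset.mem_inter, he, and_true] using hcard e he
  have : J.card * 2 ≤ D.card * 2 := calc
    J.card * 2 ≤ ∑ i ∈ J, (A i ∩ D).card := by simpa using Finset.card_nsmul_le_sum J _ 2 two_le
    _ ≤ ∑ i ∈ I, (A i ∩ D).card := Finset.sum_le_sum_of_subset (Finset.filter_subset _ _)
    _ = D.card * 2 := incidences
  omega

lemma two_le_card_of_even (hcover : ∀ e ∈ D, ∃ i ∈ I, e ∈ A i)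
    (heven : ∀ i ∈ I, Even (A i ∩ D).card) (hne : D.Nonempty) : 2 ≤ D.card := by
  obtain ⟨e, he⟩ := hne
  obtain ⟨i, hi, hei⟩ := hcover e he
  exact (two_le_card_inter_of_even (heven i hi) ⟨e, Finset.mem_inter.2 ⟨hei, he⟩⟩).trans
    (Finset.card_le_card Finset.inter_subset_right)

lemma eq_of_subset_of_even (hD : D.card ≤ 3) (hcover : ∀ e ∈ D, ∃ i ∈ I, e ∈ A i)
    (heven : ∀ i ∈ I, Even (A i ∩ D).card) (hsub : D' ⊆ D) (hne : D'.Nonempty)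
    (heven' : ∀ i ∈ I, Even (A i ∩ D').card) : D' = D := by
  by_contra hne'
  have hrest : (D \ D').Nonempty :=
    Finset.sdiff_nonempty.2 fun h => hne' (hsub.antisymm h)
  have heven_rest : ∀ i ∈ I, Even (A i ∩ (D \ D')).card := fun i hi => by
    rw [show A i ∩ (D \ D') = (A i ∩ D) \ (A i ∩ D') from inf_sdiff_distrib_left _ _ _]
    exact even_card_sdiff (Finset.inter_subset_inter_left hsub) (heven i hi) (heven' i hi)
  have card_part := two_le_card_of_even (fun e he => hcover e (hsub he)) heven' hne
  have card_rest :=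
    two_le_card_of_even (fun e he => hcover e (Finset.sdiff_subset he)) heven_rest hrest
  have := Finset.card_sdiff_add_card_eq_card hsub
  omega

lemma even_card_of_involutive {s : Finset ι} {f : ι → ι} (hf : ∀ a ∈ s, f a ∈ s)
    (hinv : Function.Involutive f) (hne : ∀ a, f a ≠ a) : Even s.card := by
  have hsum := Finset.sum_involution (s := s) (f := fun _ => (1 : ZMod 2)) (fun a _ => f a)
    (fun a _ => by decide) (fun a _ _ => hne a) hf (fun a _ => hinv a)
  rw [Finset.sum_const, nsmul_one] at hsum
  exact even_iff_two_dvd.2 ((ZMod.natCast_eq_zero_iff _ 2).1 hsum)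

end EvenSets

/-- A finite cubic multigraph without loops, given by its incidences. The vertices and edges are
finite sets in ambient types, so that contracting a set of vertices does not change the types. -/
structure CubicIncidence (V E : Type*) where
  verts : Finset V
  edges : Finset E
  /-- the edges at a vertex -/
  star : V → Finset E
  star_subset : ∀ v ∈ verts, star v ⊆ edges
  card_star : ∀ v ∈ verts, (star v).card = 3
  card_ends : ∀ e ∈ edges, (verts.filter fun v => e ∈ star v).card = 2

namespace CubicIncidence

variable {V E : Type*}

/-- The edge `e` joins the two different vertices `x` and `y`. -/
abbrev Joins (K : CubicIncidence V E) (e : E) (x y : V) : Prop :=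
  IsPairOf K.verts (fun v => e ∈ K.star v) x y

/-- The cut of a set `X` of vertices: the edges with exactly one end in `X`. -/
noncomputable abbrev cut (K : CubicIncidence V E) (X : Finset V) : Finset E :=
  oddPart K.edges X K.star

/-- Two edges have a common end. -/
def Meets (K : CubicIncidence V E) (a b : E) : Prop :=
  ∃ v ∈ K.verts, a ∈ K.star v ∧ b ∈ K.star v

variable {K : CubicIncidence V E} {X : Finset V} {v x y : V} {a b c e : E}

lemma exists_joins (he : e ∈ K.edges) : ∃ x y, K.Joins e x y :=
  exists_isPairOf (K.card_ends e he)

lemma exists_joins_left (hx : x ∈ K.verts) (hex : e ∈ K.star x) : ∃ y, K.Joins e x y :=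
  exists_isPairOf_left (K.card_ends e (K.star_subset x hx hex)) hx hex

lemma Joins.mem_edges (h : K.Joins e x y) : e ∈ K.edges :=
  K.star_subset x h.left_mem h.left

lemma Meets.symm (h : K.Meets a b) : K.Meets b a :=
  let ⟨v, hv, ha, hb⟩ := h
  ⟨v, hv, hb, ha⟩

lemma Meets.refl (he : e ∈ K.edges) : K.Meets e e :=
  let ⟨x, _, h⟩ := exists_joins he
  ⟨x, h.left_mem, h.left, h.left⟩

lemma exists_star_eq_triple (hv : v ∈ K.verts) (ha : a ∈ K.star v) :
    ∃ b c, a ≠ b ∧ a ≠ c ∧ b ≠ c ∧ K.star v = {a, b, c} := by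
  have card_rest : ((K.star v).erase a).card = 2 := by
    rw [Finset.card_erase_of_mem ha, K.card_star v hv]
  obtain ⟨b, c, hbc, h⟩ := Finset.card_eq_two.1 card_rest
  refine ⟨b, c, ?_, ?_, hbc, by rw [← h, Finset.insert_erase ha]⟩
  · exact (Finset.ne_of_mem_erase (h ▸ Finset.mem_insert_self b {c})).symm
  · exact (Finset.ne_of_mem_erase (h ▸ Finset.mem_insert_of_mem (Finset.mem_singleton_self c))).symm

lemma exists_star_eq_insert_pair (hv : v ∈ K.verts) (ha : a ∈ K.star v) (hb : b ∈ K.star v)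
    (hab : a ≠ b) : ∃ c, a ≠ c ∧ b ≠ c ∧ K.star v = {a, b, c} := by
  obtain ⟨b', c', hab', hac', hbc', hs⟩ := exists_star_eq_triple hv ha
  have hb' : b = b' ∨ b = c' := by simpa [hs, hab.symm] using hb
  rcases hb' with rfl | rfl
  · exact ⟨c', hac', hbc', hs⟩
  · exact ⟨b', hab', hbc'.symm, by rw [hs, Finset.pair_comm]⟩

lemma three_mul_card_verts : 3 * K.verts.card = 2 * K.edges.card := by
  have := sum_card_eq_mul_of_card_filter_eq K.star_subset K.card_ends
  rw [Finset.sum_const_nat K.card_star] at this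
  omega

section Cut

lemma cut_subset (X : Finset V) : K.cut X ⊆ K.edges := Finset.filter_subset _ _

lemma Joins.mem_cut_iff (h : K.Joins e x y) (hX : X ⊆ K.verts) :
    e ∈ K.cut X ↔ (x ∈ X ↔ y ∉ X) := by
  rw [mem_oddPart, h.odd_card_filter_iff hX, and_iff_right h.mem_edges]

lemma cut_compl (hX : X ⊆ K.verts) : K.cut (K.verts \ X) = K.cut X := by
  ext e
  by_cases he : e ∈ K.edges
  · obtain ⟨x, y, h⟩ := exists_joins he
    rw [h.mem_cut_iff hX, h.mem_cut_iff Finset.sdiff_subset]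
    simp only [Finset.mem_sdiff, h.left_mem, h.right_mem, true_and]
    tauto
  · exact iff_of_false (mt (@cut_subset _ _ _ _ e) he) (mt (@cut_subset _ _ _ _ e) he)

lemma cut_singleton (hv : v ∈ K.verts) : K.cut {v} = K.star v := by
  ext e
  rw [mem_oddPart, Finset.filter_singleton]
  by_cases h : e ∈ K.star v
  · simp [h, K.star_subset v hv h]
  · simp [h]

lemma even_card_cut_iff (hX : X ⊆ K.verts) : Even (K.cut X).card ↔ Even X.card := by
  have hsum : ∑ v ∈ X, (K.star v ∩ K.edges).card = X.card * 3 := Finset.sum_const_nat fun v hv => by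
    rw [Finset.inter_eq_left.2 (K.star_subset v (hX hv)), K.card_star v (hX hv)]
  have hcut := even_card_inter_oddPart_iff (I := X) (A := K.star) (subset_refl K.edges)
  rw [Finset.inter_eq_right.2 (cut_subset X), hsum, Nat.even_mul] at hcut
  simpa [show ¬ Even 3 by decide] using hcut

end Cut

/-! ### Even sets, circuits and double covers -/

/-- An even set of edges, i.e. an element of the cycle space. -/
structure IsEven (K : CubicIncidence V E) (C : Finset E) : Prop where
  subset : C ⊆ K.edges
  even_inter_star : ∀ v ∈ K.verts, Even (C ∩ K.star v).card

/-- A circuit, as a set of edges: a minimal nonempty even set. -/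
structure IsCircuit (K : CubicIncidence V E) (C : Finset E) : Prop where
  isEven : K.IsEven C
  nonempty : C.Nonempty
  minimal : ∀ D ⊆ C, K.IsEven D → D = ∅ ∨ D = C

/-- A circuit double cover without repeated circuits. For lower bounds on the number of circuit
double covers there is no loss in leaving out multiplicities. -/
structure IsCDC (K : CubicIncidence V E) (𝒞 : Finset (Finset E)) : Prop where
  isCircuit : ∀ C ∈ 𝒞, K.IsCircuit C
  card_eq_two : ∀ e ∈ K.edges, (𝒞.filter fun C => e ∈ C).card = 2

/-- The set of all circuit double covers. -/
noncomputable def cdcs (K : CubicIncidence V E) : Finset (Finset (Finset E)) :=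
  K.edges.powerset.powerset.filter K.IsCDC

/-- A double cover by even sets, given as a family; its members need not be circuits. -/
structure IsEvenDoubleCover {ι : Type*} (K : CubicIncidence V E) (I : Finset ι)
    (A : ι → Finset E) : Prop where
  isEven : ∀ i ∈ I, K.IsEven (A i)
  card_eq_two : ∀ e ∈ K.edges, (I.filter fun i => e ∈ A i).card = 2

/-- Some member of the family `A` contains the edges `a`, `e` and `b`. When these are the edges of
a path, this is the information that tells circuit double covers apart. -/
def CoversTriple {ι : Type*} (I : Finset ι) (A : ι → Finset E) (a e b : E) : Prop :=
  ∃ i ∈ I, a ∈ A i ∧ e ∈ A i ∧ b ∈ A i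

lemma mem_cdcs {𝒞 : Finset (Finset E)} : 𝒞 ∈ K.cdcs ↔ K.IsCDC 𝒞 := by
  simp only [cdcs, Finset.mem_filter, Finset.mem_powerset, and_iff_right_iff_imp]
  exact fun h C hC => Finset.mem_powerset.2 (h.isCircuit C hC).isEven.subset

lemma IsCDC.isEvenDoubleCover {𝒞 : Finset (Finset E)} (h : K.IsCDC 𝒞) :
    K.IsEvenDoubleCover 𝒞 id :=
  ⟨fun C hC => (h.isCircuit C hC).isEven, h.card_eq_two⟩

namespace IsEven

variable {A C C' D : Finset E}

lemma mem_triple_cases (hA : K.IsEven A) (hv : v ∈ K.verts) (hab : a ≠ b) (hac : a ≠ c)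
    (hbc : b ≠ c) (hs : K.star v = {a, b, c}) :
    (a ∈ A ∧ b ∈ A ∧ c ∉ A) ∨ (a ∈ A ∧ b ∉ A ∧ c ∈ A) ∨ (a ∉ A ∧ b ∈ A ∧ c ∈ A) ∨
      (a ∉ A ∧ b ∉ A ∧ c ∉ A) :=
  (even_card_inter_triple_iff hab hac hbc).1 (hs ▸ hA.even_inter_star v hv)

lemma mem_of_subset (hA : K.IsEven A) (hC : K.IsEven C) (hCA : C ⊆ A) (hv : v ∈ K.verts)
    (ha : a ∈ K.star v) (hb : b ∈ K.star v) (haC : a ∈ C) (hbA : b ∈ A) : b ∈ C := by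
  by_cases hab : a = b
  · exact hab ▸ haC
  obtain ⟨c, hac, hbc, hs⟩ := exists_star_eq_insert_pair hv ha hb hab
  have hA_cases := hA.mem_triple_cases hv hab hac hbc hs
  have hC_cases := hC.mem_triple_cases hv hab hac hbc hs
  have hcCA := @hCA c
  have haA := hCA haC
  tauto

lemma sdiff (hC : K.IsEven C) (hD : K.IsEven D) (hDC : D ⊆ C) : K.IsEven (C \ D) := by
  refine ⟨Finset.sdiff_subset.trans hC.subset, fun v hv => ?_⟩
  have inter_eq : (C \ D) ∩ K.star v = (C ∩ K.star v) \ (D ∩ K.star v) := by ext; simp; tauto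
  rw [inter_eq]
  exact even_card_sdiff (Finset.inter_subset_inter_right hDC) (hC.even_inter_star v hv)
    (hD.even_inter_star v hv)

lemma exists_isCircuit (hA : K.IsEven A) (he : e ∈ A) : ∃ C ⊆ A, K.IsCircuit C ∧ e ∈ C := by
  obtain ⟨C, hC, hmin⟩ := (A.powerset.filter fun C => K.IsEven C ∧ e ∈ C).exists_min_image
    Finset.card ⟨A, by simp [hA, he]⟩
  simp only [Finset.mem_filter, Finset.mem_powerset] at hC hmin
  obtain ⟨hCA, hCeven, heC⟩ := hC
  refine ⟨C, hCA, ⟨hCeven, ⟨e, heC⟩, fun D hDC hD => ?_⟩, heC⟩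
  by_cases heD : e ∈ D
  · exact .inr (Finset.eq_of_subset_of_card_le hDC (hmin D ⟨hDC.trans hCA, hD, heD⟩))
  · have hle := hmin (C \ D) ⟨Finset.sdiff_subset.trans hCA, hCeven.sdiff hD hDC,
      Finset.mem_sdiff.2 ⟨heC, heD⟩⟩
    rw [← Finset.eq_of_subset_of_card_le Finset.sdiff_subset hle]
    exact .inl (Finset.disjoint_self_iff_empty D |>.1 (by grind))

lemma inter_of_subset (hA : K.IsEven A) (hC : K.IsEven C) (hC' : K.IsEven C') (hCA : C ⊆ A)
    (hCA' : C' ⊆ A) : K.IsEven (C ∩ C') := by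
  refine ⟨Finset.inter_subset_left.trans hC.subset, fun v hv => ?_⟩
  by_cases hmeet : ∃ a ∈ K.star v, a ∈ C ∧ a ∈ C'
  · obtain ⟨a, ha, -, haC'⟩ := hmeet
    have inter_eq : C ∩ C' ∩ K.star v = C ∩ K.star v := by
      ext b
      simp only [Finset.mem_inter]
      exact ⟨fun h => ⟨h.1.1, h.2⟩, fun h => ⟨⟨h.1,
        hA.mem_of_subset hC' hCA' hv ha h.2 haC' (hCA h.1)⟩, h.2⟩⟩
    exact inter_eq ▸ hC.even_inter_star v hv
  · have inter_eq : C ∩ C' ∩ K.star v = ∅ := by grind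
    simp [inter_eq]

lemma isCircuit_unique (hA : K.IsEven A) (hCA : C ⊆ A) (hCA' : C' ⊆ A) (hC : K.IsCircuit C)
    (hC' : K.IsCircuit C') (he : e ∈ C) (he' : e ∈ C') : C = C' := by
  have hinter := hA.inter_of_subset hC.isEven hC'.isEven hCA hCA'
  have hne : C ∩ C' ≠ ∅ := Finset.ne_empty_of_mem (Finset.mem_inter.2 ⟨he, he'⟩)
  exact ((hC.minimal _ Finset.inter_subset_left hinter).resolve_left hne).symm.trans
    ((hC'.minimal _ Finset.inter_subset_right hinter).resolve_left hne)

lemma exists_adjacent_mem (hA : K.IsEven A) (hv : v ∈ K.verts) (ha : a ∈ K.star v) (haA : a ∈ A) :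
    ∃ b ∈ K.star v, a ≠ b ∧ b ∈ A := by
  obtain ⟨b, c, hab, hac, hbc, hs⟩ := exists_star_eq_triple hv ha
  rcases hA.mem_triple_cases hv hab hac hbc hs with h | h | h | h
  · exact ⟨b, by simp [hs], hab, h.2.1⟩
  · exact ⟨c, by simp [hs], hac, h.2.2⟩
  all_goals exact absurd haA h.1

end IsEven

variable {ι : Type*} {I : Finset ι} {A : ι → Finset E}

/-- The circuits contained in the members of the family `A`; these are the components of the
members when the members are even. -/
noncomputable def circuitRefinement (K : CubicIncidence V E) (I : Finset ι) (A : ι → Finset E) :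
    Finset (Finset E) :=
  K.edges.powerset.filter fun C => K.IsCircuit C ∧ ∃ i ∈ I, C ⊆ A i

lemma mem_circuitRefinement {C : Finset E} :
    C ∈ K.circuitRefinement I A ↔ K.IsCircuit C ∧ ∃ i ∈ I, C ⊆ A i := by
  simp only [circuitRefinement, Finset.mem_filter, Finset.mem_powerset, and_iff_right_iff_imp]
  exact fun h => h.1.isEven.subset

namespace IsEvenDoubleCover

lemma card_filter_pair (h : K.IsEvenDoubleCover I A) (hv : v ∈ K.verts) (ha : a ∈ K.star v)
    (hb : b ∈ K.star v) (hab : a ≠ b) : (I.filter fun i => a ∈ A i ∧ b ∈ A i).card = 1 := by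
  obtain ⟨c, hac, hbc, hs⟩ := exists_star_eq_insert_pair hv ha hb hab
  have hcv : c ∈ K.star v := by simp [hs]
  refine card_filter_pair_eq_one hab hac hbc
    (fun i hi => hs ▸ (h.isEven i hi).even_inter_star v hv) ?_ ?_ ?_
  all_goals exact h.card_eq_two _ (K.star_subset v hv ‹_›)

lemma eq_of_mem_pair (h : K.IsEvenDoubleCover I A) (hv : v ∈ K.verts) (ha : a ∈ K.star v)
    (hb : b ∈ K.star v) (hab : a ≠ b) {i j : ι} (hi : i ∈ I) (hj : j ∈ I)
    (hai : a ∈ A i) (hbi : b ∈ A i) (haj : a ∈ A j) (hbj : b ∈ A j) : i = j :=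
  Finset.card_le_one.1 (h.card_filter_pair hv ha hb hab).le i (by simp [hi, hai, hbi]) j
    (by simp [hj, haj, hbj])

lemma index_unique (h : K.IsEvenDoubleCover I A) {C : Finset E} (hC : K.IsCircuit C) {i j : ι}
    (hi : i ∈ I) (hj : j ∈ I) (hCi : C ⊆ A i) (hCj : C ⊆ A j) : i = j := by
  obtain ⟨e, he⟩ := hC.nonempty
  obtain ⟨v, _, hends⟩ := exists_joins (hC.isEven.subset he)
  obtain ⟨b, hb, heb, hbC⟩ := hC.isEven.exists_adjacent_mem hends.left_mem hends.left he
  exact h.eq_of_mem_pair hends.left_mem hends.left hb heb hi hj (hCi he) (hCi hbC) (hCj he)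
    (hCj hbC)

lemma isCDC_circuitRefinement (h : K.IsEvenDoubleCover I A) :
    K.IsCDC (K.circuitRefinement I A) := by
  refine ⟨fun C hC => (mem_circuitRefinement.1 hC).1, fun e he => ?_⟩
  obtain ⟨i, j, hij⟩ := exists_isPairOf (h.card_eq_two e he)
  obtain ⟨C, hCi, hC, heC⟩ := (h.isEven i hij.left_mem).exists_isCircuit hij.left
  obtain ⟨C', hCj, hC', heC'⟩ := (h.isEven j hij.right_mem).exists_isCircuit hij.right
  have hne : C ≠ C' := by
    rintro rfl
    exact hij.ne (h.index_unique hC hij.left_mem hij.right_mem hCi hCj)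
  refine Finset.card_eq_two.2 ⟨C, C', hne, ?_⟩
  ext D
  simp only [Finset.mem_filter, mem_circuitRefinement, Finset.mem_insert, Finset.mem_singleton]
  constructor
  · rintro ⟨⟨hD, k, hk, hDk⟩, heD⟩
    rcases (hij.iff k hk).1 (hDk heD) with rfl | rfl
    · exact .inl ((h.isEven k hk).isCircuit_unique hDk hCi hD hC heD heC)
    · exact .inr ((h.isEven k hk).isCircuit_unique hDk hCj hD hC' heD heC')
  · rintro (rfl | rfl)
    · exact ⟨⟨hC, i, hij.left_mem, hCi⟩, heC⟩
    · exact ⟨⟨hC', j, hij.right_mem, hCj⟩, heC'⟩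

lemma coversTriple_circuitRefinement_iff (h : K.IsEvenDoubleCover I A) (hae : K.Meets a e)
    (heb : K.Meets e b) :
    CoversTriple (K.circuitRefinement I A) id a e b ↔ CoversTriple I A a e b := by
  obtain ⟨u, hu, hau, heu⟩ := hae
  obtain ⟨v, hv, hev, hbv⟩ := heb
  constructor
  · rintro ⟨C, hC, ha, he, hb⟩
    obtain ⟨-, i, hi, hCi⟩ := mem_circuitRefinement.1 hC
    exact ⟨i, hi, hCi ha, hCi he, hCi hb⟩
  · rintro ⟨i, hi, ha, he, hb⟩
    obtain ⟨C, hCi, hC, heC⟩ := (h.isEven i hi).exists_isCircuit he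
    exact ⟨C, mem_circuitRefinement.2 ⟨hC, i, hi, hCi⟩,
      (h.isEven i hi).mem_of_subset hC.isEven hCi hu heu hau heC ha, heC,
      (h.isEven i hi).mem_of_subset hC.isEven hCi hv hev hbv heC hb⟩

end IsEvenDoubleCover

lemma card_le_card_cdcs {σ : Type*} (S : Finset σ) (I : σ → Finset ι) (A : σ → ι → Finset E)
    (h : ∀ s ∈ S, K.IsEvenDoubleCover (I s) (A s))
    (hsep : ∀ s ∈ S, ∀ t ∈ S, s ≠ t → ∃ a e b, K.Meets a e ∧ K.Meets e b ∧
      ¬ (CoversTriple (I s) (A s) a e b ↔ CoversTriple (I t) (A t) a e b)) :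
    S.card ≤ K.cdcs.card := by
  refine Finset.card_le_card_of_injOn (fun s => K.circuitRefinement (I s) (A s))
    (fun s hs => mem_cdcs.2 (h s hs).isCDC_circuitRefinement) fun s hs t ht hst => ?_
  by_contra hne
  obtain ⟨a, e, b, hae, heb, hdiff⟩ := hsep s hs t ht hne
  refine hdiff ?_
  rw [← (h s hs).coversTriple_circuitRefinement_iff hae heb,
    ← (h t ht).coversTriple_circuitRefinement_iff hae heb]
  exact iff_of_eq (congrArg (CoversTriple · id a e b) hst)

end CubicIncidence

/-! ### Contraction of one side of a cut of three edges -/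

namespace CubicIncidence

variable {V E : Type*} {K : CubicIncidence V E} {S X : Finset V} {s t v x y : V} {e : E}
  {C D : Finset E}

/-- The edges with an end outside `S`. -/
noncomputable def outer (K : CubicIncidence V E) (S : Finset V) : Finset E :=
  K.edges.filter fun e => ∃ v ∈ K.verts \ S, e ∈ K.star v

/-- The map that contracts `S` to the vertex `s`. -/
noncomputable def collapse (S : Finset V) (s v : V) : V := if v ∈ S then s else v

/-- `S` is one side of a cut of three edges, and `s` is a vertex of `S`; it stands for `S` after
the contraction. -/
structure IsContractible (K : CubicIncidence V E) (S : Finset V) (s : V) : Prop where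
  subset : S ⊆ K.verts
  card_cut : (K.cut S).card = 3
  mem : s ∈ S

lemma outer_subset (S : Finset V) : K.outer S ⊆ K.edges := Finset.filter_subset _ _

lemma Joins.mem_outer_iff (h : K.Joins e x y) : e ∈ K.outer S ↔ x ∉ S ∨ y ∉ S := by
  simp only [outer, Finset.mem_filter, Finset.mem_sdiff, h.mem_edges, true_and]
  have := h.iff
  have := h.left_mem
  have := h.right_mem
  grind

lemma cut_subset_outer (hS : S ⊆ K.verts) : K.cut S ⊆ K.outer S := by
  intro e he
  obtain ⟨x, y, h⟩ := exists_joins (cut_subset S he)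
  rw [h.mem_cut_iff hS] at he
  rw [h.mem_outer_iff]
  tauto

lemma star_subset_outer (hv : v ∈ K.verts) (hvS : v ∉ S) : K.star v ⊆ K.outer S := fun _ he =>
  Finset.mem_filter.2 ⟨K.star_subset v hv he, v, Finset.mem_sdiff.2 ⟨hv, hvS⟩, he⟩

lemma outer_union_outer_compl (S : Finset V) : K.outer S ∪ K.outer (K.verts \ S) = K.edges := by
  refine (Finset.union_subset (outer_subset _) (outer_subset _)).antisymm fun e he => ?_
  obtain ⟨x, y, h⟩ := exists_joins he
  rw [Finset.mem_union, h.mem_outer_iff, h.mem_outer_iff]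
  simp only [Finset.mem_sdiff]
  tauto

lemma outer_inter_outer_compl (hS : S ⊆ K.verts) :
    K.outer S ∩ K.outer (K.verts \ S) = K.cut S := by
  ext e
  by_cases he : e ∈ K.edges
  · obtain ⟨x, y, h⟩ := exists_joins he
    rw [Finset.mem_inter, h.mem_outer_iff, h.mem_outer_iff, h.mem_cut_iff hS]
    simp only [Finset.mem_sdiff, h.left_mem, h.right_mem]
    tauto
  · exact iff_of_false (fun h => he (outer_subset _ (Finset.mem_inter.1 h).1))
      fun h => he (cut_subset _ h)

lemma collapse_of_mem (hv : v ∈ S) : collapse S s v = s := if_pos hv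

lemma collapse_of_notMem (hv : v ∉ S) : collapse S s v = v := if_neg hv

lemma collapse_mem (hv : v ∈ K.verts) : collapse S s v ∈ insert s (K.verts \ S) := by
  by_cases hvS : v ∈ S
  · simp [collapse_of_mem hvS]
  · simp [collapse_of_notMem hvS, hv, hvS]

namespace IsContractible

lemma compl (h : K.IsContractible S s) (ht : t ∈ K.verts \ S) :
    K.IsContractible (K.verts \ S) t :=
  ⟨Finset.sdiff_subset, (cut_compl h.subset).symm ▸ h.card_cut, ht⟩

lemma update_star_of_notMem (h : K.IsContractible S s) (hv : v ∉ S) :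
    Function.update K.star s (K.cut S) v = K.star v :=
  Function.update_of_ne (ne_of_mem_of_not_mem h.mem hv).symm _ _

lemma isPairOf_collapse (h : K.IsContractible S s) (hxy : K.Joins e x y) (he : e ∈ K.outer S) :
    IsPairOf (insert s (K.verts \ S)) (fun v => e ∈ Function.update K.star s (K.cut S) v)
      (collapse S s x) (collapse S s y) := by
  have hout := hxy.mem_outer_iff.1 he
  have hne := hxy.ne
  have hs := h.mem
  refine ⟨collapse_mem hxy.left_mem, collapse_mem hxy.right_mem, by grind [collapse],
    fun v hv => ?_⟩
  rcases Finset.mem_insert.1 hv with rfl | hv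
  · rw [Function.update_self, hxy.mem_cut_iff h.subset]
    grind [collapse]
  · obtain ⟨hvK, hvS⟩ := Finset.mem_sdiff.1 hv
    rw [h.update_star_of_notMem hvS, hxy.iff v hvK]
    grind [collapse]

end IsContractible

/-- The contraction of `S` to the vertex `s`, whose edges are then those of the cut of `S`. -/
noncomputable def contract (K : CubicIncidence V E) (h : K.IsContractible S s) :
    CubicIncidence V E where
  verts := insert s (K.verts \ S)
  edges := K.outer S
  star := Function.update K.star s (K.cut S)
  star_subset v hv := by
    rcases Finset.mem_insert.1 hv with rfl | hv
    · simpa only [Function.update_self] using cut_subset_outer h.subset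
    · obtain ⟨hvK, hvS⟩ := Finset.mem_sdiff.1 hv
      exact h.update_star_of_notMem hvS ▸ star_subset_outer hvK hvS
  card_star v hv := by
    rcases Finset.mem_insert.1 hv with rfl | hv
    · simpa only [Function.update_self] using h.card_cut
    · obtain ⟨hvK, hvS⟩ := Finset.mem_sdiff.1 hv
      rw [h.update_star_of_notMem hvS, K.card_star v hvK]
  card_ends e he := by
    obtain ⟨x, y, hxy⟩ := exists_joins (outer_subset _ he)
    exact (h.isPairOf_collapse hxy he).card_filter

lemma star_contract_self (h : K.IsContractible S s) : (K.contract h).star s = K.cut S := by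
  simp only [contract, Function.update_self]

lemma forall_mem_verts_contract (h : K.IsContractible S s) {p : V → Finset E → Prop} :
    (∀ v ∈ (K.contract h).verts, p v ((K.contract h).star v)) ↔
      p s (K.cut S) ∧ ∀ v ∈ K.verts, v ∉ S → p v (K.star v) := by
  simp only [contract, Finset.forall_mem_insert, Function.update_self, Finset.mem_sdiff, and_imp]
  refine and_congr_right fun _ => forall₃_congr fun v _ hvS => ?_
  rw [h.update_star_of_notMem hvS]

lemma card_verts_contract (h : K.IsContractible S s) :
    (K.contract h).verts.card = (K.verts \ S).card + 1 :=
  Finset.card_insert_of_notMem (by simp [h.mem])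

lemma cut_contract (h : K.IsContractible S s) (hX : X ⊆ (K.contract h).verts) :
    (K.contract h).cut X = K.cut (K.verts.filter fun v => collapse S s v ∈ X) := by
  ext e
  by_cases heK : e ∈ K.edges
  · obtain ⟨x, y, hxy⟩ := exists_joins heK
    rw [hxy.mem_cut_iff (Finset.filter_subset _ _)]
    simp only [Finset.mem_filter, hxy.left_mem, hxy.right_mem, true_and]
    by_cases he : e ∈ K.outer S
    · have hxy' : (K.contract h).Joins e _ _ := h.isPairOf_collapse hxy he
      exact hxy'.mem_cut_iff hX
    · have hmem : x ∈ S ∧ y ∈ S := by rw [hxy.mem_outer_iff] at he; tauto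
      rw [collapse_of_mem hmem.1, collapse_of_mem hmem.2]
      exact iff_of_false (fun he' => he (cut_subset (K := K.contract h) X he')) (by tauto)
  · exact iff_of_false
      (fun he => heK (outer_subset _ (cut_subset (K := K.contract h) X he)))
      fun he => heK (cut_subset _ he)

lemma isEven_contract_iff (h : K.IsContractible S s) : (K.contract h).IsEven C ↔
    C ⊆ K.outer S ∧ Even (C ∩ K.cut S).card ∧
      ∀ v ∈ K.verts, v ∉ S → Even (C ∩ K.star v).card := by
  rw [← forall_mem_verts_contract h (p := fun _ A => Even (C ∩ A).card)]
  exact ⟨fun hC => ⟨hC.subset, hC.even_inter_star⟩, fun hC => ⟨hC.1, hC.2⟩⟩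

lemma IsEven.even_inter_cut (hC : K.IsEven C) (hX : X ⊆ K.verts) : Even (C ∩ K.cut X).card :=
  even_card_inter_oddPart hC.subset fun v hv => by
    rw [Finset.inter_comm]
    exact hC.even_inter_star v (hX hv)

lemma IsEven.contract (hC : K.IsEven C) (h : K.IsContractible S s) :
    (K.contract h).IsEven (C ∩ K.outer S) := by
  refine (isEven_contract_iff h).2 ⟨Finset.inter_subset_right, ?_, fun v hv hvS => ?_⟩
  · rw [Finset.inter_assoc, Finset.inter_eq_right.2 (cut_subset_outer h.subset)]
    exact hC.even_inter_cut h.subset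
  · rw [Finset.inter_assoc, Finset.inter_eq_right.2 (star_subset_outer hv hvS)]
    exact hC.even_inter_star v hv

lemma IsEven.even_inter_star_of_contract {h : K.IsContractible S s}
    (hC : (K.contract h).IsEven (C ∩ K.outer S)) (hv : v ∈ K.verts) (hvS : v ∉ S) :
    Even (C ∩ K.star v).card := by
  have := ((isEven_contract_iff h).1 hC).2.2 v hv hvS
  rwa [Finset.inter_assoc, Finset.inter_eq_right.2 (star_subset_outer hv hvS)] at this

lemma isEven_of_contract {h : K.IsContractible S s} {h' : K.IsContractible (K.verts \ S) t}
    (hC : C ⊆ K.edges) (hC₁ : (K.contract h).IsEven (C ∩ K.outer S))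
    (hC₂ : (K.contract h').IsEven (C ∩ K.outer (K.verts \ S))) : K.IsEven C := by
  refine ⟨hC, fun v hv => ?_⟩
  by_cases hvS : v ∈ S
  · exact hC₂.even_inter_star_of_contract hv (by simp [hvS])
  · exact hC₁.even_inter_star_of_contract hv hvS

end CubicIncidence

/-! ### Gluing families of sets along their common elements -/

/-- The sets that restrict to members of `𝒞₁` on `E₁` and to members of `𝒞₂` on `E₂`; a set that
avoids `E₁ ∩ E₂` lies on one side only. -/
noncomputable def glue {E : Type*} (E₁ E₂ : Finset E) (𝒞₁ 𝒞₂ : Finset (Finset E)) :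
    Finset (Finset E) :=
  (E₁ ∪ E₂).powerset.filter fun D => D.Nonempty ∧ (D ∩ E₁ = ∅ ∨ D ∩ E₁ ∈ 𝒞₁) ∧
    (D ∩ E₂ = ∅ ∨ D ∩ E₂ ∈ 𝒞₂) ∧ (D ∩ (E₁ ∩ E₂) = ∅ → D ∩ E₁ = ∅ ∨ D ∩ E₂ = ∅)

/-- Every member of `𝒞₁` that contains an element of `E₁ ∩ E₂` has a unique partner in `𝒞₂` with
the same elements there. -/
def HasPartners {E : Type*} (E₁ E₂ : Finset E) (𝒞₁ 𝒞₂ : Finset (Finset E)) : Prop :=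
  ∀ C ∈ 𝒞₁, (C ∩ (E₁ ∩ E₂)).Nonempty →
    ∃! C', C' ∈ 𝒞₂ ∧ C' ∩ (E₁ ∩ E₂) = C ∩ (E₁ ∩ E₂)

section Glue

variable {E : Type*} {E₁ E₂ C D D' X : Finset E} {𝒞₁ 𝒞₂ : Finset (Finset E)} {e : E}

lemma mem_glue : D ∈ glue E₁ E₂ 𝒞₁ 𝒞₂ ↔ D ⊆ E₁ ∪ E₂ ∧ D.Nonempty ∧
    (D ∩ E₁ = ∅ ∨ D ∩ E₁ ∈ 𝒞₁) ∧ (D ∩ E₂ = ∅ ∨ D ∩ E₂ ∈ 𝒞₂) ∧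
      (D ∩ (E₁ ∩ E₂) = ∅ → D ∩ E₁ = ∅ ∨ D ∩ E₂ = ∅) := by
  simp only [glue, Finset.mem_filter, Finset.mem_powerset]

lemma glue_comm : glue E₁ E₂ 𝒞₁ 𝒞₂ = glue E₂ E₁ 𝒞₂ 𝒞₁ := by
  ext D
  rw [mem_glue, mem_glue, Finset.union_comm, Finset.inter_comm E₁ E₂]
  tauto

lemma inter_eq_of_mem_glue (hD : D ∈ glue E₁ E₂ 𝒞₁ 𝒞₂) (hne : (D ∩ E₁).Nonempty) :
    D ∩ E₁ ∈ 𝒞₁ :=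
  (mem_glue.1 hD).2.2.1.resolve_left hne.ne_empty

lemma exists_mem_glue (h₁ : ∀ C ∈ 𝒞₁, C ⊆ E₁ ∧ C.Nonempty) (h₂ : ∀ C ∈ 𝒞₂, C ⊆ E₂)
    (hp : HasPartners E₁ E₂ 𝒞₁ 𝒞₂) (hC : C ∈ 𝒞₁) : ∃ D ∈ glue E₁ E₂ 𝒞₁ 𝒞₂, D ∩ E₁ = C := by
  obtain ⟨hCE, hne⟩ := h₁ C hC
  by_cases hδ : (C ∩ (E₁ ∩ E₂)).Nonempty
  · obtain ⟨C', ⟨hC', hCC'⟩, -⟩ := hp C hC hδ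
    have hCE' := h₂ C' hC'
    have inter_left : (C ∪ C') ∩ E₁ = C := by grind
    have inter_right : (C ∪ C') ∩ E₂ = C' := by grind
    refine ⟨C ∪ C', mem_glue.2 ⟨Finset.union_subset_union hCE hCE', hne.mono
      Finset.subset_union_left, .inr (by rwa [inter_left]), .inr (by rwa [inter_right]),
      fun h => absurd h ?_⟩, inter_left⟩
    exact (hδ.mono (Finset.inter_subset_inter_right Finset.subset_union_left)).ne_empty
  · rw [Finset.not_nonempty_iff_eq_empty] at hδ
    have inter_left : C ∩ E₁ = C := Finset.inter_eq_left.2 hCE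
    have inter_right : C ∩ E₂ = ∅ := by rw [← hδ, ← Finset.inter_assoc, inter_left]
    exact ⟨C, mem_glue.2 ⟨hCE.trans Finset.subset_union_left, hne, .inr (inter_left.symm ▸ hC),
      .inl inter_right, fun _ => .inr inter_right⟩, inter_left⟩

lemma eq_of_inter_eq_of_mem_glue (hp : HasPartners E₁ E₂ 𝒞₁ 𝒞₂) (hD : D ∈ glue E₁ E₂ 𝒞₁ 𝒞₂)
    (hD' : D' ∈ glue E₁ E₂ 𝒞₁ 𝒞₂) (hDD' : D ∩ E₁ = D' ∩ E₁) (hne : (D ∩ E₁).Nonempty) :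
    D = D' := by
  have hC := inter_eq_of_mem_glue hD hne
  obtain ⟨hDE, -, -, hD₂, hDδ⟩ := mem_glue.1 hD
  obtain ⟨hDE', -, -, hD₂', hDδ'⟩ := mem_glue.1 hD'
  suffices inter_right : D ∩ E₂ = D' ∩ E₂ by
    rw [← Finset.inter_eq_left.2 hDE, ← Finset.inter_eq_left.2 hDE',
      Finset.inter_union_distrib_left, Finset.inter_union_distrib_left, hDD', inter_right]
  have common_eq : D ∩ (E₁ ∩ E₂) = D' ∩ (E₁ ∩ E₂) := by
    rw [← Finset.inter_assoc, hDD', Finset.inter_assoc]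
  by_cases hδ : D ∩ (E₁ ∩ E₂) = ∅
  · rw [(hDδ hδ).resolve_left hne.ne_empty,
      (hDδ' (common_eq ▸ hδ)).resolve_left (hDD' ▸ hne.ne_empty)]
  · have hsub : ∀ Y : Finset E, Y ∩ (E₁ ∩ E₂) ⊆ Y ∩ E₂ := fun Y =>
      Finset.inter_subset_inter_left Finset.inter_subset_right
    have common_left : D ∩ E₁ ∩ (E₁ ∩ E₂) = D ∩ (E₁ ∩ E₂) := by ext; simp
    have common_right : ∀ Y : Finset E, Y ∩ E₂ ∩ (E₁ ∩ E₂) = Y ∩ (E₁ ∩ E₂) := by intro Y; ext; simp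
    have hne₂ : D ∩ E₂ ≠ ∅ := fun h => hδ (Finset.subset_empty.1 (h ▸ hsub D))
    have hne₂' : D' ∩ E₂ ≠ ∅ := fun h => hδ (Finset.subset_empty.1 (common_eq ▸ h ▸ hsub D'))
    refine (hp _ hC ?_).unique ⟨hD₂.resolve_left hne₂, ?_⟩ ⟨hD₂'.resolve_left hne₂', ?_⟩
    · rwa [common_left, Finset.nonempty_iff_ne_empty]
    · rw [common_left, common_right]
    · rw [common_left, common_right, common_eq]

lemma card_filter_mem_glue (h₁ : ∀ C ∈ 𝒞₁, C ⊆ E₁ ∧ C.Nonempty) (h₂ : ∀ C ∈ 𝒞₂, C ⊆ E₂)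
    (hp : HasPartners E₁ E₂ 𝒞₁ 𝒞₂) (he : e ∈ E₁) :
    ((glue E₁ E₂ 𝒞₁ 𝒞₂).filter (e ∈ ·)).card = (𝒞₁.filter (e ∈ ·)).card := by
  have hmem : ∀ D, e ∈ D ∩ E₁ ↔ e ∈ D := by simp [he]
  refine Finset.card_nbij (· ∩ E₁) (fun D hD => ?_) (fun D hD D' hD' hDD' => ?_) fun C hC => ?_
  · obtain ⟨hD, heD⟩ := Finset.mem_filter.1 hD
    exact Finset.mem_filter.2 ⟨inter_eq_of_mem_glue hD ⟨e, (hmem D).2 heD⟩, (hmem D).2 heD⟩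
  · obtain ⟨hD, heD⟩ := Finset.mem_filter.1 hD
    exact eq_of_inter_eq_of_mem_glue hp hD (Finset.mem_filter.1 hD').1 hDD' ⟨e, (hmem D).2 heD⟩
  · obtain ⟨hC, heC⟩ := Finset.mem_filter.1 hC
    obtain ⟨D, hD, rfl⟩ := exists_mem_glue h₁ h₂ hp hC
    exact ⟨D, Finset.mem_coe.2 (Finset.mem_filter.2 ⟨hD, (hmem D).1 heC⟩), rfl⟩

lemma image_glue (h₁ : ∀ C ∈ 𝒞₁, C ⊆ E₁ ∧ C.Nonempty) (h₂ : ∀ C ∈ 𝒞₂, C ⊆ E₂)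
    (hp : HasPartners E₁ E₂ 𝒞₁ 𝒞₂) : ((glue E₁ E₂ 𝒞₁ 𝒞₂).image (· ∩ E₁)).erase ∅ = 𝒞₁ := by
  ext C
  simp only [Finset.mem_erase, Finset.mem_image]
  constructor
  · rintro ⟨hne, D, hD, rfl⟩
    exact inter_eq_of_mem_glue hD (Finset.nonempty_iff_ne_empty.2 hne)
  · exact fun hC => ⟨(h₁ C hC).2.ne_empty, exists_mem_glue h₁ h₂ hp hC⟩

lemma eq_empty_or_eq_of_inter_eq_empty_or_eq (hD : D ⊆ E₁ ∪ E₂) (hX : X ⊆ D)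
    (h₁ : X ∩ E₁ = ∅ ∨ X ∩ E₁ = D ∩ E₁) (h₂ : X ∩ E₂ = ∅ ∨ X ∩ E₂ = D ∩ E₂)
    (hδ : D ∩ (E₁ ∩ E₂) = ∅ → D ∩ E₁ = ∅ ∨ D ∩ E₂ = ∅) : X = ∅ ∨ X = D := by
  have hsplit : ∀ Y ⊆ D, Y = Y ∩ E₁ ∪ Y ∩ E₂ := fun Y hY => by
    rw [← Finset.inter_union_distrib_left, Finset.inter_eq_left.2 (hY.trans hD)]
  rw [hsplit X hX, hsplit D subset_rfl]
  rcases h₁ with h₁ | h₁ <;> rcases h₂ with h₂ | h₂ <;> rw [h₁, h₂]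
  · exact .inl rfl
  · rcases hδ (by grind) with h | h <;> simp [h]
  · rcases hδ (by grind) with h | h <;> simp [h]
  · exact .inr rfl

end Glue

/-! ### Gluing circuit double covers along a cut of three edges -/

namespace CubicIncidence

variable {V E : Type*} {K : CubicIncidence V E} {S T X : Finset V} {s t v : V} {C D P : Finset E}
  {𝒞 𝒞₁ 𝒞₂ : Finset (Finset E)}

lemma IsEven.card_inter_star (hC : K.IsEven C) (hv : v ∈ K.verts)
    (hne : (C ∩ K.star v).Nonempty) : (C ∩ K.star v).card = 2 := by
  have hle : (C ∩ K.star v).card ≤ 3 :=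
    (Finset.card_le_card Finset.inter_subset_right).trans (K.card_star v hv).le
  have hpos := hne.card_pos
  obtain ⟨k, hk⟩ := hC.even_inter_star v hv
  omega

lemma IsCDC.existsUnique_inter_star (h : K.IsCDC 𝒞) (hv : v ∈ K.verts) (hP : P ⊆ K.star v)
    (hcard : P.card = 2) : ∃! C, C ∈ 𝒞 ∧ C ∩ K.star v = P := by
  obtain ⟨a, b, hab, rfl⟩ := Finset.card_eq_two.1 hcard
  obtain ⟨ha, hb⟩ : a ∈ K.star v ∧ b ∈ K.star v := by
    simpa only [Finset.insert_subset_iff, Finset.singleton_subset_iff] using hP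
  have inter_eq_iff : ∀ C ∈ 𝒞, C ∩ K.star v = {a, b} ↔ a ∈ C ∧ b ∈ C := fun C hC => by
    refine ⟨fun h => by grind, fun h' => ?_⟩
    have hsub : ({a, b} : Finset E) ⊆ C ∩ K.star v := by grind
    refine (Finset.eq_of_subset_of_card_le hsub ?_).symm
    rw [(h.isCircuit C hC).isEven.card_inter_star hv ⟨a, hsub (by simp)⟩, hcard]
  obtain ⟨C, hC⟩ := Finset.card_eq_one.1 (h.isEvenDoubleCover.card_filter_pair hv ha hb hab)
  have mem_iff : ∀ D, D ∈ 𝒞 ∧ D ∩ K.star v = {a, b} ↔ D = C := fun D => by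
    rw [and_congr_right (inter_eq_iff D), ← Finset.mem_singleton, ← hC, Finset.mem_filter]
    rfl
  exact ⟨C, (mem_iff C).2 rfl, fun D => (mem_iff D).1⟩

lemma IsCDC.subset_nonempty (h : K.IsCDC 𝒞) : ∀ C ∈ 𝒞, C ⊆ K.edges ∧ C.Nonempty :=
  fun C hC => ⟨(h.isCircuit C hC).isEven.subset, (h.isCircuit C hC).nonempty⟩

lemma IsCDC.hasPartners {h : K.IsContractible S s} {h' : K.IsContractible (K.verts \ S) t}
    (h₁ : (K.contract h).IsCDC 𝒞₁) (h₂ : (K.contract h').IsCDC 𝒞₂) :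
    HasPartners (K.outer S) (K.outer (K.verts \ S)) 𝒞₁ 𝒞₂ ∧
      HasPartners (K.outer (K.verts \ S)) (K.outer S) 𝒞₂ 𝒞₁ := by
  have star_left : (K.contract h).star s = K.cut S := star_contract_self h
  have star_right : (K.contract h').star t = K.cut S :=
    (star_contract_self h').trans (cut_compl h.subset)
  have mem_left : s ∈ (K.contract h).verts := Finset.mem_insert_self ..
  have mem_right : t ∈ (K.contract h').verts := Finset.mem_insert_self ..
  rw [HasPartners, HasPartners, Finset.inter_comm (K.outer (K.verts \ S)),
    outer_inter_outer_compl h.subset]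
  refine ⟨fun C hC hne => ?_, fun C hC hne => ?_⟩
  · rw [← star_left] at hne
    have hcard := (h₁.isCircuit C hC).isEven.card_inter_star mem_left hne
    rw [star_left, ← star_right] at hcard
    exact star_right ▸ h₂.existsUnique_inter_star mem_right Finset.inter_subset_right hcard
  · rw [← star_right] at hne
    have hcard := (h₂.isCircuit C hC).isEven.card_inter_star mem_right hne
    rw [star_right, ← star_left] at hcard
    exact star_left ▸ h₁.existsUnique_inter_star mem_left Finset.inter_subset_right hcard

lemma isEven_empty : K.IsEven ∅ := ⟨Finset.empty_subset _, fun v _ => by simp⟩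

lemma IsEven.inter_outer_eq_empty_or_eq {A : Finset E} (hA : K.IsEven A)
    {h : K.IsContractible S s} (hAD : A ⊆ D)
    (hD : D ∩ K.outer S = ∅ ∨ (K.contract h).IsCircuit (D ∩ K.outer S)) :
    A ∩ K.outer S = ∅ ∨ A ∩ K.outer S = D ∩ K.outer S := by
  have hsub := Finset.inter_subset_inter_right (u := K.outer S) hAD
  rcases hD with hD | hD
  · exact .inl (Finset.subset_empty.1 (hD ▸ hsub))
  · exact hD.minimal _ hsub (hA.contract h)

lemma isCircuit_of_mem_glue {h : K.IsContractible S s} {h' : K.IsContractible (K.verts \ S) t}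
    (h₁ : (K.contract h).IsCDC 𝒞₁) (h₂ : (K.contract h').IsCDC 𝒞₂)
    (hD : D ∈ glue (K.outer S) (K.outer (K.verts \ S)) 𝒞₁ 𝒞₂) : K.IsCircuit D := by
  obtain ⟨hDE, hne, hD₁, hD₂, hDδ⟩ := mem_glue.1 hD
  replace hD₁ := hD₁.imp_right (h₁.isCircuit _)
  replace hD₂ := hD₂.imp_right (h₂.isCircuit _)
  refine ⟨isEven_of_contract (hDE.trans_eq (outer_union_outer_compl S))
    (hD₁.elim (· ▸ isEven_empty) (·.isEven)) (hD₂.elim (· ▸ isEven_empty) (·.isEven)), hne,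
    fun A hAD hA => ?_⟩
  exact eq_empty_or_eq_of_inter_eq_empty_or_eq hDE hAD (hA.inter_outer_eq_empty_or_eq hAD hD₁)
    (hA.inter_outer_eq_empty_or_eq hAD hD₂) hDδ

lemma IsCDC.glue {h : K.IsContractible S s} {h' : K.IsContractible (K.verts \ S) t}
    (h₁ : (K.contract h).IsCDC 𝒞₁) (h₂ : (K.contract h').IsCDC 𝒞₂) :
    K.IsCDC (glue (K.outer S) (K.outer (K.verts \ S)) 𝒞₁ 𝒞₂) := by
  refine ⟨fun D hD => isCircuit_of_mem_glue h₁ h₂ hD, fun e he => ?_⟩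
  obtain ⟨hp, hp'⟩ := h₁.hasPartners h₂
  rw [← outer_union_outer_compl S] at he
  rcases Finset.mem_union.1 he with he | he
  · exact (card_filter_mem_glue h₁.subset_nonempty (fun C hC => (h₂.subset_nonempty C hC).1)
      hp he).trans (h₁.card_eq_two e he)
  · rw [glue_comm]
    exact (card_filter_mem_glue h₂.subset_nonempty (fun C hC => (h₁.subset_nonempty C hC).1)
      hp' he).trans (h₂.card_eq_two e he)

lemma card_cdcs_contract_mul_le (h : K.IsContractible S s)
    (h' : K.IsContractible (K.verts \ S) t) :
    (K.contract h).cdcs.card * (K.contract h').cdcs.card ≤ K.cdcs.card := by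
  rw [← Finset.card_product]
  refine Finset.card_le_card_of_injOn
    (fun p => _root_.glue (K.outer S) (K.outer (K.verts \ S)) p.1 p.2) ?_ ?_
  · rintro ⟨𝒞₁, 𝒞₂⟩ hmem
    obtain ⟨h₁, h₂⟩ := Finset.mem_product.1 hmem
    exact mem_cdcs.2 ((mem_cdcs.1 h₁).glue (mem_cdcs.1 h₂))
  · refine Set.LeftInvOn.injOn (f₁' := fun 𝒞 =>
      ((𝒞.image (· ∩ K.outer S)).erase ∅, (𝒞.image (· ∩ K.outer (K.verts \ S))).erase ∅)) ?_
    rintro ⟨𝒞₁, 𝒞₂⟩ hmem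
    obtain ⟨h₁, h₂⟩ := Finset.mem_product.1 hmem
    replace h₁ := mem_cdcs.1 h₁
    replace h₂ := mem_cdcs.1 h₂
    obtain ⟨hp, hp'⟩ := h₁.hasPartners h₂
    refine Prod.ext ?_ ?_
    · exact image_glue h₁.subset_nonempty (fun C hC => (h₂.subset_nonempty C hC).1) hp
    · dsimp only
      rw [glue_comm]
      exact image_glue h₂.subset_nonempty (fun C hC => (h₁.subset_nonempty C hC).1) hp'

end CubicIncidence

/-! ### Connectedness and face boundaries -/

namespace CubicIncidence

variable {V E ι : Type*} {K : CubicIncidence V E} {S X : Finset V} {s : V}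

/-- Connectedness: every nonempty proper set of vertices has a nonempty cut. -/
def IsConnected (K : CubicIncidence V E) : Prop :=
  ∀ X ⊆ K.verts, K.cut X = ∅ → X = ∅ ∨ X = K.verts

lemma cut_eq_union_of_cut_subset_outer (hS : S ⊆ K.verts) (hX : X ⊆ K.verts)
    (hXS : K.cut X ⊆ K.outer S) :
    K.cut S = K.cut (S ∩ X) ∪ K.cut (S \ X) ∧ Disjoint (K.cut (S ∩ X)) (K.cut (S \ X)) := by
  have hinter : S ∩ X ⊆ K.verts := Finset.inter_subset_left.trans hS
  have hdiff : S \ X ⊆ K.verts := Finset.sdiff_subset.trans hS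
  have mem_iff : ∀ e, (e ∈ K.cut S ↔ e ∈ K.cut (S ∩ X) ∨ e ∈ K.cut (S \ X)) ∧
      (e ∈ K.cut (S ∩ X) → e ∉ K.cut (S \ X)) := fun e => by
    by_cases he : e ∈ K.edges
    · obtain ⟨x, y, h⟩ := exists_joins he
      have hout := @hXS e
      rw [h.mem_outer_iff, h.mem_cut_iff hX] at hout
      rw [h.mem_cut_iff hS, h.mem_cut_iff hinter, h.mem_cut_iff hdiff]
      simp only [Finset.mem_inter, Finset.mem_sdiff]
      tauto
    · have : ∀ Y, e ∉ K.cut Y := fun Y h => he (cut_subset _ h)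
      simp [this]
  exact ⟨Finset.ext fun e => (mem_iff e).1.trans Finset.mem_union.symm,
    Finset.disjoint_left.2 fun e => (mem_iff e).2⟩

lemma IsConnected.subset_or_disjoint (hK : K.IsConnected)
    (hbridge : ∀ Y ⊆ K.verts, (K.cut Y).card ≠ 1) (hS : S ⊆ K.verts) (hcut : (K.cut S).card = 3)
    (hX : X ⊆ K.verts) (hXS : K.cut X ⊆ K.outer S) : S ⊆ X ∨ Disjoint S X := by
  obtain ⟨hunion, hdisj⟩ := cut_eq_union_of_cut_subset_outer hS hX hXS
  have hsum := congrArg Finset.card hunion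
  rw [Finset.card_union_of_disjoint hdisj, hcut] at hsum
  have hinter := hbridge (S ∩ X) (Finset.inter_subset_left.trans hS)
  have hdiff := hbridge (S \ X) (Finset.sdiff_subset.trans hS)
  have eq_empty : ∀ Y ⊆ S, (K.cut Y).card = 0 → Y = ∅ := fun Y hY hzero => by
    refine (hK Y (hY.trans hS) (Finset.card_eq_zero.1 hzero)).resolve_right ?_
    rintro rfl
    rw [hS.antisymm hY, hzero] at hcut
    contradiction
  obtain hzero | hzero : (K.cut (S ∩ X)).card = 0 ∨ (K.cut (S \ X)).card = 0 := by omega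
  · exact .inr (Finset.disjoint_iff_inter_eq_empty.2 (eq_empty _ Finset.inter_subset_left hzero))
  · exact .inl (Finset.sdiff_eq_empty_iff_subset.1 (eq_empty _ Finset.sdiff_subset hzero))

lemma IsConnected.contract (hK : K.IsConnected) (h : K.IsContractible S s) :
    (K.contract h).IsConnected := by
  intro X hX hcut
  have mem_iff : ∀ v ∈ (K.contract h).verts, v ∈ K.verts ∧ collapse S s v = v := fun v hv => by
    rcases Finset.mem_insert.1 hv with rfl | hv
    · exact ⟨h.subset h.mem, collapse_of_mem h.mem⟩
    · obtain ⟨hvK, hvS⟩ := Finset.mem_sdiff.1 hv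
      exact ⟨hvK, collapse_of_notMem hvS⟩
  rw [cut_contract h hX] at hcut
  refine (hK _ (Finset.filter_subset _ _) hcut).imp (fun hempty => ?_) fun hall => ?_
  · refine Finset.eq_empty_of_forall_notMem fun v hv => ?_
    obtain ⟨hvK, hvs⟩ := mem_iff v (hX hv)
    exact Finset.filter_eq_empty_iff.1 hempty hvK (hvs.symm ▸ hv)
  · refine hX.antisymm fun v hv => ?_
    obtain ⟨hvK, hvs⟩ := mem_iff v hv
    exact hvs ▸ Finset.filter_eq_self.1 hall v hvK

lemma exists_cut_contract_eq (h : K.IsContractible S s) (hX : X ⊆ K.verts)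
    (hXS : S ⊆ X ∨ Disjoint S X) : ∃ Y ⊆ (K.contract h).verts, (K.contract h).cut Y = K.cut X := by
  refine ⟨(K.contract h).verts.filter (· ∈ X), Finset.filter_subset _ _, ?_⟩
  rw [cut_contract h (Finset.filter_subset _ _)]
  congr 1
  ext v
  have hv := @hX v
  have hs := h.mem
  simp only [contract, Finset.mem_filter, Finset.mem_insert, Finset.mem_sdiff, collapse]
  rcases hXS with hsub | hdisj
  · have := @hsub v
    have := @hsub s
    grind
  · have := @Finset.disjoint_left.1 hdisj v
    have := @Finset.disjoint_left.1 hdisj s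
    grind

namespace IsEvenDoubleCover

variable {I : Finset ι} {A : ι → Finset E}

lemma card_cut_ne_one (hA : K.IsEvenDoubleCover I A) (hX : X ⊆ K.verts) :
    (K.cut X).card ≠ 1 := by
  intro hone
  obtain ⟨e, he⟩ := Finset.card_eq_one.1 hone
  have heK : e ∈ K.edges := cut_subset X (he ▸ Finset.mem_singleton_self e)
  obtain ⟨i, j, hij⟩ := exists_isPairOf (hA.card_eq_two e heK)
  have heven := (hA.isEven i hij.left_mem).even_inter_cut hX
  rw [he, Finset.inter_singleton_of_mem hij.left] at heven
  simp at heven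

lemma card_le (hA : K.IsEvenDoubleCover I A) (hne : ∀ i ∈ I, (A i).Nonempty) :
    I.card ≤ 3 * K.verts.card := by
  have hsum := sum_card_eq_mul_of_card_filter_eq (fun i hi => (hA.isEven i hi).subset)
    hA.card_eq_two
  have hle : I.card ≤ ∑ i ∈ I, (A i).card := by
    rw [Finset.card_eq_sum_ones]
    exact Finset.sum_le_sum fun i hi => Finset.card_pos.2 (hne i hi)
  have := K.three_mul_card_verts
  omega

lemma contract (hA : K.IsEvenDoubleCover I A) (h : K.IsContractible S s) :
    (K.contract h).IsEvenDoubleCover (I.filter fun i => (A i ∩ K.outer S).Nonempty)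
      fun i => A i ∩ K.outer S where
  isEven i hi := (hA.isEven i (Finset.mem_filter.1 hi).1).contract h
  card_eq_two e he := by
    have he : e ∈ K.outer S := he
    rw [← hA.card_eq_two e (outer_subset _ he)]
    congr 1
    ext i
    simp only [Finset.mem_filter, Finset.mem_inter, he, and_true]
    exact ⟨fun hi => ⟨hi.1.1, hi.2⟩,
      fun hi => ⟨⟨hi.1, e, Finset.mem_inter.2 ⟨hi.2, he⟩⟩, hi.2⟩⟩

end IsEvenDoubleCover

end CubicIncidence

/-- The combinatorial data of a connected cubic graph embedded with large representativity: the
boundaries of the faces form a double cover by even sets, and every set `D` of two or three edges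
that is even in the dual graph is an edge cut. The second property is all that is needed of the
representativity; unlike the latter, it is inherited by contractions. -/
structure FacedCubic (V E Φ : Type*) extends CubicIncidence V E where
  faces : Finset Φ
  /-- the edges on the boundary of a face -/
  bd : Φ → Finset E
  bd_nonempty : ∀ φ ∈ faces, (bd φ).Nonempty
  isEvenDoubleCover : toCubicIncidence.IsEvenDoubleCover faces bd
  isConnected : toCubicIncidence.IsConnected
  exists_cut : ∀ D ⊆ edges, D.card = 2 ∨ D.card = 3 → (∀ φ ∈ faces, Even (bd φ ∩ D).card) →
    ∃ X ⊆ verts, toCubicIncidence.cut X = D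

namespace FacedCubic

open CubicIncidence

variable {V E Φ : Type*} {K : FacedCubic V E Φ} {S X : Finset V} {s t : V} {e : E} {A B : Φ}

/-- The edge `e` lies on the boundaries of the two different faces `A` and `B`. -/
abbrev Borders (K : FacedCubic V E Φ) (e : E) (A B : Φ) : Prop :=
  IsPairOf K.faces (fun φ => e ∈ K.bd φ) A B

lemma isEven_bd (hA : A ∈ K.faces) : K.IsEven (K.bd A) := K.isEvenDoubleCover.isEven A hA

lemma bd_subset (hA : A ∈ K.faces) : K.bd A ⊆ K.edges := (isEven_bd hA).subset

lemma exists_borders (he : e ∈ K.edges) : ∃ A B, K.Borders e A B :=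
  exists_isPairOf (K.isEvenDoubleCover.card_eq_two e he)

lemma exists_borders_left (hA : A ∈ K.faces) (he : e ∈ K.bd A) : ∃ B, K.Borders e A B :=
  exists_isPairOf_left (K.isEvenDoubleCover.card_eq_two e (bd_subset hA he)) hA he

lemma Borders.mem_edges (h : K.Borders e A B) : e ∈ K.edges := bd_subset h.left_mem h.left

lemma borders_of_mem (hA : A ∈ K.faces) (hB : B ∈ K.faces) (hAB : A ≠ B) (heA : e ∈ K.bd A)
    (heB : e ∈ K.bd B) : K.Borders e A B := by
  obtain ⟨C, hC⟩ := exists_borders_left hA heA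
  rwa [((hC.iff B hB).1 heB).resolve_left hAB.symm]

lemma card_cut_ne_one (hX : X ⊆ K.verts) : (K.cut X).card ≠ 1 :=
  K.isEvenDoubleCover.card_cut_ne_one hX

/-- The contraction of one side of a cut of three edges; the faces inside `S` are lost. -/
noncomputable def contract (K : FacedCubic V E Φ) (h : K.IsContractible S s) :
    FacedCubic V E Φ where
  toCubicIncidence := K.toCubicIncidence.contract h
  faces := K.faces.filter fun φ => (K.bd φ ∩ K.outer S).Nonempty
  bd φ := K.bd φ ∩ K.outer S
  bd_nonempty _ hφ := (Finset.mem_filter.1 hφ).2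
  isEvenDoubleCover := K.isEvenDoubleCover.contract h
  isConnected := K.isConnected.contract h
  exists_cut D hD hcard hev := by
    have hD : D ⊆ K.outer S := hD
    have heven : ∀ φ ∈ K.faces, Even (K.bd φ ∩ D).card := fun φ hφ => by
      by_cases hne : (K.bd φ ∩ K.outer S).Nonempty
      · have := hev φ (Finset.mem_filter.2 ⟨hφ, hne⟩)
        rwa [Finset.inter_assoc, Finset.inter_eq_right.2 hD] at this
      · have : K.bd φ ∩ D ⊆ ∅ := Finset.not_nonempty_iff_eq_empty.1 hne ▸
          Finset.inter_subset_inter_left hD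
        simp [Finset.subset_empty.1 this]
    obtain ⟨X, hX, rfl⟩ := K.exists_cut D (hD.trans (outer_subset _)) hcard heven
    exact exists_cut_contract_eq h hX (K.isConnected.subset_or_disjoint
      (fun _ => card_cut_ne_one) h.subset h.card_cut hX hD)

lemma card_faces_le_contract (h : K.IsContractible S s) (h' : K.IsContractible (K.verts \ S) t) :
    K.faces.card ≤ (K.contract h).faces.card + (K.contract h').faces.card := by
  refine (Finset.card_le_card fun φ hφ => ?_).trans (Finset.card_union_le _ _)
  obtain ⟨e, he⟩ := K.bd_nonempty φ hφ
  have heK := bd_subset hφ he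
  rw [← outer_union_outer_compl S, Finset.mem_union] at heK
  simp only [contract, Finset.mem_union, Finset.mem_filter, hφ, true_and]
  exact heK.imp (fun hout => ⟨e, Finset.mem_inter.2 ⟨he, hout⟩⟩)
    fun hout => ⟨e, Finset.mem_inter.2 ⟨he, hout⟩⟩

end FacedCubic

/-! ### The local structure in the absence of small cuts -/

namespace CubicIncidence

variable {V E : Type*} {K : CubicIncidence V E} {X : Finset V} {v x y z : V} {a b e w m p : E}
  {A : Finset E}

lemma mem_cut_insert (hv : v ∈ K.verts) (hvX : v ∉ X) :
    e ∈ K.cut (insert v X) ↔ ¬ (e ∈ K.cut X ↔ e ∈ K.star v) := by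
  rw [mem_oddPart, mem_oddPart, Finset.filter_insert]
  by_cases he : e ∈ K.edges
  · by_cases hev : e ∈ K.star v
    · have hvf : v ∉ X.filter fun i => e ∈ K.star i := fun h => hvX (Finset.mem_filter.1 h).1
      simp only [he, hev, if_true, Finset.card_insert_of_notMem hvf, true_and, iff_true]
      exact Nat.odd_add_one
    · simp [he, hev]
  · have hev : e ∉ K.star v := fun h => he (K.star_subset v hv h)
    simp [he, hev]

lemma exists_mem_star_of_mem_cut (he : e ∈ K.cut X) : ∃ v ∈ X, e ∈ K.star v := by
  obtain ⟨v, hv⟩ := Finset.card_pos.1 (mem_oddPart.1 he).2.pos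
  exact ⟨v, Finset.mem_filter.1 hv⟩

lemma Joins.notMem_cut (h : K.Joins e x y) (hX : X ⊆ K.verts) (hxX : x ∈ X) (hyX : y ∈ X) :
    e ∉ K.cut X := by
  simp [h.mem_cut_iff hX, hxX, hyX]

lemma joins_of_mem_star (hx : x ∈ K.verts) (hy : y ∈ K.verts) (hxy : x ≠ y) (hex : e ∈ K.star x)
    (hey : e ∈ K.star y) : K.Joins e x y := by
  obtain ⟨z, hz⟩ := exists_joins_left hx hex
  rwa [((hz.iff y hy).1 hey).resolve_left hxy.symm]

lemma IsEven.exists_isPairOf_star (hA : K.IsEven A) (hv : v ∈ K.verts) (ha : a ∈ K.star v)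
    (haA : a ∈ A) : ∃ b, IsPairOf (K.star v) (· ∈ A) a b := by
  refine exists_isPairOf_left ?_ ha haA
  rw [Finset.filter_mem_eq_inter, Finset.inter_comm]
  exact hA.card_inter_star hv ⟨a, Finset.mem_inter.2 ⟨haA, ha⟩⟩

/-- Cyclic 4-edge-connectivity, with the two smallest cubic graphs excluded: the graph is
3-edge-connected, has only trivial cuts of three edges, and has at least four vertices. -/
structure IsTight (K : CubicIncidence V E) : Prop where
  three_le_card_cut : ∀ X ⊂ K.verts, X.Nonempty → 3 ≤ (K.cut X).card
  exists_cut_eq_star : ∀ X ⊆ K.verts, (K.cut X).card = 3 → ∃ v ∈ K.verts, K.cut X = K.star v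
  four_le_card_verts : 4 ≤ K.verts.card

lemma cut_verts : K.cut K.verts = ∅ := by
  refine Finset.eq_empty_of_forall_notMem fun e he => ?_
  obtain ⟨x, y, h⟩ := exists_joins (cut_subset _ he)
  exact h.notMem_cut subset_rfl h.left_mem h.right_mem he

namespace IsTight

lemma card_cut_ne_two (hK : K.IsTight) (hX : X ⊆ K.verts) : (K.cut X).card ≠ 2 := by
  intro htwo
  rcases hX.eq_or_ssubset with rfl | hss
  · simp [cut_verts] at htwo
  rcases X.eq_empty_or_nonempty with rfl | hne
  · simp [oddPart] at htwo
  · have := hK.three_le_card_cut X hss hne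
    omega

lemma ssubset_verts (hK : K.IsTight) (hX : X ⊆ K.verts) (hcard : X.card < 4) : X ⊂ K.verts :=
  hX.ssubset_of_ne (by rintro rfl; have := hK.four_le_card_verts; omega)

lemma eq_of_joins (hK : K.IsTight) (ha : K.Joins a x y) (hb : K.Joins b x y) : a = b := by
  by_contra hab
  obtain ⟨c, -, -, hsx⟩ := exists_star_eq_insert_pair ha.left_mem ha.left hb.left hab
  obtain ⟨d, -, -, hsy⟩ := exists_star_eq_insert_pair ha.right_mem ha.right hb.right hab
  have hX : {x, y} ⊆ K.verts := by simp [Finset.insert_subset_iff, ha.left_mem, ha.right_mem]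
  have hsub : K.cut {x, y} ⊆ {c, d} := fun e he => by
    have hea : e ≠ a := by rintro rfl; exact ha.notMem_cut hX (by simp) (by simp) he
    have heb : e ≠ b := by rintro rfl; exact hb.notMem_cut hX (by simp) (by simp) he
    obtain ⟨v, hv, hev⟩ := exists_mem_star_of_mem_cut he
    rcases (by simpa using hv : v = x ∨ v = y) with rfl | rfl
    · exact Finset.mem_insert.2 (.inl (by simpa [hsx, hea, heb] using hev))
    · exact Finset.mem_insert_of_mem (by simpa [hsy, hea, heb] using hev)
  have hle := (Finset.card_le_card hsub).trans Finset.card_le_two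
  have hge := hK.three_le_card_cut {x, y} (hK.ssubset_verts hX (Finset.card_le_two.trans_lt
    (by norm_num))) (by simp)
  omega

lemma card_verts_eq_four_of_triangle (hK : K.IsTight) (hw : K.Joins w x y) (hm : K.Joins m x z)
    (hp : K.Joins p y z) : K.verts.card = 4 := by
  have hwm : w ≠ m := by rintro rfl; exact hp.ne (hw.right_unique hm)
  have hwp : w ≠ p := by rintro rfl; exact hm.ne (hw.symm.right_unique hp)
  have hmp : m ≠ p := by rintro rfl; exact hw.ne (hm.symm.right_unique hp.symm)
  obtain ⟨a, -, -, hsx⟩ := exists_star_eq_insert_pair hw.left_mem hw.left hm.left hwm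
  obtain ⟨b, -, -, hsy⟩ := exists_star_eq_insert_pair hp.left_mem hw.right hp.left hwp
  obtain ⟨c, -, -, hsz⟩ := exists_star_eq_insert_pair hp.right_mem hm.right hp.right hmp
  have hX : {x, y, z} ⊆ K.verts := by
    simp [Finset.insert_subset_iff, hw.left_mem, hp.left_mem, hp.right_mem]
  have hwX : w ∉ K.cut {x, y, z} := hw.notMem_cut hX (by simp) (by simp)
  have hmX : m ∉ K.cut {x, y, z} := hm.notMem_cut hX (by simp) (by simp)
  have hpX : p ∉ K.cut {x, y, z} := hp.notMem_cut hX (by simp) (by simp)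
  have hsub : K.cut {x, y, z} ⊆ {a, b, c} := fun e he => by
    have hew : e ≠ w := by rintro rfl; exact hwX he
    have hem : e ≠ m := by rintro rfl; exact hmX he
    have hep : e ≠ p := by rintro rfl; exact hpX he
    obtain ⟨v, hv, hev⟩ := exists_mem_star_of_mem_cut he
    rcases (by simpa using hv : v = x ∨ v = y ∨ v = z) with rfl | rfl | rfl
    · simp [show e = a by simpa [hsx, hew, hem] using hev]
    · simp [show e = b by simpa [hsy, hew, hep] using hev]
    · simp [show e = c by simpa [hsz, hem, hep] using hev]
  have hthree : (K.cut {x, y, z}).card = 3 :=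
    ((Finset.card_le_card hsub).trans Finset.card_le_three).antisymm (hK.three_le_card_cut _
      (hK.ssubset_verts hX (Finset.card_le_three.trans_lt (by norm_num))) (by simp))
  obtain ⟨v, hv, hvs⟩ := hK.exists_cut_eq_star _ hX hthree
  have hvX : v ∉ ({x, y, z} : Finset V) := by
    simp only [Finset.mem_insert, Finset.mem_singleton]
    rintro (rfl | rfl | rfl)
    exacts [hwX (hvs ▸ hw.left), hwX (hvs ▸ hw.right), hmX (hvs ▸ hm.right)]
  have hempty : K.cut (insert v {x, y, z}) = ∅ := Finset.eq_empty_of_forall_notMem fun e => by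
    simp [mem_cut_insert hv hvX, hvs]
  have hall : insert v {x, y, z} = K.verts := by
    by_contra hne
    have := hK.three_le_card_cut _ ((Finset.insert_subset hv hX).ssubset_of_ne hne) (by simp)
    simp [hempty] at this
  rw [← hall, Finset.card_insert_of_notMem hvX,
    Finset.card_eq_three.2 ⟨x, y, z, hw.ne, hm.ne, hp.ne, rfl⟩]

end IsTight

/-- `m` and `p` are the edges before and after `w` on a closed walk with edge set `A`, and they
are not adjacent to each other. -/
structure IsNeighbourPair (K : CubicIncidence V E) (A : Finset E) (w m p : E) : Prop where
  left_mem : m ∈ A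
  right_mem : p ∈ A
  left_ne : w ≠ m
  right_ne : w ≠ p
  left_meets : K.Meets w m
  right_meets : K.Meets w p
  not_meets : ¬ K.Meets m p
  eq_of_meets : ∀ b ∈ A, K.Meets w b → b = w ∨ b = m ∨ b = p

lemma IsEven.card_filter_meets_le (hA : K.IsEven A) (hw : w ∈ A) :
    (A.filter (K.Meets w)).card ≤ 3 := by
  obtain ⟨x, y, hxy⟩ := exists_joins (hA.subset hw)
  obtain ⟨m, hm⟩ := hA.exists_isPairOf_star hxy.left_mem hxy.left hw
  obtain ⟨p, hp⟩ := hA.exists_isPairOf_star hxy.right_mem hxy.right hw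
  refine (Finset.card_le_card (t := {w, m, p}) fun b hb => ?_).trans Finset.card_le_three
  obtain ⟨hbA, v, hv, hwv, hbv⟩ := Finset.mem_filter.1 hb
  have := hm.iff b
  have := hp.iff b
  have := hxy.iff v hv
  grind

lemma IsTight.exists_isNeighbourPair (hK : K.IsTight) (hfour : K.verts.card ≠ 4) (hA : K.IsEven A)
    (hw : w ∈ A) : ∃ m p, K.IsNeighbourPair A w m p := by
  obtain ⟨x, y, hxy⟩ := exists_joins (hA.subset hw)
  obtain ⟨m, hm⟩ := hA.exists_isPairOf_star hxy.left_mem hxy.left hw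
  obtain ⟨p, hp⟩ := hA.exists_isPairOf_star hxy.right_mem hxy.right hw
  refine ⟨m, p, hm.right, hp.right, hm.ne, hp.ne, ⟨x, hxy.left_mem, hxy.left, hm.right_mem⟩,
    ⟨y, hxy.right_mem, hxy.right, hp.right_mem⟩, ?_, ?_⟩
  · rintro ⟨z, hz, hmz, hpz⟩
    have hmp : m ≠ p := by
      rintro rfl
      exact hm.ne (hK.eq_of_joins hxy (joins_of_mem_star hxy.left_mem hxy.right_mem hxy.ne
        hm.right_mem hp.right_mem))
    have hxz : x ≠ z := by
      rintro rfl
      exact ((hm.iff p hpz).1 hp.right).elim hp.ne.symm hmp.symm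
    have hyz : y ≠ z := by
      rintro rfl
      exact ((hp.iff m hmz).1 hm.right).elim hm.ne.symm hmp
    exact hfour (hK.card_verts_eq_four_of_triangle hxy
      (joins_of_mem_star hxy.left_mem hz hxz hm.right_mem hmz)
      (joins_of_mem_star hxy.right_mem hz hyz hp.right_mem hpz))
  · rintro b hb ⟨v, hv, hwv, hbv⟩
    rcases (hxy.iff v hv).1 hwv with rfl | rfl
    · exact ((hm.iff b hbv).1 hb).imp_right .inl
    · exact ((hp.iff b hbv).1 hb).imp_right .inr

end CubicIncidence

namespace FacedCubic

open CubicIncidence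

variable {V E Φ : Type*} {K : FacedCubic V E Φ} {A B C Q F₁ F₂ R : Φ} {v : V} {a e f g : E}

lemma eq_of_borders (hK : K.IsTight) (he : K.Borders e A B) (hg : K.Borders g A B) : e = g := by
  by_contra heg
  have hsub : {e, g} ⊆ K.edges := by
    simp [Finset.insert_subset_iff, he.mem_edges, hg.mem_edges]
  have heven : ∀ φ ∈ K.faces, Even (K.bd φ ∩ {e, g}).card := fun φ hφ => by
    have hiff : e ∈ K.bd φ ↔ g ∈ K.bd φ := (he.iff φ hφ).trans (hg.iff φ hφ).symm
    by_cases hg : g ∈ K.bd φ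
    · simp [Finset.inter_insert_of_mem, hiff, hg, heg]
    · simp [Finset.inter_insert_of_notMem, hiff, hg]
  obtain ⟨X, hX, hcut⟩ := K.exists_cut {e, g} hsub (.inl (Finset.card_pair heg)) heven
  exact hK.card_cut_ne_two hX (hcut ▸ Finset.card_pair heg)

lemma ne_and_meets_of_borders (hK : K.IsTight) (he : K.Borders e A B) (hf : K.Borders f A C)
    (hg : K.Borders g B C) : e ≠ f ∧ K.Meets e f := by
  have hef : e ≠ f := by rintro rfl; exact hg.ne (he.right_unique hf)
  have heg : e ≠ g := by rintro rfl; exact hf.ne (he.symm.right_unique hg)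
  have hfg : f ≠ g := by rintro rfl; exact he.ne (hf.symm.right_unique hg.symm)
  have hsub : {e, f, g} ⊆ K.edges := by
    simp [Finset.insert_subset_iff, he.mem_edges, hf.mem_edges, hg.mem_edges]
  have hcard : ({e, f, g} : Finset E).card = 3 :=
    Finset.card_eq_three.2 ⟨e, f, g, hef, heg, hfg, rfl⟩
  have heven : ∀ φ ∈ K.faces, Even (K.bd φ ∩ {e, f, g}).card := fun φ hφ => by
    rw [even_card_inter_triple_iff hef heg hfg, he.iff φ hφ, hf.iff φ hφ, hg.iff φ hφ]
    have := he.ne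
    have := hf.ne
    have := hg.ne
    grind
  obtain ⟨X, hX, hcut⟩ := K.exists_cut {e, f, g} hsub (.inr hcard) heven
  obtain ⟨v, hv, hs⟩ := hK.exists_cut_eq_star X hX (hcut ▸ hcard)
  rw [hcut] at hs
  exact ⟨hef, v, hv, by simp [← hs], by simp [← hs]⟩

lemma exists_third_face (hK : K.IsTight) (ha : K.Borders a A B) (hv : v ∈ K.verts)
    (hav : a ∈ K.star v) :
    ∃ b ∈ K.star v, ∃ c ∈ K.star v, ∃ C, K.Borders b A C ∧ K.Borders c B C := by
  obtain ⟨b, hb⟩ := (isEven_bd ha.left_mem).exists_isPairOf_star hv hav ha.left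
  obtain ⟨C, hC⟩ := exists_borders_left ha.left_mem hb.right
  have hCB : C ≠ B := by rintro rfl; exact hb.ne (eq_of_borders hK ha hC)
  obtain ⟨c, hac, hbc, hs⟩ := exists_star_eq_insert_pair hv hav hb.right_mem hb.ne
  have hbB : b ∉ K.bd B := fun h => hb.ne (eq_of_borders hK ha
    (borders_of_mem ha.left_mem ha.right_mem ha.ne hb.right h))
  have haC : a ∉ K.bd C := fun h => ((ha.iff C hC.right_mem).1 h).elim hC.ne.symm hCB
  have hcB : c ∈ K.bd B := by
    have := (isEven_bd ha.right_mem).mem_triple_cases hv hb.ne hac hbc hs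
    have := ha.right
    tauto
  have hcC : c ∈ K.bd C := by
    have := (isEven_bd hC.right_mem).mem_triple_cases hv hb.ne hac hbc hs
    have := hC.right
    tauto
  exact ⟨b, hb.right_mem, c, by simp [hs], C, hC,
    borders_of_mem ha.right_mem hC.right_mem hCB.symm hcB hcC⟩

/-- The faces around an edge `s` that leaves the boundary of the face `Q`: at one end of `s`, the
faces `F₁` and `F₂` on its two sides meet `Q` in the edges `e₁` and `e₂`; at the other end, they
meet a further face `R` in the edges `p` and `q`. -/
structure IsSpoke (K : FacedCubic V E Φ) (Q F₁ F₂ R : Φ) (e₁ e₂ s p q : E) : Prop where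
  borders₁ : K.Borders e₁ Q F₁
  borders₂ : K.Borders e₂ Q F₂
  borders_spoke : K.Borders s F₁ F₂
  borders_left : K.Borders p F₁ R
  borders_right : K.Borders q F₂ R
  ne : Q ≠ R
  meets₁ : K.Meets e₁ s
  meets_left : K.Meets s p

lemma exists_isSpoke (hK : K.IsTight) (hQ : Q ∈ K.faces) :
    ∃ F₁ F₂ R e₁ e₂ s p q, K.IsSpoke Q F₁ F₂ R e₁ e₂ s p q := by
  obtain ⟨e₁, he₁Q⟩ := K.bd_nonempty Q hQ
  obtain ⟨F₁, he₁⟩ := exists_borders_left hQ he₁Q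
  obtain ⟨v, _, hv⟩ := exists_joins he₁.mem_edges
  obtain ⟨e₂, he₂v, s, hsv, F₂, he₂, hs⟩ := exists_third_face hK he₁ hv.left_mem hv.left
  obtain ⟨w, hw⟩ := exists_joins_left hv.left_mem hsv
  obtain ⟨p, hpw, q, hqw, R, hp, hq⟩ := exists_third_face hK hs hw.right_mem hw.right
  have hQR : Q ≠ R := by
    rintro rfl
    obtain rfl := eq_of_borders hK he₁ hp.symm
    obtain rfl := eq_of_borders hK he₂ hq.symm
    refine hs.ne (he₁.right_unique (?_ : K.Borders e₁ Q F₂))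
    rwa [hK.eq_of_joins (joins_of_mem_star hw.left_mem hw.right_mem hw.ne hv.left hpw)
      (joins_of_mem_star hw.left_mem hw.right_mem hw.ne he₂v hqw)]
  exact ⟨F₁, F₂, R, e₁, e₂, s, p, q, he₁, he₂, hs, hp, hq, hQR,
    ⟨v, hv.left_mem, hv.left, hsv⟩, ⟨w, hw.right_mem, hw.right, hpw⟩⟩

end FacedCubic

/-! ### Recombining the faces around a set of centres -/

namespace CubicIncidence

variable {V E ι κ σ : Type*} {K : CubicIncidence V E} {A P : Finset E}

/-- The colouring `c` distinguishes any two different adjacent edges in `A`. -/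
def IsProperOn (K : CubicIncidence V E) (A : Finset E) (c : E → κ) : Prop :=
  ∀ a ∈ A, ∀ b ∈ A, a ≠ b → K.Meets a b → c a ≠ c b

lemma IsEven.exists_isProperOn_extension [Fintype κ] (hA : K.IsEven A) (hκ : 3 ≤ Fintype.card κ)
    (hP : P ⊆ A) (c₀ : E → κ) (hc₀ : K.IsProperOn P c₀) :
    ∃ c, (∀ a ∈ P, c a = c₀ a) ∧ K.IsProperOn A c := by
  have hdeg : ∀ a ∈ A, (A.filter fun b => a ≠ b ∧ K.Meets a b).card < Fintype.card κ := by
    refine fun a ha => (Finset.card_lt_card ?_).trans_le ((hA.card_filter_meets_le ha).trans hκ)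
    refine Finset.ssubset_iff.2 ⟨a, by simp, Finset.insert_subset ?_ fun b hb => ?_⟩
    · exact Finset.mem_filter.2 ⟨ha, .refl (hA.subset ha)⟩
    · obtain ⟨hbA, -, hab⟩ := Finset.mem_filter.1 hb
      exact Finset.mem_filter.2 ⟨hbA, hab⟩
  obtain ⟨c, hext, hc⟩ := exists_coloring_extension (fun a b => a ≠ b ∧ K.Meets a b)
    (fun _ _ h => ⟨h.1.symm, h.2.symm⟩) (fun _ h => h.1 rfl) hP hdeg c₀
    (fun a ha b hb h => hc₀ a ha b hb h.1 h.2)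
  exact ⟨c, hext, fun a ha b hb hab hm => hc a ha b hb ⟨hab, hm⟩⟩

lemma two_pow_le_card_cdcs (J : Finset σ) (I : Finset σ → Finset ι)
    (A : Finset σ → ι → Finset E) (h : ∀ U ⊆ J, K.IsEvenDoubleCover (I U) (A U))
    (hsep : ∀ q ∈ J, ∃ a e b, K.Meets a e ∧ K.Meets e b ∧ ∀ U ⊆ J, ∀ U' ⊆ J,
      (CoversTriple (I U) (A U) a e b ↔ CoversTriple (I U') (A U') a e b) → (q ∈ U ↔ q ∈ U')) :
    2 ^ J.card ≤ K.cdcs.card := by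
  rw [← Finset.card_powerset]
  refine card_le_card_cdcs J.powerset I A (fun U hU => h U (Finset.mem_powerset.1 hU))
    fun U hU U' hU' hne => ?_
  rw [Finset.mem_powerset] at hU hU'
  obtain ⟨q, hqJ, hq⟩ : ∃ q ∈ J, ¬ (q ∈ U ↔ q ∈ U') := by
    by_contra! hall
    exact hne (Finset.ext fun q => ⟨fun hq => (hall q (hU hq)).1 hq,
      fun hq => (hall q (hU' hq)).2 hq⟩)
  obtain ⟨a, e, b, hae, heb, htriple⟩ := hsep q hqJ
  exact ⟨a, e, b, hae, heb, fun hiff => hq (htriple U hU U' hU' hiff)⟩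

end CubicIncidence

namespace FacedCubic

open CubicIncidence

variable {V E Φ : Type*} {K : FacedCubic V E Φ} {J U : Finset Φ} {c : Φ → E → Fin 3}
  {A B Q Q' F₁ F₂ R X : Φ} {e e₁ e₂ g s p q w m : E} {i : Fin 3} {l : Φ ⊕ Φ × Fin 3}

/-- No face touches two different members of `J`. -/
structure IsSparse (K : FacedCubic V E Φ) (J : Finset Φ) : Prop where
  subset : J ⊆ K.faces
  eq_of_not_disjoint : ∀ Q ∈ J, ∀ Q' ∈ J, ∀ R ∈ K.faces,
    ¬ Disjoint (K.bd R) (K.bd Q) → ¬ Disjoint (K.bd R) (K.bd Q') → Q = Q'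

/-- The members of the new cover to which the face `R` contributes. A centre `Q` splits into the
three members `Sum.inr (Q, i)`, a face next to `Q` is added to the one given by the colour of the
common edge, and `Sum.inl X` keeps the face `X`. -/
def HasLabel (K : FacedCubic V E Φ) (c : Φ → E → Fin 3) (R : Φ) : Φ ⊕ Φ × Fin 3 → Prop
  | .inl X => R = X
  | .inr (Q, i) => R = Q ∨ ∃ g ∈ K.bd R, g ∈ K.bd Q ∧ c Q g = i

/-- The labels in use when the set of centres is `J`: the faces that touch no centre, and three
labels for each centre. -/
noncomputable def labels (K : FacedCubic V E Φ) (J : Finset Φ) : Finset (Φ ⊕ Φ × Fin 3) :=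
  (K.faces.filter fun X => ∀ Q ∈ J, Disjoint (K.bd X) (K.bd Q)).disjSum (J ×ˢ Finset.univ)

/-- The sum modulo 2 of the faces with label `l`. -/
noncomputable def recombine (K : FacedCubic V E Φ) (c : Φ → E → Fin 3) (l : Φ ⊕ Φ × Fin 3) :
    Finset E :=
  oddPart K.edges (K.faces.filter fun R => K.HasLabel c R l) K.bd

lemma inl_mem_labels :
    Sum.inl X ∈ K.labels J ↔ X ∈ K.faces ∧ ∀ Q ∈ J, Disjoint (K.bd X) (K.bd Q) := by
  simp [labels]

lemma inr_mem_labels : Sum.inr (Q, i) ∈ K.labels J ↔ Q ∈ J := by simp [labels]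

lemma isSparse_singleton (hQ : Q ∈ K.faces) : K.IsSparse {Q} where
  subset := Finset.singleton_subset_iff.2 hQ
  eq_of_not_disjoint _ hA _ hB _ _ _ _ :=
    (Finset.mem_singleton.1 hA).trans (Finset.mem_singleton.1 hB).symm

lemma mem_recombine_iff (he : K.Borders e A B) :
    e ∈ K.recombine c l ↔ (K.HasLabel c A l ↔ ¬ K.HasLabel c B l) := by
  rw [recombine, mem_oddPart, he.odd_card_filter_iff (Finset.filter_subset _ _)]
  simp [he.mem_edges, he.left_mem, he.right_mem]

lemma bd_subset_recombine_inl (hA : A ∈ K.faces) : K.bd A ⊆ K.recombine c (.inl A) := fun e he => by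
  obtain ⟨B, hB⟩ := exists_borders_left hA he
  simp [mem_recombine_iff hB, HasLabel, hB.ne.symm]

namespace IsSparse

lemma mono (hJ : K.IsSparse J) (hU : U ⊆ J) : K.IsSparse U where
  subset := hU.trans hJ.subset
  eq_of_not_disjoint Q hQ Q' hQ' := hJ.eq_of_not_disjoint Q (hU hQ) Q' (hU hQ')

lemma eq_of_mem (hJ : K.IsSparse J) (hQ : Q ∈ J) (hQ' : Q' ∈ J) (hR : R ∈ K.faces)
    (heR : e ∈ K.bd R) (heQ : e ∈ K.bd Q) (hgR : g ∈ K.bd R) (hgQ' : g ∈ K.bd Q') : Q = Q' :=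
  hJ.eq_of_not_disjoint Q hQ Q' hQ' R hR (Finset.not_disjoint_iff.2 ⟨e, heR, heQ⟩)
    (Finset.not_disjoint_iff.2 ⟨g, hgR, hgQ'⟩)

lemma notMem_of_borders (hJ : K.IsSparse J) (hQ : Q ∈ J) (he : K.Borders e Q R) : R ∉ J :=
  fun hR => he.ne (hJ.eq_of_mem hQ hR he.right_mem he.right he.left he.right he.right)

lemma hasLabel_iff_of_mem (hJ : K.IsSparse J) (hQ : Q ∈ J) (hl : l ∈ K.labels J) :
    K.HasLabel c Q l ↔ ∃ i, l = .inr (Q, i) := by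
  obtain ⟨e, he⟩ := K.bd_nonempty Q (hJ.subset hQ)
  rcases l with X | ⟨Q', i⟩
  · have hXQ : Q ≠ X := by
      rintro rfl
      exact Finset.disjoint_left.1 ((inl_mem_labels.1 hl).2 Q hQ) he he
    simp [HasLabel, hXQ]
  · have hQQ' : K.HasLabel c Q (.inr (Q', i)) → Q = Q' := by
      rintro (h | ⟨g, hgQ, hgQ', -⟩)
      exacts [h, hJ.eq_of_mem hQ (inr_mem_labels.1 hl) (hJ.subset hQ) he he hgQ hgQ']
    refine ⟨fun h => ⟨i, by rw [hQQ' h]⟩, ?_⟩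
    rintro ⟨j, hj⟩
    exact .inl (by simpa [eq_comm] using congrArg (Sum.elim id Prod.fst) hj)

lemma hasLabel_iff_of_borders (hJ : K.IsSparse J) (hK : K.IsTight) (hQ : Q ∈ J)
    (he : K.Borders e Q R) (hl : l ∈ K.labels J) :
    K.HasLabel c R l ↔ l = .inr (Q, c Q e) := by
  constructor
  · rcases l with X | ⟨Q', i⟩
    · rintro rfl
      exact absurd he.left (Finset.disjoint_left.1 ((inl_mem_labels.1 hl).2 Q hQ) he.right)
    · have hQ' := inr_mem_labels.1 hl
      rintro (rfl | ⟨g, hgR, hgQ', rfl⟩)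
      · exact absurd hQ' (hJ.notMem_of_borders hQ he)
      · obtain rfl := hJ.eq_of_mem hQ hQ' he.right_mem he.right he.left hgR hgQ'
        rw [eq_of_borders hK he (borders_of_mem he.left_mem he.right_mem he.ne hgQ' hgR)]
  · rintro rfl
    exact .inr ⟨e, he.right, he.left, rfl⟩

lemma mem_recombine_iff_of_mem (hJ : K.IsSparse J) (hK : K.IsTight) (hQ : Q ∈ J)
    (he : e ∈ K.bd Q) (hl : l ∈ K.labels J) :
    e ∈ K.recombine c l ↔ ∃ i, i ≠ c Q e ∧ l = .inr (Q, i) := by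
  obtain ⟨F, hF⟩ := exists_borders_left (hJ.subset hQ) he
  rw [mem_recombine_iff hF, hJ.hasLabel_iff_of_mem hQ hl, hJ.hasLabel_iff_of_borders hK hQ hF hl]
  grind

lemma exists_isPairOf_recombine_of_mem (hJ : K.IsSparse J) (hK : K.IsTight) (hQ : Q ∈ J)
    (he : e ∈ K.bd Q) : ∃ l l', IsPairOf (K.labels J) (e ∈ K.recombine c ·) l l' := by
  have other_colours : ∀ x : Fin 3, ∃ i j, i ≠ j ∧ ∀ k, k ≠ x ↔ k = i ∨ k = j := by decide
  obtain ⟨i, j, hij, hiff⟩ := other_colours (c Q e)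
  refine ⟨.inr (Q, i), .inr (Q, j), inr_mem_labels.2 hQ, inr_mem_labels.2 hQ, by simp [hij],
    fun l hl => ?_⟩
  rw [hJ.mem_recombine_iff_of_mem hK hQ he hl]
  simp only [hiff, or_and_right, exists_or, exists_eq_left]

end IsSparse

lemma hasLabel_iff_of_forall_disjoint (hR : ∀ Q ∈ J, Disjoint (K.bd R) (K.bd Q)) (hRJ : R ∉ J)
    (hl : l ∈ K.labels J) : K.HasLabel c R l ↔ l = .inl R := by
  rcases l with X | ⟨Q, i⟩
  · simp [HasLabel, eq_comm]
  · have hQ := inr_mem_labels.1 hl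
    refine iff_of_false ?_ (by simp)
    rintro (rfl | ⟨g, hgR, hgQ, -⟩)
    exacts [hRJ hQ, Finset.disjoint_left.1 (hR Q hQ) hgR hgQ]

lemma exists_label_of_notMem (hJ : K.IsSparse J) (hK : K.IsTight) (hR : R ∈ K.faces)
    (hRJ : R ∉ J) : ∃ l ∈ K.labels J, (∀ k ∈ K.labels J, K.HasLabel c R k ↔ k = l) ∧
      (l = .inl R ∨ ∃ Q ∈ J, ∃ g, K.Borders g Q R ∧ l = .inr (Q, c Q g)) := by
  by_cases hdisj : ∀ Q ∈ J, Disjoint (K.bd R) (K.bd Q)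
  · exact ⟨.inl R, inl_mem_labels.2 ⟨hR, hdisj⟩,
      fun _ hk => hasLabel_iff_of_forall_disjoint hdisj hRJ hk, .inl rfl⟩
  · push Not at hdisj
    obtain ⟨Q, hQ, hne⟩ := hdisj
    obtain ⟨g, hgR, hgQ⟩ := Finset.not_disjoint_iff.1 hne
    have hg : K.Borders g Q R :=
      borders_of_mem (hJ.subset hQ) hR (by rintro rfl; exact hRJ hQ) hgQ hgR
    exact ⟨.inr (Q, c Q g), inr_mem_labels.2 hQ,
      fun _ hk => hJ.hasLabel_iff_of_borders hK hQ hg hk, .inr ⟨Q, hQ, g, hg, rfl⟩⟩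

lemma exists_isPairOf_recombine (hJ : K.IsSparse J) (hK : K.IsTight)
    (hc : ∀ Q ∈ J, K.IsProperOn (K.bd Q) (c Q)) (he : K.Borders e A B) :
    ∃ l l', IsPairOf (K.labels J) (e ∈ K.recombine c ·) l l' := by
  by_cases hAJ : A ∈ J
  · exact hJ.exists_isPairOf_recombine_of_mem hK hAJ he.left
  by_cases hBJ : B ∈ J
  · exact hJ.exists_isPairOf_recombine_of_mem hK hBJ he.right
  obtain ⟨lA, hlA, hiffA, hA⟩ := exists_label_of_notMem (c := c) hJ hK he.left_mem hAJ
  obtain ⟨lB, hlB, hiffB, hB⟩ := exists_label_of_notMem (c := c) hJ hK he.right_mem hBJ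
  have hne : lA ≠ lB := by
    rintro rfl
    rcases hA with rfl | ⟨Q, hQ, g, hg, rfl⟩
    · exact he.ne (by simpa using hB)
    · obtain ⟨h, hh, hcol⟩ : ∃ h, K.Borders h Q B ∧ c Q g = c Q h := by
        simpa [hQ] using hB
      obtain ⟨hgh, hm⟩ := ne_and_meets_of_borders hK hg hh he
      exact hc Q hQ g hg.left h hh.left hgh hm hcol
  refine ⟨lA, lB, hlA, hlB, hne, fun k hk => ?_⟩
  rw [mem_recombine_iff he, hiffA k hk, hiffB k hk]
  grind

lemma isEvenDoubleCover_recombine (hJ : K.IsSparse J) (hK : K.IsTight)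
    (hc : ∀ Q ∈ J, K.IsProperOn (K.bd Q) (c Q)) :
    K.IsEvenDoubleCover (K.labels J) (K.recombine c) where
  isEven l _ :=
    { subset := Finset.filter_subset _ _
      even_inter_star := fun v hv => by
        rw [Finset.inter_comm]
        exact even_card_inter_oddPart (K.star_subset v hv)
          fun φ hφ => (isEven_bd (Finset.mem_filter.1 hφ).1).even_inter_star v hv }
  card_eq_two e he := by
    obtain ⟨A, B, hAB⟩ := exists_borders he
    obtain ⟨l, l', h⟩ := exists_isPairOf_recombine hJ hK hc hAB
    exact h.card_filter

/-! ### Many centres -/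

lemma IsSpoke.not_coversTriple (h : K.IsSpoke Q F₁ F₂ R e₁ e₂ s p q) (hJ : K.IsSparse J)
    (hK : K.IsTight) (hc : K.IsProperOn (K.bd Q) (c Q)) (hQ : Q ∈ J) :
    ¬ CoversTriple (K.labels J) (K.recombine c) e₁ s p := by
  rintro ⟨l, hl, he₁, hs, hp⟩
  obtain ⟨i, hi, rfl⟩ := (hJ.mem_recombine_iff_of_mem hK hQ h.borders₁.left hl).1 he₁
  have hF₁ : ¬ K.HasLabel c F₁ (.inr (Q, i)) := by
    simp [hJ.hasLabel_iff_of_borders hK hQ h.borders₁ hl, hi]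
  have hF₂ : K.HasLabel c F₂ (.inr (Q, i)) := by
    simpa [hF₁] using (mem_recombine_iff h.borders_spoke).1 hs
  have hR : K.HasLabel c R (.inr (Q, i)) := by
    simpa [hF₁] using (mem_recombine_iff h.borders_left).1 hp
  obtain rfl : i = c Q e₂ := by
    simpa [hJ.hasLabel_iff_of_borders hK hQ h.borders₂ hl] using hF₂
  obtain hRQ | ⟨g, hgR, hgQ, hcol⟩ := hR
  · exact h.ne hRQ.symm
  · have hg := borders_of_mem h.borders₁.left_mem h.borders_left.right_mem h.ne hgQ hgR
    obtain ⟨hne, hm⟩ := ne_and_meets_of_borders hK h.borders₂ hg h.borders_right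
    exact hc e₂ h.borders₂.left g hgQ hne hm hcol.symm

lemma IsSpoke.coversTriple (h : K.IsSpoke Q F₁ F₂ R e₁ e₂ s p q) (hJ : K.IsSparse J) (hQ : Q ∈ J)
    (hU : U ⊆ J) (hQU : Q ∉ U) : CoversTriple (K.labels U) (K.recombine c) e₁ s p := by
  have hF₁ : .inl F₁ ∈ K.labels U := by
    refine inl_mem_labels.2 ⟨h.borders₁.right_mem, fun Q' hQ' => ?_⟩
    by_contra hdisj
    obtain ⟨g, hgF, hgQ'⟩ := Finset.not_disjoint_iff.1 hdisj
    exact hQU (hJ.eq_of_mem hQ (hU hQ') h.borders₁.right_mem h.borders₁.right h.borders₁.left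
      hgF hgQ' ▸ hQ')
  have hsub := bd_subset_recombine_inl (c := c) h.borders₁.right_mem
  exact ⟨.inl F₁, hF₁, hsub h.borders₁.right, hsub h.borders_spoke.left, hsub h.borders_left.left⟩

lemma IsSparse.two_pow_card_le (hJ : K.IsSparse J) (hK : K.IsTight) :
    2 ^ J.card ≤ K.cdcs.card := by
  choose! c hc using fun Q (hQ : Q ∈ K.faces) =>
    ((isEven_bd hQ).exists_isProperOn_extension (κ := Fin 3) (by simp) (Finset.empty_subset _) 0
      (by simp [IsProperOn])).imp fun _ h => h.2
  refine two_pow_le_card_cdcs J K.labels (fun _ => K.recombine c) (fun U hU =>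
    isEvenDoubleCover_recombine (hJ.mono hU) hK fun Q hQ => hc Q (hJ.subset (hU hQ)))
    fun Q hQ => ?_
  obtain ⟨F₁, F₂, R, e₁, e₂, s, p, q, h⟩ := exists_isSpoke hK (hJ.subset hQ)
  have coversTriple_iff : ∀ U ⊆ J, CoversTriple (K.labels U) (K.recombine c) e₁ s p ↔ Q ∉ U :=
    fun U hU => ⟨fun htriple hQU => h.not_coversTriple (hJ.mono hU) hK (hc Q (hJ.subset hQ)) hQU
      htriple, h.coversTriple hJ hQ hU⟩
  refine ⟨e₁, s, p, h.meets₁, h.meets_left, fun U hU U' hU' hiff => ?_⟩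
  rwa [coversTriple_iff U hU, coversTriple_iff U' hU', not_iff_not] at hiff

lemma card_filter_not_disjoint_le (hA : A ∈ K.faces) :
    (K.faces.filter fun R => ¬ Disjoint (K.bd A) (K.bd R)).card ≤ (K.bd A).card * 2 := by
  have heq : (K.faces.filter fun R => ¬ Disjoint (K.bd A) (K.bd R)) =
      K.faces.filter fun R => ∃ e ∈ K.bd A, True ∧ e ∈ K.bd R := by
    simp [Finset.not_disjoint_iff]
  rw [heq]
  exact card_filter_exists_le (Finset.card_filter_le _ _)
    fun e he => (K.isEvenDoubleCover.card_eq_two e (bd_subset hA he)).le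

lemma exists_isSparse (d : ℕ) (hd : ∀ φ ∈ K.faces, (K.bd φ).card ≤ d) :
    ∃ J, K.IsSparse J ∧ K.faces.card ≤ J.card * (2 * d * (2 * d)) := by
  have card_le : ∀ A ∈ K.faces,
      (K.faces.filter fun R => ¬ Disjoint (K.bd A) (K.bd R)).card ≤ 2 * d := fun A hA => by
    linarith [card_filter_not_disjoint_le hA, hd A hA]
  obtain ⟨J, hJ, hind, hcard⟩ := exists_independent_subset K.faces
    (fun A B => ∃ R ∈ K.faces, ¬ Disjoint (K.bd A) (K.bd R) ∧ ¬ Disjoint (K.bd R) (K.bd B))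
    (2 * d * (2 * d))
    (fun A B ⟨R, hR, hA, hB⟩ => ⟨R, hR, by rwa [disjoint_comm], by rwa [disjoint_comm]⟩)
    (fun A hA => ⟨A, hA, by simpa using (K.bd_nonempty A hA).ne_empty,
      by simpa using (K.bd_nonempty A hA).ne_empty⟩)
    fun A hA => card_filter_exists_le (card_le A hA) card_le
  exact ⟨J, ⟨hJ, fun Q hQ Q' hQ' R hR h h' =>
    hind Q hQ Q' hQ' ⟨R, hR, by rwa [disjoint_comm], h'⟩⟩, hcard⟩

end FacedCubic

/-! ### One centre with a long boundary -/

namespace CubicIncidence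

variable {V E : Type*} {K : CubicIncidence V E} {A W U : Finset E} {m p : E → E} {a w w' : E}

/-- The edges in `W ⊆ A` are so far apart in `A` that colours can be prescribed independently
near each of them. -/
structure IsScattered (K : CubicIncidence V E) (A W : Finset E) : Prop where
  subset : W ⊆ A
  eq_of_meets : ∀ w ∈ W, ∀ w' ∈ W, ∀ a ∈ A, K.Meets w a → ∀ b ∈ A, K.Meets a b → K.Meets b w' →
    w = w'

lemma IsEven.exists_isScattered (hA : K.IsEven A) :
    ∃ W, K.IsScattered A W ∧ A.card ≤ W.card * 27 := by
  have hrefl : ∀ a ∈ A, K.Meets a a := fun a ha => .refl (hA.subset ha)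
  obtain ⟨W, hWA, hind, hcard⟩ := exists_independent_subset A
    (fun w w' => ∃ a ∈ A, K.Meets w a ∧ ∃ b ∈ A, K.Meets a b ∧ K.Meets b w') (3 * (3 * 3))
    (fun w w' ⟨a, ha, hwa, b, hb, hab, hbw'⟩ => ⟨b, hb, hbw'.symm, a, ha, hab.symm, hwa.symm⟩)
    (fun a ha => ⟨a, ha, hrefl a ha, a, ha, hrefl a ha, hrefl a ha⟩)
    fun w hw => card_filter_exists_le (hA.card_filter_meets_le hw) fun a ha =>
      card_filter_exists_le (hA.card_filter_meets_le ha) fun b hb => hA.card_filter_meets_le hb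
  exact ⟨W, ⟨hWA, fun w hw w' hw' a ha hwa b hb hab hbw' =>
    hind w hw w' hw' ⟨a, ha, hwa, b, hb, hab, hbw'⟩⟩, hcard⟩

lemma IsScattered.eq_of_common_neighbour (hW : K.IsScattered A W) (hA : K.IsEven A) (hw : w ∈ W)
    (hw' : w' ∈ W) (ha : a ∈ A) (hwa : K.Meets w a) (hwa' : K.Meets w' a) : w = w' :=
  hW.eq_of_meets w hw w' hw' a ha hwa a ha (.refl (hA.subset ha)) hwa'.symm

/-- A colouring near the edges `w` in `W` that gives `m w` and `p w` the same colour exactly for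
`w ∈ U`. -/
noncomputable def prescribedColor (W U : Finset E) (p : E → E) (a : E) : Fin 3 :=
  if a ∈ W then 1 else if ∃ w ∈ W \ U, a = p w then 2 else 0

lemma prescribedColor_of_mem (hw : w ∈ W) : prescribedColor W U p w = 1 := by
  simp [prescribedColor, hw]

lemma IsScattered.prescribedColor_left (hW : K.IsScattered A W) (hA : K.IsEven A)
    (hmp : ∀ w ∈ W, K.IsNeighbourPair A w (m w) (p w)) (hw : w ∈ W) :
    prescribedColor W U p (m w) = 0 := by
  have h := hmp w hw
  have hmW : m w ∉ W := fun hm => h.left_ne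
    (hW.eq_of_common_neighbour hA hw hm h.left_mem h.left_meets (.refl (hA.subset h.left_mem)))
  have hmp' : ¬ ∃ w' ∈ W \ U, m w = p w' := by
    rintro ⟨w', hw', heq⟩
    have hw' := (Finset.mem_sdiff.1 hw').1
    obtain rfl := hW.eq_of_common_neighbour hA hw hw' h.left_mem h.left_meets
      (heq ▸ (hmp w' hw').right_meets)
    exact h.not_meets (heq ▸ .refl (hA.subset h.left_mem))
  rw [prescribedColor, if_neg hmW, if_neg hmp']

lemma IsScattered.prescribedColor_right (hW : K.IsScattered A W) (hA : K.IsEven A)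
    (hmp : ∀ w ∈ W, K.IsNeighbourPair A w (m w) (p w)) (hw : w ∈ W) :
    prescribedColor W U p (p w) = if w ∈ U then 0 else 2 := by
  have h := hmp w hw
  have hpW : p w ∉ W := fun hp => h.right_ne
    (hW.eq_of_common_neighbour hA hw hp h.right_mem h.right_meets (.refl (hA.subset h.right_mem)))
  have hpp : (∃ w' ∈ W \ U, p w = p w') ↔ w ∉ U := by
    refine ⟨?_, fun hwU => ⟨w, Finset.mem_sdiff.2 ⟨hw, hwU⟩, rfl⟩⟩
    rintro ⟨w', hw', heq⟩
    obtain ⟨hw', hwU⟩ := Finset.mem_sdiff.1 hw'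
    obtain rfl := hW.eq_of_common_neighbour hA hw hw' h.right_mem h.right_meets
      (heq ▸ (hmp w' hw').right_meets)
    exact hwU
  rw [prescribedColor, if_neg hpW]
  simp only [hpp, ite_not]

lemma IsScattered.isProperOn_prescribedColor (hW : K.IsScattered A W) (hA : K.IsEven A)
    (hmp : ∀ w ∈ W, K.IsNeighbourPair A w (m w) (p w)) :
    K.IsProperOn (W.biUnion fun w => A.filter (K.Meets w)) (prescribedColor W U p) := by
  intro a ha b hb hab hm
  obtain ⟨w, hw, ha⟩ := Finset.mem_biUnion.1 ha
  obtain ⟨w', hw', hb⟩ := Finset.mem_biUnion.1 hb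
  obtain ⟨haA, hwa⟩ := Finset.mem_filter.1 ha
  obtain ⟨hbA, hwb⟩ := Finset.mem_filter.1 hb
  obtain rfl := hW.eq_of_meets w hw w' hw' a haA hwa b hbA hm hwb.symm
  have hleft : prescribedColor W U p w ≠ prescribedColor W U p (m w) := by
    rw [prescribedColor_of_mem hw, hW.prescribedColor_left hA hmp hw]
    decide
  have hright : prescribedColor W U p w ≠ prescribedColor W U p (p w) := by
    rw [prescribedColor_of_mem hw, hW.prescribedColor_right hA hmp hw]
    split_ifs <;> decide
  have hn := (hmp w hw).not_meets
  rcases (hmp w hw).eq_of_meets a haA hwa with rfl | rfl | rfl <;>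
    rcases (hmp _ hw).eq_of_meets b hbA hwb with rfl | rfl | rfl
  exacts [absurd rfl hab, hleft, hright, hleft.symm, absurd rfl hab, absurd hm hn, hright.symm,
    absurd hm.symm hn, absurd rfl hab]

lemma IsScattered.exists_isProperOn (hW : K.IsScattered A W) (hA : K.IsEven A)
    (hmp : ∀ w ∈ W, K.IsNeighbourPair A w (m w) (p w)) (U : Finset E) :
    ∃ c : E → Fin 3, K.IsProperOn A c ∧ ∀ w ∈ W, c (m w) = c (p w) ↔ w ∈ U := by
  obtain ⟨c, hext, hc⟩ := hA.exists_isProperOn_extension (κ := Fin 3) (by simp)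
    (Finset.biUnion_subset.2 fun w _ => Finset.filter_subset _ _) (prescribedColor W U p)
    (hW.isProperOn_prescribedColor hA hmp)
  refine ⟨c, hc, fun w hw => ?_⟩
  have h := hmp w hw
  rw [hext (m w) (Finset.mem_biUnion.2 ⟨w, hw, Finset.mem_filter.2 ⟨h.left_mem, h.left_meets⟩⟩),
    hext (p w) (Finset.mem_biUnion.2 ⟨w, hw, Finset.mem_filter.2 ⟨h.right_mem, h.right_meets⟩⟩),
    hW.prescribedColor_left hA hmp hw, hW.prescribedColor_right hA hmp hw]
  by_cases hwU : w ∈ U <;> simp [hwU]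

end CubicIncidence

namespace FacedCubic

open CubicIncidence

variable {V E Φ : Type*} {K : FacedCubic V E Φ} {J : Finset Φ} {c : Φ → E → Fin 3} {Q : Φ}
  {w m p : E}

lemma IsSparse.coversTriple_iff (hJ : K.IsSparse J) (hK : K.IsTight) (hQ : Q ∈ J)
    (hc : K.IsProperOn (K.bd Q) (c Q)) (hw : w ∈ K.bd Q) (h : K.IsNeighbourPair (K.bd Q) w m p) :
    CoversTriple (K.labels J) (K.recombine c) m w p ↔ c Q m = c Q p := by
  have common_colour : ∀ x y z : Fin 3, x ≠ y → x ≠ z →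
      ((∃ i, i ≠ y ∧ i ≠ x ∧ i ≠ z) ↔ y = z) := by decide
  rw [← common_colour _ _ _ (hc w hw m h.left_mem h.left_ne h.left_meets)
    (hc w hw p h.right_mem h.right_ne h.right_meets)]
  constructor
  · rintro ⟨l, hl, hml, hwl, hpl⟩
    obtain ⟨i, hi, rfl⟩ := (hJ.mem_recombine_iff_of_mem hK hQ h.left_mem hl).1 hml
    exact ⟨i, hi, by simpa using (hJ.mem_recombine_iff_of_mem hK hQ hw hl).1 hwl,
      by simpa using (hJ.mem_recombine_iff_of_mem hK hQ h.right_mem hl).1 hpl⟩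
  · rintro ⟨i, him, hiw, hip⟩
    have hl : .inr (Q, i) ∈ K.labels J := inr_mem_labels.2 hQ
    exact ⟨.inr (Q, i), hl, (hJ.mem_recombine_iff_of_mem hK hQ h.left_mem hl).2 ⟨i, him, rfl⟩,
      (hJ.mem_recombine_iff_of_mem hK hQ hw hl).2 ⟨i, hiw, rfl⟩,
      (hJ.mem_recombine_iff_of_mem hK hQ h.right_mem hl).2 ⟨i, hip, rfl⟩⟩

lemma exists_two_pow_le_of_mem_faces (hK : K.IsTight) (hfour : K.verts.card ≠ 4)
    (hQ : Q ∈ K.faces) : ∃ k : ℕ, (K.bd Q).card ≤ k * 27 ∧ 2 ^ k ≤ K.cdcs.card := by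
  have : Nonempty E := (K.bd_nonempty Q hQ).to_type
  have hev := isEven_bd hQ
  choose! m p hmp using fun w (hw : w ∈ K.bd Q) => hK.exists_isNeighbourPair hfour hev hw
  obtain ⟨W, hW, hcard⟩ := hev.exists_isScattered
  choose c hproper hc using hW.exists_isProperOn hev fun w hw => hmp w (hW.subset hw)
  have hsparse := isSparse_singleton hQ
  refine ⟨W.card, hcard, two_pow_le_card_cdcs W (fun _ => K.labels {Q})
    (fun U => K.recombine fun _ => c U) (fun U _ => isEvenDoubleCover_recombine hsparse hK
      (by simpa using hproper U)) fun w hw => ?_⟩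
  have h := hmp w (hW.subset hw)
  have coversTriple_iff : ∀ U, CoversTriple (K.labels {Q}) (K.recombine fun _ => c U) (m w) w (p w)
      ↔ w ∈ U := fun U => (hsparse.coversTriple_iff hK (Finset.mem_singleton_self Q) (hproper U)
    (hW.subset hw) h).trans (hc U w hw)
  refine ⟨m w, w, p w, h.left_meets.symm, h.right_meets, fun U _ U' _ hiff => ?_⟩
  rwa [coversTriple_iff U, coversTriple_iff U'] at hiff

end FacedCubic

/-! ### Cuts of two edges -/

namespace CubicIncidence

variable {V E : Type*} {K : CubicIncidence V E} {X : Finset V} {w x y z : V} {a b c d e g : E}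

/-- The necklace with four vertices: the edges `a` and `b` are parallel, so are `c` and `d`, and
the two digons are joined by the edges `e` and `g`. -/
structure IsNecklace (K : CubicIncidence V E) (w x y z : V) (a b c d e g : E) : Prop where
  verts_eq : K.verts = {w, x, y, z}
  star_w : K.star w = {e, a, b}
  star_x : K.star x = {g, a, b}
  star_y : K.star y = {e, c, d}
  star_z : K.star z = {g, c, d}
  nodup : [a, b, c, d, e, g].Nodup

/-- A double cover of the necklace by its two digons and two circuits of length four. -/
noncomputable def necklaceCover (a b c d e g : E) : Fin 4 → Finset E :=
  ![{a, b}, {c, d}, {e, g, a, c}, {e, g, b, d}]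

namespace IsNecklace

lemma swap (h : K.IsNecklace w x y z a b c d e g) : K.IsNecklace w x y z a b d c e g where
  verts_eq := h.verts_eq
  star_w := h.star_w
  star_x := h.star_x
  star_y := by rw [h.star_y, Finset.pair_comm]
  star_z := by rw [h.star_z, Finset.pair_comm]
  nodup := (((List.Perm.swap d c [e, g]).cons b).cons a).nodup_iff.1 h.nodup

lemma edges_eq (h : K.IsNecklace w x y z a b c d e g) : K.edges = {a, b, c, d, e, g} := by
  have star_subset : ∀ v ∈ ({w, x, y, z} : Finset V), K.star v ⊆ K.edges := fun v hv =>
    K.star_subset v (h.verts_eq ▸ hv)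
  simp only [Finset.forall_mem_insert, Finset.mem_singleton, forall_eq, h.star_w, h.star_x,
    h.star_y, h.star_z, Finset.insert_subset_iff, Finset.singleton_subset_iff] at star_subset
  refine Finset.Subset.antisymm (fun k hk => ?_) (by
    simp [Finset.insert_subset_iff, star_subset])
  obtain ⟨v, _, hv⟩ := exists_joins hk
  have hkv := hv.left
  have hmem : v = w ∨ v = x ∨ v = y ∨ v = z := by simpa [h.verts_eq] using hv.left_mem
  simp only [Finset.mem_insert, Finset.mem_singleton]
  rcases hmem with rfl | rfl | rfl | rfl <;> simp only [h.star_w, h.star_x, h.star_y, h.star_z,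
    Finset.mem_insert, Finset.mem_singleton] at hkv <;> tauto

lemma isEvenDoubleCover (h : K.IsNecklace w x y z a b c d e g) :
    K.IsEvenDoubleCover Finset.univ (necklaceCover a b c d e g) := by
  have hnodup := h.nodup
  simp only [List.nodup_cons, List.mem_cons, List.not_mem_nil, or_false, not_or] at hnodup
  obtain ⟨⟨hab, hac, had, hae, hag⟩, ⟨hbc, hbd, hbe, hbg⟩, ⟨hcd, hce, hcg⟩, ⟨hde, hdg⟩, heg, -⟩ :=
    hnodup
  refine ⟨fun i _ => ⟨?_, ?_⟩, fun k hk => ?_⟩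
  · rw [h.edges_eq]
    fin_cases i <;> simp [necklaceCover, Finset.insert_subset_iff]
  · simp only [h.verts_eq, Finset.forall_mem_insert, Finset.mem_singleton, forall_eq, h.star_w,
      h.star_x, h.star_y, h.star_z]
    rw [even_card_inter_triple_iff (Ne.symm hae) (Ne.symm hbe) hab,
      even_card_inter_triple_iff (Ne.symm hag) (Ne.symm hbg) hab,
      even_card_inter_triple_iff (Ne.symm hce) (Ne.symm hde) hcd,
      even_card_inter_triple_iff (Ne.symm hcg) (Ne.symm hdg) hcd]
    fin_cases i <;> simp [necklaceCover] <;> grind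
  · rw [Finset.card_filter, Fin.sum_univ_four]
    have hk' : k = a ∨ k = b ∨ k = c ∨ k = d ∨ k = e ∨ k = g := by simpa [h.edges_eq] using hk
    simp only [necklaceCover, Matrix.cons_val]
    rcases hk' with rfl | rfl | rfl | rfl | rfl | rfl <;> simp <;> grind

lemma coversTriple : CoversTriple Finset.univ (necklaceCover a b c d e g) a e c :=
  ⟨2, by simp [necklaceCover]⟩

lemma not_coversTriple (h : K.IsNecklace w x y z a b c d e g) :
    ¬ CoversTriple Finset.univ (necklaceCover a b c d e g) a e d := by
  have hnodup := h.nodup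
  simp only [List.nodup_cons, List.mem_cons, List.not_mem_nil, or_false, not_or] at hnodup
  rintro ⟨i, -, hi⟩
  fin_cases i <;> simp [necklaceCover] at hi <;> grind

lemma two_le_card_cdcs (h : K.IsNecklace w x y z a b c d e g) : 2 ≤ K.cdcs.card := by
  have hae : K.Meets a e := ⟨w, by simp [h.verts_eq], by simp [h.star_w], by simp [h.star_w]⟩
  have hec : K.Meets e c := ⟨y, by simp [h.verts_eq], by simp [h.star_y], by simp [h.star_y]⟩
  have hne := h.swap.not_coversTriple
  have heq := coversTriple (a := a) (b := b) (c := c) (d := d) (e := e) (g := g)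
  refine card_le_card_cdcs (Finset.univ : Finset Bool) (fun _ => Finset.univ)
    (fun s => if s then necklaceCover a b c d e g else necklaceCover a b d c e g) ?_ ?_
  · rintro (_ | _) -
    exacts [h.swap.isEvenDoubleCover, h.isEvenDoubleCover]
  · intro s _ t _ hst
    refine ⟨a, e, c, hae, hec, ?_⟩
    cases s <;> cases t <;> simp_all

end IsNecklace

/-- Every cut of three edges separates at most one vertex from the rest. -/
def HasTrivialThreeCuts (K : CubicIncidence V E) : Prop :=
  ∀ X ⊆ K.verts, (K.cut X).card = 3 → X.card ≤ 1 ∨ (K.verts \ X).card ≤ 1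

lemma exists_star_eq_of_cut_eq_pair (hX : X ⊆ K.verts) (hcard : X.card = 2) (heg : e ≠ g)
    (hcut : K.cut X = {e, g}) : ∃ x y a b, x ≠ y ∧ X = {x, y} ∧ a ≠ b ∧ a ≠ e ∧ a ≠ g ∧ b ≠ e ∧
      b ≠ g ∧ K.star x = {e, a, b} ∧ K.star y = {g, a, b} := by
  obtain ⟨x, hxX, hex⟩ := exists_mem_star_of_mem_cut (show e ∈ K.cut X by simp [hcut])
  obtain ⟨y, hyx⟩ := Finset.card_eq_one.1
    (show (X.erase x).card = 1 by rw [Finset.card_erase_of_mem hxX, hcard])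
  obtain ⟨hne, hyX⟩ := Finset.mem_erase.1 (hyx ▸ Finset.mem_singleton_self y : y ∈ X.erase x)
  obtain rfl : X = {x, y} := by rw [← Finset.insert_erase hxX, hyx]
  have hx := hX hxX
  have hy := hX hyX
  have mem_star_iff : ∀ k, k = e ∨ k = g ↔ ¬ (k ∈ K.star y ↔ k ∈ K.star x) := fun k => by
    rw [← cut_singleton hy, ← mem_cut_insert hx (by simpa using hne.symm), hcut]
    simp
  have hcards : (K.star y).card = (K.star x).card := by rw [K.card_star x hx, K.card_star y hy]
  have hgx : g ∉ K.star x := fun hgx => by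
    have hsub : K.star y ⊆ K.star x := fun k hk => by have := mem_star_iff k; grind
    have hey := Finset.eq_of_subset_of_card_le hsub hcards.ge ▸ hex
    exact (mem_star_iff e).1 (.inl rfl) (iff_of_true hey hex)
  obtain ⟨a, b, hea, heb, hab, hsx⟩ := exists_star_eq_triple hx hex
  have hag : a ≠ g := by rintro rfl; simp [hsx] at hgx
  have hbg : b ≠ g := by rintro rfl; simp [hsx] at hgx
  refine ⟨x, y, a, b, hne.symm, rfl, hab, hea.symm, hag, heb.symm, hbg, hsx,
    (Finset.eq_of_subset_of_card_le (fun k hk => ?_) ?_).symm⟩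
  · have := mem_star_iff k
    simp only [hsx, Finset.mem_insert, Finset.mem_singleton] at hk this
    grind
  · rw [K.card_star y hy, Finset.card_eq_three.2 ⟨g, a, b, hag.symm, hbg.symm, hab, rfl⟩]

lemma card_cut_insert_of_card_cut_eq_two (hbridge : ∀ X ⊆ K.verts, (K.cut X).card ≠ 1)
    (hX : X ⊆ K.verts) (hcut : (K.cut X).card = 2) (heX : e ∈ K.cut X) (hy : y ∈ K.verts)
    (hyX : y ∉ X) (hey : e ∈ K.star y) : (K.cut (insert y X)).card = 3 := by
  have hne := hbridge (insert y X) (Finset.insert_subset hy hX)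
  have hunion : K.cut (insert y X) = K.cut X \ K.star y ∪ K.star y \ K.cut X := by
    ext k
    rw [mem_cut_insert hy hyX, Finset.mem_union, Finset.mem_sdiff, Finset.mem_sdiff]
    tauto
  rw [hunion, Finset.card_union_of_disjoint disjoint_sdiff_sdiff] at hne ⊢
  have hleft := Finset.card_sdiff_add_card_inter (K.cut X) (K.star y)
  have hright := Finset.card_sdiff_add_card_inter (K.star y) (K.cut X)
  rw [Finset.inter_comm, K.card_star y hy] at hright
  have hpos : 0 < (K.cut X ∩ K.star y).card :=
    Finset.card_pos.2 ⟨e, Finset.mem_inter.2 ⟨heX, hey⟩⟩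
  omega

lemma HasTrivialThreeCuts.card_compl_eq_two (h : K.HasTrivialThreeCuts)
    (hbridge : ∀ X ⊆ K.verts, (K.cut X).card ≠ 1) (hX : X ⊆ K.verts)
    (hcut : (K.cut X).card = 2) : (K.verts \ X).card = 2 := by
  obtain ⟨e, he⟩ : (K.cut X).Nonempty := Finset.card_pos.1 (by omega)
  obtain ⟨x, hxX, hex⟩ := exists_mem_star_of_mem_cut he
  rw [← cut_compl hX] at he
  obtain ⟨y, hyX, hey⟩ := exists_mem_star_of_mem_cut he
  rw [cut_compl hX] at he
  obtain ⟨hy, hyX'⟩ := Finset.mem_sdiff.1 hyX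
  have hthree := card_cut_insert_of_card_cut_eq_two hbridge hX hcut he hy hyX' hey
  have hle := h _ (Finset.insert_subset hy hX) hthree
  rw [Finset.sdiff_insert, Finset.card_erase_of_mem hyX,
    Finset.card_insert_of_notMem hyX'] at hle
  have hXpos : 0 < X.card := Finset.card_pos.2 ⟨x, hxX⟩
  have hpos : 0 < (K.verts \ X).card := Finset.card_pos.2 ⟨y, hyX⟩
  have heven : Even (K.verts \ X).card := by
    rw [← even_card_cut_iff Finset.sdiff_subset, cut_compl hX, hcut]
    exact even_two
  obtain ⟨r, hr⟩ := heven
  omega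

lemma HasTrivialThreeCuts.exists_isNecklace (h : K.HasTrivialThreeCuts)
    (hbridge : ∀ X ⊆ K.verts, (K.cut X).card ≠ 1) (hX : X ⊆ K.verts)
    (hcut : (K.cut X).card = 2) : ∃ w x y z a b c d e g, K.IsNecklace w x y z a b c d e g := by
  have hYX : K.cut (K.verts \ X) = K.cut X := cut_compl hX
  have hY := h.card_compl_eq_two hbridge hX hcut
  have hXcard := h.card_compl_eq_two hbridge Finset.sdiff_subset (hYX ▸ hcut)
  rw [Finset.sdiff_sdiff_eq_self hX] at hXcard
  obtain ⟨e, g, heg, hceg⟩ := Finset.card_eq_two.1 hcut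
  obtain ⟨w, x, a, b, hwx, hXwx, hab, hae, hag, hbe, hbg, hw, hx⟩ :=
    exists_star_eq_of_cut_eq_pair hX hXcard heg hceg
  obtain ⟨y, z, c, d, -, hXyz, hcd, hce, hcg, hde, hdg, hy, hz⟩ :=
    exists_star_eq_of_cut_eq_pair Finset.sdiff_subset hY heg (hYX.trans hceg)
  have hverts : K.verts = {w, x, y, z} := by
    rw [← Finset.union_sdiff_of_subset hX, hXyz, hXwx, Finset.insert_union, Finset.singleton_union]
  have hyX : y ∈ K.verts \ X := by simp [hXyz]
  have notMem_star : ∀ k, k ∈ K.star w → k ∈ K.star x → k ∉ K.star y := fun k hkw hkx hky => by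
    have hjoins := joins_of_mem_star (hX (by simp [hXwx])) (hX (by simp [hXwx])) hwx hkw hkx
    have := (hjoins.iff y (Finset.mem_sdiff.1 hyX).1).1 hky
    exact (Finset.mem_sdiff.1 hyX).2 (by simpa [hXwx] using this)
  have ha : a ∉ K.star y := notMem_star a (by simp [hw]) (by simp [hx])
  have hb : b ∉ K.star y := notMem_star b (by simp [hw]) (by simp [hx])
  simp only [hy, Finset.mem_insert, Finset.mem_singleton, not_or] at ha hb
  refine ⟨w, x, y, z, a, b, c, d, e, g, hverts, hw, hx, hy, hz, ?_⟩
  simp [*]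

lemma HasTrivialThreeCuts.isTight (h : K.HasTrivialThreeCuts) (hconn : K.IsConnected)
    (hbridge : ∀ X ⊆ K.verts, (K.cut X).card ≠ 1) (htwo : ∀ X ⊆ K.verts, (K.cut X).card ≠ 2)
    (hn : 4 ≤ K.verts.card) : K.IsTight where
  three_le_card_cut X hX hne := by
    have hzero : (K.cut X).card ≠ 0 := fun hzero =>
      (hconn X hX.subset (Finset.card_eq_zero.1 hzero)).elim hne.ne_empty hX.ne
    have := hbridge X hX.subset
    have := htwo X hX.subset
    omega
  exists_cut_eq_star X hX hcut := by
    have exists_of_card_le_one : ∀ Y ⊆ K.verts, (K.cut Y).card = 3 → Y.card ≤ 1 →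
        ∃ v ∈ K.verts, K.cut Y = K.star v := fun Y hY hthree hle => by
      obtain ⟨e, he⟩ : (K.cut Y).Nonempty := Finset.card_pos.1 (by omega)
      obtain ⟨v, hv, -⟩ := exists_mem_star_of_mem_cut he
      obtain rfl : Y = {v} := Finset.eq_singleton_iff_unique_mem.2
        ⟨hv, fun u hu => Finset.card_le_one.1 hle u hu v hv⟩
      exact ⟨v, hY hv, cut_singleton (hY hv)⟩
    rcases h X hX hcut with hle | hle
    · exact exists_of_card_le_one X hX hcut hle
    · rw [← cut_compl hX] at hcut ⊢
      exact exists_of_card_le_one _ Finset.sdiff_subset hcut hle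
  four_le_card_verts := hn

end CubicIncidence

/-! ### The lower bound -/

namespace FacedCubic

open CubicIncidence

variable {V E Φ : Type*} {K : FacedCubic V E Φ} {S : Finset V} {s t : V}

lemma two_mul_card_faces_le_of_card_verts_eq_four (hfour : K.verts.card = 4) :
    2 * K.faces.card ≤ (18 * 1) ^ 3 := by
  have := K.isEvenDoubleCover.card_le K.bd_nonempty
  omega

lemma exists_two_pow_le_card_cdcs_of_isTight (hK : K.IsTight) :
    ∃ m, 2 * K.faces.card ≤ (18 * m) ^ 3 ∧ 2 ^ m ≤ K.cdcs.card := by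
  have hfaces : K.faces.Nonempty := by
    obtain ⟨v, hv⟩ : K.verts.Nonempty := Finset.card_pos.1 (by have := hK.four_le_card_verts; omega)
    obtain ⟨e, he⟩ : (K.star v).Nonempty := Finset.card_pos.1 (by rw [K.card_star v hv]; omega)
    obtain ⟨A, _, hA⟩ := exists_borders (K.star_subset v hv he)
    exact ⟨A, hA.left_mem⟩
  obtain ⟨Q, hQ, hmax⟩ := K.faces.exists_max_image (fun φ => (K.bd φ).card) hfaces
  by_cases hfour : K.verts.card = 4
  · exact ⟨1, two_mul_card_faces_le_of_card_verts_eq_four hfour,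
      by simpa using (isSparse_singleton hQ).two_pow_card_le hK⟩
  -- Either the longest face or a sparse set of faces supplies the exponent.
  obtain ⟨k, hk, hkpow⟩ := exists_two_pow_le_of_mem_faces hK hfour hQ
  obtain ⟨J, hJ, hJcard⟩ := exists_isSparse (K := K) (K.bd Q).card hmax
  refine ⟨max k J.card, ?_, ?_⟩
  · set m := max k J.card
    have hQm : (K.bd Q).card ≤ m * 27 := hk.trans (by gcongr; exact le_max_left _ _)
    calc 2 * K.faces.card ≤ 2 * (J.card * (2 * (K.bd Q).card * (2 * (K.bd Q).card))) := by gcongr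
      _ ≤ 2 * (m * (2 * (m * 27) * (2 * (m * 27)))) := by gcongr; exact le_max_right _ _
      _ = (18 * m) ^ 3 := by ring
  · rcases max_choice k J.card with hm | hm <;> rw [hm]
    exacts [hkpow, hJ.two_pow_card_le hK]

lemma exists_two_pow_le_card_cdcs_of_contract (h : K.IsContractible S s)
    (h' : K.IsContractible (K.verts \ S) t) {m m' : ℕ}
    (hm : 2 * (K.contract h).faces.card ≤ (18 * m) ^ 3)
    (hm' : 2 * (K.contract h').faces.card ≤ (18 * m') ^ 3)
    (hpow : 2 ^ m ≤ (K.contract h).cdcs.card) (hpow' : 2 ^ m' ≤ (K.contract h').cdcs.card) :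
    ∃ m, 2 * K.faces.card ≤ (18 * m) ^ 3 ∧ 2 ^ m ≤ K.cdcs.card := by
  refine ⟨m + m', ?_, ?_⟩
  · calc 2 * K.faces.card ≤ (18 * m) ^ 3 + (18 * m') ^ 3 := by
          have := card_faces_le_contract h h'
          omega
      _ ≤ (18 * m + 18 * m') ^ 3 := pow_add_pow_le (Nat.zero_le _) (Nat.zero_le _) (by norm_num)
      _ = (18 * (m + m')) ^ 3 := by rw [mul_add]
  · calc 2 ^ (m + m') = 2 ^ m * 2 ^ m' := pow_add 2 m m'
      _ ≤ (K.contract h).cdcs.card * (K.contract h').cdcs.card := Nat.mul_le_mul hpow hpow'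
      _ ≤ K.cdcs.card := card_cdcs_contract_mul_le h h'

lemma three_le_card_of_card_cut_eq_three (hS : S ⊆ K.verts) (hcut : (K.cut S).card = 3)
    (hcard : 1 < S.card) : 3 ≤ S.card := by
  have hodd : ¬ Even S.card := by
    rw [← even_card_cut_iff hS, hcut]
    decide
  have htwo : S.card ≠ 2 := fun htwo => hodd (htwo ▸ even_two)
  omega

theorem exists_two_pow_le_card_cdcs (K : FacedCubic V E Φ) (hn : 4 ≤ K.verts.card) :
    ∃ m, 2 * K.faces.card ≤ (18 * m) ^ 3 ∧ 2 ^ m ≤ K.cdcs.card := by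
  induction h : K.verts.card using Nat.strong_induction_on generalizing K with | _ n ih =>
  subst h
  by_cases hthree : K.HasTrivialThreeCuts
  · by_cases htwo : ∃ X ⊆ K.verts, (K.cut X).card = 2
    · obtain ⟨X, hX, hcut⟩ := htwo
      obtain ⟨w, x, y, z, a, b, c, d, e, g, hneck⟩ :=
        hthree.exists_isNecklace (fun _ => card_cut_ne_one) hX hcut
      have hle : K.verts.card ≤ 4 := hneck.verts_eq ▸ Finset.card_le_four
      exact ⟨1, two_mul_card_faces_le_of_card_verts_eq_four (hle.antisymm hn),
        hneck.two_le_card_cdcs⟩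
    · push Not at htwo
      exact exists_two_pow_le_card_cdcs_of_isTight
        (hthree.isTight K.isConnected (fun _ => card_cut_ne_one) htwo hn)
  · simp only [HasTrivialThreeCuts] at hthree
    push Not at hthree
    obtain ⟨S, hS, hcut, hScard, hTcard⟩ := hthree
    obtain ⟨s, hs⟩ : S.Nonempty := Finset.card_pos.1 (by omega)
    obtain ⟨t, ht⟩ : (K.verts \ S).Nonempty := Finset.card_pos.1 (by omega)
    have hcontr : K.IsContractible S s := ⟨hS, hcut, hs⟩
    have hcontr' := hcontr.compl ht
    have hSthree := three_le_card_of_card_cut_eq_three hS hcut hScard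
    have hTthree := three_le_card_of_card_cut_eq_three hcontr'.subset hcontr'.card_cut hTcard
    have hsum := Finset.card_sdiff_add_card_eq_card hS
    have hverts : (K.contract hcontr).verts.card = _ := card_verts_contract hcontr
    have hverts' : (K.contract hcontr').verts.card = _ := card_verts_contract hcontr'
    rw [Finset.sdiff_sdiff_eq_self hS] at hverts'
    obtain ⟨m, hm, hpow⟩ := ih _ (by omega) (K.contract hcontr) (by omega) rfl
    obtain ⟨m', hm', hpow'⟩ := ih _ (by omega) (K.contract hcontr') (by omega) rfl
    exact exists_two_pow_le_card_cdcs_of_contract hcontr hcontr' hm hm' hpow hpow'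

end FacedCubic

/-! ### Cubic graphs and their circuits -/

section CubicGraph

open Graph

variable {α β : Type*} {G : Graph α β} {D T : Set β} {X : Set α} {e : β} {u v x y : α}

/-- Every edge of `G` with exactly one end in `X` belongs to `D`. -/
def CrossedOnlyBy (G : Graph α β) (X : Set α) (D : Set β) : Prop :=
  ∀ e u v, e ∉ D → G.IsLink e u v → (u ∈ X ↔ v ∈ X)

lemma CrossedOnlyBy.isBridge (h : CrossedOnlyBy G X {e}) (he : G.IsLink e x y) (hx : x ∈ X)
    (hy : y ∉ X) : G.IsBridge e := by
  suffices hreach : ∀ z, Relation.ReflTransGen (G.deleteEdges {e}).Adj x z → z ∈ X from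
    ⟨x, y, he, fun hxy => hy (hreach y hxy)⟩
  intro z hz
  induction hz with
  | refl => exact hx
  | tail _ hab ih =>
    obtain ⟨f, hf⟩ := hab
    rw [deleteEdges_isLink] at hf
    exact (h f _ _ hf.2 hf.1).1 ih

lemma CrossedOnlyBy.mem_of_empty (h : CrossedOnlyBy G X ∅) (hG : G.IsConnected) (hu : u ∈ V(G))
    (hv : v ∈ V(G)) (huX : u ∈ X) : v ∈ X := by
  suffices hreach : ∀ z, Relation.ReflTransGen G.Adj u z → z ∈ X from hreach v (hG.2 u hu v hv)
  intro z hz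
  induction hz with
  | refl => exact huX
  | tail _ hab ih =>
    obtain ⟨f, hf⟩ := hab
    exact (h f _ _ (Set.notMem_empty f) hf).1 ih

lemma CrossedOnlyBy.mem_of_singleton (h : CrossedOnlyBy G X {e}) (hG : G.IsConnected)
    (hb : G.IsBridgeless) (hu : u ∈ V(G)) (hv : v ∈ V(G)) (huX : u ∈ X) : v ∈ X := by
  refine CrossedOnlyBy.mem_of_empty (fun f a b _ hf => ?_) hG hu hv huX
  by_cases hfe : f = e
  · subst hfe
    by_contra hab
    by_cases ha : a ∈ X
    · exact hb f (h.isBridge hf ha (by tauto))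
    · exact hb f (h.isBridge hf.symm (by tauto) ha)
  · exact h f a b hfe hf

lemma deg_eq_encard_incidenceSet (h : ∀ e, ¬ G.IsLink e x x) :
    G.deg x = (G.incidenceSet x).encard := by
  have loopSet_eq : G.loopSet x = ∅ := Set.eq_empty_of_forall_notMem h
  rw [deg, loopSet_eq, Set.encard_empty, add_zero]

lemma finite_incidenceSet_of_isCubic (hG : G.IsCubic) (hx : x ∈ V(G)) :
    (G.incidenceSet x).Finite :=
  Set.encard_lt_top_iff.1 <| calc
    (G.incidenceSet x).encard ≤ G.deg x := le_self_add
    _ = 3 := hG x hx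
    _ < ⊤ := ENat.natCast_lt_top 3

lemma finite_edgeSet_of_isCubic (hG : G.IsCubic) (hfin : V(G).Finite) : E(G).Finite := by
  refine (hfin.biUnion fun x hx => finite_incidenceSet_of_isCubic hG hx).subset fun e he => ?_
  obtain ⟨x, y, h⟩ := exists_isLink_of_mem_edgeSet he
  exact Set.mem_biUnion h.left_mem h.inc_left

lemma exists_incidenceSet_sdiff_loopSet_eq_singleton (hG : G.IsCubic) (he : G.IsLink e x x) :
    ∃ f, G.incidenceSet x \ G.loopSet x = {f} := by
  have hfin := finite_incidenceSet_of_isCubic hG he.left_mem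
  have hsub := G.loopSet_subset_incidenceSet x
  have hloop_fin := hfin.subset hsub
  have hsum : (G.incidenceSet x).ncard + (G.loopSet x).ncard = 3 := by
    have hdeg := hG x he.left_mem
    rw [deg, ← hfin.cast_ncard_eq, ← hloop_fin.cast_ncard_eq] at hdeg
    exact_mod_cast hdeg
  have hpos : 0 < (G.loopSet x).ncard := (Set.ncard_pos hloop_fin).2 ⟨e, he⟩
  have hdiff := Set.ncard_sdiff_add_ncard_of_subset hsub hfin
  exact Set.ncard_eq_one.1 (by omega)

lemma not_isLink_self_of_isCubic (hG : G.IsCubic) (hb : G.IsBridgeless) (e : β) (x : α) :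
    ¬ G.IsLink e x x := by
  intro he
  obtain ⟨f, hf⟩ := exists_incidenceSet_sdiff_loopSet_eq_singleton hG he
  obtain ⟨⟨y, hy⟩, hfloop⟩ : f ∈ G.incidenceSet x \ G.loopSet x := hf ▸ rfl
  have hyx : y ∉ ({x} : Set α) := fun h => hfloop (Set.mem_singleton_iff.1 h ▸ hy)
  have eq_of_isLink : ∀ g v, g ∉ ({f} : Set β) → G.IsLink g x v → v = x := fun g v hg hgv => by
    by_contra hv
    exact hg (hf ▸ ⟨⟨v, hgv⟩, fun hloop => hv (hgv.right_unique hloop)⟩)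
  have hcross : CrossedOnlyBy G {x} {f} := fun g u v hg hl =>
    ⟨by rintro rfl; exact eq_of_isLink g v hg hl, by rintro rfl; exact eq_of_isLink g u hg hl.symm⟩
  exact hb f (hcross.isBridge hy rfl hyx)

/-- The incidences of a finite cubic bridgeless graph. -/
noncomputable def cubicIncidence (hG : G.IsCubic) (hb : G.IsBridgeless) (hfin : V(G).Finite) :
    CubicIncidence α β where
  verts := hfin.toFinset
  edges := (finite_edgeSet_of_isCubic hG hfin).toFinset
  star v := (finite_edgeSet_of_isCubic hG hfin).toFinset.filter fun e => G.Inc e v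
  star_subset _ _ := Finset.filter_subset _ _
  card_star v hv := by
    have hv : v ∈ V(G) := hfin.mem_toFinset.1 hv
    have coe_star : (((finite_edgeSet_of_isCubic hG hfin).toFinset.filter fun e => G.Inc e v :
        Finset β) : Set β) = G.incidenceSet v := by
      ext e
      simpa using Inc.edge_mem
    have hdeg := deg_eq_encard_incidenceSet (not_isLink_self_of_isCubic hG hb · v)
    rw [hG v hv, ← coe_star, Set.encard_coe_eq_coe_finsetCard] at hdeg
    exact_mod_cast hdeg.symm
  card_ends e he := by
    have he := (finite_edgeSet_of_isCubic hG hfin).mem_toFinset.1 he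
    obtain ⟨x, y, hl⟩ := exists_isLink_of_mem_edgeSet he
    refine IsPairOf.card_filter (x := x) (y := y) ⟨hfin.mem_toFinset.2 hl.left_mem,
      hfin.mem_toFinset.2 hl.right_mem, ?_, fun v _ => ?_⟩
    · rintro rfl
      exact not_isLink_self_of_isCubic hG hb e x hl
    · simp only [Finset.mem_filter, Set.Finite.mem_toFinset, he, true_and]
      exact ⟨fun h => h.eq_or_eq_of_isLink hl,
        by rintro (rfl | rfl); exacts [hl.inc_left, hl.inc_right]⟩

variable {hG : G.IsCubic} {hb : G.IsBridgeless} {hfin : V(G).Finite}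

lemma mem_verts_cubicIncidence : v ∈ (cubicIncidence hG hb hfin).verts ↔ v ∈ V(G) :=
  hfin.mem_toFinset

lemma mem_edges_cubicIncidence : e ∈ (cubicIncidence hG hb hfin).edges ↔ e ∈ E(G) :=
  (finite_edgeSet_of_isCubic hG hfin).mem_toFinset

lemma mem_star_cubicIncidence : e ∈ (cubicIncidence hG hb hfin).star v ↔ G.Inc e v := by
  simpa [cubicIncidence] using Inc.edge_mem

lemma joins_cubicIncidence (h : G.IsLink e x y) : (cubicIncidence hG hb hfin).Joins e x y where
  left_mem := mem_verts_cubicIncidence.2 h.left_mem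
  right_mem := mem_verts_cubicIncidence.2 h.right_mem
  ne := by
    rintro rfl
    exact not_isLink_self_of_isCubic hG hb e x h
  iff v _ := mem_star_cubicIncidence.trans ⟨fun hv => hv.eq_or_eq_of_isLink h,
    by rintro (rfl | rfl); exacts [h.inc_left, h.inc_right]⟩

lemma crossedOnlyBy_cut {Y : Finset α} (hY : Y ⊆ (cubicIncidence hG hb hfin).verts) :
    CrossedOnlyBy G Y ((cubicIncidence hG hb hfin).cut Y) := by
  intro e u v he hl
  rw [Finset.mem_coe, (joins_cubicIncidence hl).mem_cut_iff hY] at he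
  simp only [Finset.mem_coe]
  tauto

lemma CrossedOnlyBy.mem_of_mem_cut (h : CrossedOnlyBy G X D)
    (he : e ∈ (cubicIncidence hG hb hfin).cut ((cubicIncidence hG hb hfin).verts.filter (· ∈ X))) :
    e ∈ D := by
  obtain ⟨u, v, hl⟩ := exists_isLink_of_mem_edgeSet
    (mem_edges_cubicIncidence.1 (CubicIncidence.cut_subset _ he))
  have hends := joins_cubicIncidence (hG := hG) (hb := hb) (hfin := hfin) hl
  rw [hends.mem_cut_iff (Finset.filter_subset _ _)] at he
  simp only [Finset.mem_filter, hends.left_mem, hends.right_mem, true_and] at he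
  by_contra heD
  have := h e u v heD hl
  tauto

lemma isConnected_cubicIncidence (hconn : G.IsConnected) :
    (cubicIncidence hG hb hfin).IsConnected := by
  intro Y hY hcut
  have hcross := crossedOnlyBy_cut hY
  rw [hcut, Finset.coe_empty] at hcross
  rcases Y.eq_empty_or_nonempty with hempty | ⟨x, hx⟩
  · exact .inl hempty
  · exact .inr (hY.antisymm fun y hy => Finset.mem_coe.1 (hcross.mem_of_empty hconn
      (mem_verts_cubicIncidence.1 (hY hx)) (mem_verts_cubicIncidence.1 hy) hx))

/-- The subgraph of `G` formed by the edges in `T` and their ends. -/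
def edgeSpan (G : Graph α β) (T : Set β) : Graph α β where
  vertexSet := {x | ∃ e ∈ T, G.Inc e x}
  IsLink e x y := e ∈ T ∧ G.IsLink e x y
  isLink_symm _ _ := ⟨fun _ _ h => ⟨h.1, h.2.symm⟩⟩
  eq_or_eq_of_isLink_of_isLink _ _ _ _ _ h h' := h.2.left_eq_or_eq h'.2
  left_mem_of_isLink e _ _ h := ⟨e, h.1, h.2.inc_left⟩

lemma edgeSpan_le : edgeSpan G T ≤ G where
  vertexSet_mono := fun _ ⟨_, _, h⟩ => h.vertex_mem
  isLink_mono := fun _ _ _ h => h.2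

lemma edgeSet_edgeSpan (hT : T ⊆ E(G)) : E(edgeSpan G T) = T := by
  ext e
  refine ⟨fun ⟨x, y, h⟩ => h.1, fun h => ?_⟩
  obtain ⟨x, y, hl⟩ := exists_isLink_of_mem_edgeSet (hT h)
  exact ⟨x, y, h, hl⟩

lemma deg_edgeSpan (hloop : ∀ e, ¬ G.IsLink e x x) :
    (edgeSpan G T).deg x = (T ∩ G.incidenceSet x).encard := by
  have hloop' : ∀ e, ¬ (edgeSpan G T).IsLink e x x := fun e h => hloop e h.2
  rw [deg_eq_encard_incidenceSet hloop']
  congr 1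
  ext e
  exact ⟨fun ⟨y, h⟩ => ⟨h.1, y, h.2⟩, fun ⟨h, y, hy⟩ => ⟨y, h, hy⟩⟩

variable {C : Finset β}

-- The edges of `C` that can be reached from `x` form a nonempty even subset of `C`.
lemma reflTransGen_adj_edgeSpan_of_isCircuit (hC : (cubicIncidence hG hb hfin).IsCircuit C)
    {e g : β} (he : e ∈ C) (hex : G.Inc e x) (hg : g ∈ C) (hgy : G.Inc g y) :
    Relation.ReflTransGen (edgeSpan G C).Adj x y := by
  set reach := Relation.ReflTransGen (edgeSpan G C).Adj x
  have reach_of_inc : ∀ k ∈ C, ∀ u v, G.Inc k u → G.Inc k v → reach u → reach v := by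
    intro k hk u v ⟨w, hw⟩ hkv hu
    by_cases huv : v = u
    · exact huv ▸ hu
    · exact hkv.eq_of_isLink_of_ne_left hw huv ▸ hu.tail ⟨k, hk, hw⟩
  set D := C.filter fun k => ∃ u, G.Inc k u ∧ reach u
  have mem_D_iff : ∀ k v, G.Inc k v → (k ∈ D ↔ k ∈ C ∧ reach v) := fun k v hkv => by
    rw [Finset.mem_filter]
    exact and_congr_right fun hk =>
      ⟨fun ⟨u, hku, hu⟩ => reach_of_inc k hk u v hku hkv hu, fun hv => ⟨v, hkv, hv⟩⟩
  have hD : (cubicIncidence hG hb hfin).IsEven D := by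
    refine ⟨(Finset.filter_subset _ _).trans hC.isEven.subset, fun v hv => ?_⟩
    have inter_eq : D ∩ (cubicIncidence hG hb hfin).star v =
        if reach v then C ∩ (cubicIncidence hG hb hfin).star v else ∅ := by
      ext k
      by_cases hkv : G.Inc k v
      · split_ifs with hxv <;> simp [hxv, (mem_D_iff k v hkv)]
      · split_ifs <;> simp [mem_star_cubicIncidence, hkv]
    rw [inter_eq]
    split_ifs
    exacts [hC.isEven.even_inter_star v hv, by simp]
  have heD : e ∈ D := (mem_D_iff e x hex).2 ⟨he, .refl⟩
  have hDC := (hC.minimal D (Finset.filter_subset _ _) hD).resolve_left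
    (Finset.ne_empty_of_mem heD)
  exact ((mem_D_iff g y hgy).1 (hDC ▸ hg)).2

lemma isCircuitOf_edgeSpan (hC : (cubicIncidence hG hb hfin).IsCircuit C) :
    (edgeSpan G (C : Set β)).IsCircuitOf G where
  le := edgeSpan_le
  finite := hfin.subset edgeSpan_le.vertexSet_mono
  connected := by
    constructor
    · obtain ⟨e, he⟩ := hC.nonempty
      obtain ⟨x, y, hl⟩ := exists_isLink_of_mem_edgeSet
        (mem_edges_cubicIncidence.1 (hC.isEven.subset he))
      exact ⟨x, e, he, hl.inc_left⟩
    · rintro x ⟨e, he, hex⟩ y ⟨g, hg, hgy⟩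
      exact reflTransGen_adj_edgeSpan_of_isCircuit hC he hex hg hgy
  deg_eq_two := by
    rintro x ⟨e, he, hex⟩
    have inter_eq : (C : Set β) ∩ G.incidenceSet x =
        (C ∩ (cubicIncidence hG hb hfin).star x : Finset β) := by
      ext k
      simp [mem_star_cubicIncidence]
    rw [deg_edgeSpan (not_isLink_self_of_isCubic hG hb · x), inter_eq,
      Set.encard_coe_eq_coe_finsetCard, hC.isEven.card_inter_star
        (mem_verts_cubicIncidence.2 hex.vertex_mem)
        ⟨e, Finset.mem_inter.2 ⟨he, mem_star_cubicIncidence.2 hex⟩⟩]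
    rfl

lemma finite_setOf_le (hV : V(G).Finite) (hE : E(G).Finite) : {H | H ≤ G}.Finite := by
  refine Set.Finite.of_finite_image (f := fun H : Graph α β => (V(H), E(H)))
    ((hV.powerset.prod hE.powerset).subset ?_) fun H hH H' hH' h => ?_
  · rintro _ ⟨H, hH, rfl⟩
    exact ⟨hH.vertexSet_mono, IsSubgraph.edgeSet_mono hH⟩
  · exact (Compatible.of_le_le hH hH').ext (Prod.mk.inj h).1 (Prod.mk.inj h).2

lemma nonempty_edgeSet_of_isCircuitOf {C : Graph α β} (hC : C.IsCircuitOf G) : E(C).Nonempty := by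
  obtain ⟨x, hx⟩ := hC.connected.1
  rw [Set.nonempty_iff_ne_empty]
  intro hempty
  have hinc : C.incidenceSet x = ∅ :=
    Set.subset_empty_iff.1 (hempty ▸ C.incidenceSet_subset_edgeSet x)
  have hdeg := hC.deg_eq_two x hx
  rw [deg_eq_encard_incidenceSet fun e he => hempty.subset he.edge_mem, hinc] at hdeg
  simp at hdeg

lemma count_le_two_of_isCircuitDoubleCover {𝒞 : Multiset (Graph α β)}
    (h : G.IsCircuitDoubleCover 𝒞) (C : Graph α β) : 𝒞.count C ≤ 2 := by
  by_cases hC : C ∈ 𝒞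
  · obtain ⟨e, he⟩ := nonempty_edgeSet_of_isCircuitOf (h.1 C hC)
    rw [← h.2 e (IsSubgraph.edgeSet_mono (h.1 C hC).le he), Multiset.count,
      Multiset.countP_eq_card_filter, Multiset.countP_eq_card_filter]
    exact Multiset.card_le_card (Multiset.monotone_filter_right _ fun _ hC' => hC' ▸ he)
  · rw [Multiset.count_eq_zero_of_notMem hC]
    exact Nat.zero_le 2

lemma finite_setOf_isCircuitDoubleCover (hV : V(G).Finite) (hE : E(G).Finite) :
    {𝒞 | G.IsCircuitDoubleCover 𝒞}.Finite := by
  refine (Set.finite_Iic (2 • (finite_setOf_le hV hE).toFinset.val)).subset fun 𝒞 h𝒞 => ?_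
  rw [Set.mem_Iic, Multiset.le_iff_count]
  intro C
  by_cases hC : C ∈ 𝒞
  · rw [Multiset.count_nsmul, Multiset.count_eq_one_of_mem (Finset.nodup _)
      (by simpa using (h𝒞.1 C hC).le)]
    exact count_le_two_of_isCircuitDoubleCover h𝒞 C
  · rw [Multiset.count_eq_zero_of_notMem hC]
    exact Nat.zero_le _

/-- The multiset of subgraphs formed by a set of edge sets. -/
def edgeSpans (G : Graph α β) (𝒞 : Finset (Finset β)) : Multiset (Graph α β) :=
  𝒞.val.map fun C : Finset β => edgeSpan G (C : Set β)

variable {𝒞 : Finset (Finset β)}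

lemma edgeSet_edgeSpan_of_isCDC (h : (cubicIncidence hG hb hfin).IsCDC 𝒞) (hC : C ∈ 𝒞) :
    E(edgeSpan G (C : Set β)) = C :=
  edgeSet_edgeSpan fun _ he => mem_edges_cubicIncidence.1 ((h.isCircuit C hC).isEven.subset he)

lemma isCircuitDoubleCover_edgeSpans (h : (cubicIncidence hG hb hfin).IsCDC 𝒞) :
    G.IsCircuitDoubleCover (edgeSpans G 𝒞) := by
  constructor
  · intro H hH
    obtain ⟨C, hC, rfl⟩ := Multiset.mem_map.1 hH
    exact isCircuitOf_edgeSpan (h.isCircuit C hC)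
  · intro e he
    rw [edgeSpans, Multiset.countP_map, ← h.card_eq_two e (mem_edges_cubicIncidence.2 he),
      Finset.card_def, Finset.filter_val]
    congr 1
    refine Multiset.filter_congr fun C hC => ?_
    rw [edgeSet_edgeSpan_of_isCDC h hC, Finset.mem_coe]

lemma injOn_edgeSpans :
    Set.InjOn (edgeSpans G) {𝒞 | (cubicIncidence hG hb hfin).IsCDC 𝒞} := by
  have map_edgeSet : ∀ 𝒞, (cubicIncidence hG hb hfin).IsCDC 𝒞 →
      (edgeSpans G 𝒞).map (fun C => E(C)) = 𝒞.val.map fun C : Finset β => (C : Set β) := by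
    intro 𝒞 h
    rw [edgeSpans, Multiset.map_map]
    exact Multiset.map_congr rfl fun C hC => edgeSet_edgeSpan_of_isCDC h hC
  intro 𝒞 h𝒞 𝒟 h𝒟 heq
  have hmap := map_edgeSet 𝒞 h𝒞
  rw [heq, map_edgeSet 𝒟 h𝒟] at hmap
  exact (Finset.val_injective (Multiset.map_injective Finset.coe_injective hmap)).symm

lemma card_cdcs_le_numCircuitDoubleCovers :
    (cubicIncidence hG hb hfin).cdcs.card ≤ G.numCircuitDoubleCovers := by
  have hinj : Set.InjOn (edgeSpans G) (cubicIncidence hG hb hfin).cdcs :=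
    injOn_edgeSpans.mono fun _ h𝒞 => CubicIncidence.mem_cdcs.1 (Finset.mem_coe.1 h𝒞)
  rw [numCircuitDoubleCovers, ← Set.ncard_coe_finset, ← hinj.ncard_image]
  refine Set.ncard_le_ncard ?_
    (finite_setOf_isCircuitDoubleCover hfin (finite_edgeSet_of_isCubic hG hfin))
  rintro _ ⟨𝒞, h𝒞, rfl⟩
  exact isCircuitDoubleCover_edgeSpans (CubicIncidence.mem_cdcs.1 (Finset.mem_coe.1 h𝒞))

end CubicGraph

/-! ### Curves that cross a set of edges -/

namespace SurfaceEmbedding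

variable {α β F : Type*} {G : Graph α β} {M : SurfaceEmbedding G F} {D : Set β} {x y : F}

lemma edge_mem (M : SurfaceEmbedding G F) (x : F) : M.edge x ∈ E(G) := (M.isLink x).edge_mem

lemma edge_flipFace (M : SurfaceEmbedding G F) (x : F) : M.edge (M.flipFace x) = M.edge x :=
  ((M.edge_eq_iff x _).2 (.inr (.inr (.inl rfl)))).symm

/-- The segment from the centre of the face of `x` to the midpoint of the edge of `x`, given by the
two flags along it. Every edge has two of them, one on each of its sides. -/
def side (M : SurfaceEmbedding G F) (x : F) : Sym2 F := s(x, M.flipVert x)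

lemma side_eq_side_iff : M.side x = M.side y ↔ x = y ∨ x = M.flipVert y := by
  rw [side, side, Sym2.eq_iff]
  exact ⟨Or.imp And.left And.left, by
    rintro (rfl | rfl)
    exacts [.inl ⟨rfl, rfl⟩, .inr ⟨rfl, M.flipVert_invol y⟩]⟩

lemma side_flipFace_ne (x : F) : M.side (M.flipFace x) ≠ M.side x := fun h =>
  (side_eq_side_iff.1 h).elim (M.flipFace_ne x) fun h' =>
    M.flipVert_flipFace_ne x (by rw [h', M.flipVert_invol])

lemma edge_eq_and_face_eq_of_side_eq (h : M.side x = M.side y) :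
    M.edge x = M.edge y ∧ M.face x = M.face y := by
  rcases side_eq_side_iff.1 h with rfl | rfl
  exacts [⟨rfl, rfl⟩, ⟨M.edge_flipVert y, M.face_flipVert y⟩]

lemma edge_eq_edge_iff : M.edge x = M.edge y ↔ M.side x = M.side y ∨
    M.side x = M.side (M.flipFace y) := by
  rw [eq_comm, M.edge_eq_iff, side_eq_side_iff, side_eq_side_iff, or_assoc]

lemma face_eq_or_eq_of_edge_eq (h : M.edge x = M.edge y) :
    M.face x = M.face y ∨ M.face x = M.face (M.flipFace y) :=
  (edge_eq_edge_iff.1 h).imp (fun h => (edge_eq_and_face_eq_of_side_eq h).2)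
    fun h => (edge_eq_and_face_eq_of_side_eq h).2

lemma finite_setOf_edge_mem (M : SurfaceEmbedding G F) (hD : D.Finite) :
    {x | M.edge x ∈ D}.Finite := by
  refine hD.preimage' fun e _ => ?_
  by_cases h : ∃ y, M.edge y = e
  · obtain ⟨y, rfl⟩ := h
    exact (Set.toFinite {y, M.flipVert y, M.flipFace y, M.flipVert (M.flipFace y)}).subset
      fun x hx => (M.edge_eq_iff y x).1 (Eq.symm hx)
  · exact Set.finite_empty.subset fun x hx => h ⟨x, hx⟩

lemma finite_flags (M : SurfaceEmbedding G F) (hE : E(G).Finite) : Finite F :=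
  Set.finite_univ_iff.1 ((M.finite_setOf_edge_mem hE).subset fun x _ => M.edge_mem x)

lemma isLink_segmentGraph_side (M : SurfaceEmbedding G F) (x : F) :
    M.segmentGraph.IsLink (.inl (M.side x)) (.inl (.inr (M.edge x))) (.inr (M.face x)) :=
  ⟨_, _, .toEdge x, .inl ⟨rfl, rfl⟩⟩

lemma inc_segmentGraph_side {a : (α ⊕ β) ⊕ M.Face} : M.segmentGraph.Inc (.inl (M.side x)) a ↔
    a = .inl (.inr (M.edge x)) ∨ a = .inr (M.face x) := by
  have hl := M.isLink_segmentGraph_side x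
  exact ⟨fun h => h.eq_or_eq_of_isLink hl,
    by rintro (rfl | rfl); exacts [hl.inc_left, hl.inc_right]⟩

lemma not_isLink_segmentGraph_self (s : Sym2 F ⊕ Sym2 F) (a : (α ⊕ β) ⊕ M.Face) :
    ¬ M.segmentGraph.IsLink s a a := by
  rintro ⟨p, f, -, ⟨rfl, h⟩ | ⟨rfl, h⟩⟩ <;> simp at h

/-- The union of the segments that run from the midpoints of the edges in `D` to the centres of
the faces. -/
def curve (M : SurfaceEmbedding G F) (D : Set β) :
    Graph ((α ⊕ β) ⊕ M.Face) (Sym2 F ⊕ Sym2 F) :=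
  edgeSpan M.segmentGraph (Sum.inl '' (M.side '' {x | M.edge x ∈ D}))

lemma mem_vertexSet_curve {a : (α ⊕ β) ⊕ M.Face} : a ∈ V(M.curve D) ↔
    ∃ x, M.edge x ∈ D ∧ (a = .inl (.inr (M.edge x)) ∨ a = .inr (M.face x)) := by
  constructor
  · rintro ⟨_, ⟨_, ⟨x, hx, rfl⟩, rfl⟩, ha⟩
    exact ⟨x, hx, inc_segmentGraph_side.1 ha⟩
  · rintro ⟨x, hx, ha⟩
    exact ⟨_, ⟨_, ⟨x, hx, rfl⟩, rfl⟩, inc_segmentGraph_side.2 ha⟩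

lemma edgeSet_curve : E(M.curve D) = Sum.inl '' (M.side '' {x | M.edge x ∈ D}) := by
  refine edgeSet_edgeSpan ?_
  rintro _ ⟨_, ⟨x, -, rfl⟩, rfl⟩
  exact (M.isLink_segmentGraph_side x).edge_mem

lemma inl_side_mem_edgeSet_curve : Sum.inl (M.side x) ∈ E(M.curve D) ↔ M.edge x ∈ D := by
  rw [edgeSet_curve, Sum.inl_injective.mem_set_image]
  constructor
  · rintro ⟨y, hy, hyx⟩
    exact (edge_eq_and_face_eq_of_side_eq hyx).1 ▸ hy
  · exact fun hx => ⟨x, hx, rfl⟩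

lemma inr_notMem_edgeSet_curve {s : Sym2 F} : Sum.inr s ∉ E(M.curve D) := by
  simp [edgeSet_curve]

lemma deg_curve (a : (α ⊕ β) ⊕ M.Face) : (M.curve D).deg a = (M.side '' {x | M.edge x ∈ D ∧
    (a = .inl (.inr (M.edge x)) ∨ a = .inr (M.face x))}).encard := by
  rw [curve, deg_edgeSpan fun s => not_isLink_segmentGraph_self s a,
    ← (Sum.inl_injective (β := Sym2 F)).encard_image (M.side '' _)]
  refine congrArg Set.encard (Set.ext fun s => ⟨?_, ?_⟩)
  · rintro ⟨⟨_, ⟨x, hx, rfl⟩, rfl⟩, ha⟩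
    exact ⟨_, ⟨x, ⟨hx, inc_segmentGraph_side.1 ha⟩, rfl⟩, rfl⟩
  · rintro ⟨_, ⟨x, ⟨hx, ha⟩, rfl⟩, rfl⟩
    exact ⟨⟨_, ⟨x, hx, rfl⟩, rfl⟩, inc_segmentGraph_side.2 ha⟩

lemma deg_curve_midpoint (hx : M.edge x ∈ D) : (M.curve D).deg (.inl (.inr (M.edge x))) = 2 := by
  have sides_eq : M.side '' {y | M.edge y ∈ D ∧
      ((.inl (.inr (M.edge x)) : (α ⊕ β) ⊕ M.Face) = .inl (.inr (M.edge y)) ∨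
        (.inl (.inr (M.edge x)) : (α ⊕ β) ⊕ M.Face) = .inr (M.face y))} =
      {M.side (M.flipFace x), M.side x} := by
    ext s
    simp only [Sum.inl.injEq, Sum.inr.injEq, reduceCtorEq, or_false]
    constructor
    · rintro ⟨y, ⟨-, hy⟩, rfl⟩
      exact (edge_eq_edge_iff.1 hy.symm).symm
    · rintro (rfl | rfl)
      · exact ⟨M.flipFace x, by simp [edge_flipFace, hx], rfl⟩
      · exact ⟨x, ⟨hx, rfl⟩, rfl⟩
  rw [deg_curve, sides_eq, Set.encard_pair (side_flipFace_ne x)]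

/-- The segments from the midpoints of the edges in `D` to the centres of the faces form a simple
closed curve: any two of these edges have a common face, and the curve visits no face twice. -/
structure IsCrossedByCurve (M : SurfaceEmbedding G F) (D : Set β) : Prop where
  nonempty : D.Nonempty
  subset : D ⊆ E(G)
  exists_common_face : ∀ e ∈ D, ∀ g ∈ D, ∃ x y, M.edge x = e ∧ M.edge y = g ∧ M.face x = M.face y
  encard_sides : ∀ z, M.edge z ∈ D →
    (M.side '' {x | M.edge x ∈ D ∧ M.face x = M.face z}).encard = 2

namespace IsCrossedByCurve

lemma deg_curve_eq_two (h : M.IsCrossedByCurve D) (a : (α ⊕ β) ⊕ M.Face)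
    (ha : a ∈ V(M.curve D)) : (M.curve D).deg a = 2 := by
  obtain ⟨z, hz, rfl | rfl⟩ := mem_vertexSet_curve.1 ha
  · exact deg_curve_midpoint hz
  · rw [← h.encard_sides z hz, deg_curve]
    simp only [reduceCtorEq, Sum.inr.injEq, false_or, eq_comm (a := M.face z)]

lemma isConnected_curve (h : M.IsCrossedByCurve D) : (M.curve D).IsConnected := by
  have adj_centre : ∀ x, M.edge x ∈ D →
      (M.curve D).Adj (.inl (.inr (M.edge x))) (.inr (M.face x)) :=
    fun x hx => ⟨_, ⟨_, ⟨x, hx, rfl⟩, rfl⟩, M.isLink_segmentGraph_side x⟩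
  have reach_midpoint : ∀ e ∈ D, ∀ g ∈ D, Relation.ReflTransGen (M.curve D).Adj
      (.inl (.inr e)) (.inl (.inr g)) := by
    intro e he g hg
    obtain ⟨x, y, rfl, rfl, hxy⟩ := h.exists_common_face e he g hg
    exact .tail (.single (adj_centre x he)) (hxy ▸ (adj_centre y hg).symm)
  constructor
  · obtain ⟨e, he⟩ := h.nonempty
    obtain ⟨x, rfl⟩ := M.exists_edge e (h.subset he)
    exact ⟨_, mem_vertexSet_curve.2 ⟨x, he, .inl rfl⟩⟩
  · intro a ha b hb
    obtain ⟨x, hx, ha⟩ := mem_vertexSet_curve.1 ha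
    obtain ⟨y, hy, hb⟩ := mem_vertexSet_curve.1 hb
    calc Relation.ReflTransGen (M.curve D).Adj a (.inl (.inr (M.edge x))) := by
          rcases ha with rfl | rfl
          exacts [.refl, .single (adj_centre x hx).symm]
      Relation.ReflTransGen (M.curve D).Adj _ (.inl (.inr (M.edge y))) :=
          reach_midpoint _ hx _ hy
      Relation.ReflTransGen (M.curve D).Adj _ b := by
          rcases hb with rfl | rfl
          exacts [.refl, .single (adj_centre y hy)]

lemma isSimpleClosedCurve (h : M.IsCrossedByCurve D) (hD : D.Finite) :
    M.IsSimpleClosedCurve (M.curve D) where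
  le := edgeSpan_le
  finite := by
    have hfin := M.finite_setOf_edge_mem hD
    refine ((hfin.image fun x => .inl (.inr (M.edge x))).union
      (hfin.image fun x => .inr (M.face x))).subset fun a ha => ?_
    obtain ⟨x, hx, rfl | rfl⟩ := mem_vertexSet_curve.1 ha
    exacts [.inl ⟨x, hx, rfl⟩, .inr ⟨x, hx, rfl⟩]
  connected := h.isConnected_curve
  deg_eq_two := h.deg_curve_eq_two

end IsCrossedByCurve

lemma numPoints_curve_le : M.numPoints (M.curve D) ≤ D.encard := by
  rw [numPoints, ← (Sum.inr_injective (α := α)).encard_image D]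
  refine Set.encard_le_encard fun p hp => ?_
  obtain ⟨x, hx, h | h⟩ := mem_vertexSet_curve.1 hp
  · exact ⟨_, hx, (Sum.inl.inj h).symm⟩
  · simp at h

lemma eqvGen_adjOff_curve_of_vert_eq (h : M.vert x = M.vert y) :
    Relation.EqvGen (M.AdjOff (M.curve D)) x y := by
  refine ((M.vert_eq_iff x y).1 h).mono ?_
  rintro a b (rfl | rfl)
  exacts [.inr (.inl ⟨rfl, inr_notMem_edgeSet_curve⟩), .inr (.inr rfl)]

lemma exists_crossedOnlyBy_of_not_isNonseparating (h : ¬ M.IsNonseparating (M.curve D)) :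
    ∃ X, (∃ u ∈ V(G), u ∈ X) ∧ (∃ v ∈ V(G), v ∉ X) ∧ CrossedOnlyBy G X D := by
  simp only [IsNonseparating, not_forall] at h
  obtain ⟨x, y, hxy⟩ := h
  set X := M.vert '' {z | Relation.EqvGen (M.AdjOff (M.curve D)) x z}
  have vert_mem_iff : ∀ w, M.vert w ∈ X ↔ Relation.EqvGen (M.AdjOff (M.curve D)) x w :=
    fun w => ⟨fun ⟨_, hxz, hz⟩ => hxz.trans _ _ _ (eqvGen_adjOff_curve_of_vert_eq hz),
      fun h => ⟨w, h, rfl⟩⟩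
  refine ⟨X, ⟨M.vert x, (M.isLink x).left_mem, (vert_mem_iff x).2 (.refl x)⟩,
    ⟨M.vert y, (M.isLink y).left_mem, (vert_mem_iff y).not.2 hxy⟩, fun e u v he huv => ?_⟩
  obtain ⟨z, rfl⟩ := M.exists_edge e huv.edge_mem
  have hadj : Relation.EqvGen (M.AdjOff (M.curve D)) z (M.flipVert z) :=
    .rel _ _ (.inl ⟨rfl, fun h => he (inl_side_mem_edgeSet_curve.1 h)⟩)
  have ends_mem_iff : M.vert z ∈ X ↔ M.vert (M.flipVert z) ∈ X := by
    rw [vert_mem_iff, vert_mem_iff]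
    exact ⟨fun h => h.trans _ _ _ hadj, fun h => h.trans _ _ _ (hadj.symm _ _)⟩
  rcases huv.eq_and_eq_or_eq_and_eq (M.isLink z) with ⟨rfl, rfl⟩ | ⟨rfl, rfl⟩
  exacts [ends_mem_iff, ends_mem_iff.symm]

lemma IsCrossedByCurve.exists_crossedOnlyBy (h : M.IsCrossedByCurve D) (hD : D.encard ≤ 3)
    (hrep : 4 ≤ M.representativity) :
    ∃ X, (∃ u ∈ V(G), u ∈ X) ∧ (∃ v ∈ V(G), v ∉ X) ∧ CrossedOnlyBy G X D := by
  refine exists_crossedOnlyBy_of_not_isNonseparating (M := M) fun hns => ?_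
  have hsimple := h.isSimpleClosedCurve
    (Set.encard_lt_top_iff.1 (hD.trans_lt (ENat.natCast_lt_top 3)))
  have hfour : (4 : ℕ∞) ≤ 3 := calc
    4 ≤ M.representativity := hrep
    _ ≤ M.numPoints (M.curve D) := iInf_le_of_le _ (iInf_le_of_le hsimple (iInf_le _ hns))
    _ ≤ D.encard := numPoints_curve_le
    _ ≤ 3 := hD
  exact absurd hfour (by decide)

lemma isCrossedByCurve_singleton (hx : M.face (M.flipFace x) = M.face x) :
    M.IsCrossedByCurve {M.edge x} where
  nonempty := Set.singleton_nonempty _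
  subset := Set.singleton_subset_iff.2 (M.edge_mem x)
  exists_common_face := by
    rintro e rfl g rfl
    exact ⟨x, x, rfl, rfl, rfl⟩
  encard_sides z hz := by
    have face_eq : ∀ w, M.edge w = M.edge x → M.face w = M.face x := fun w hw => by
      simpa only [hx, or_self] using face_eq_or_eq_of_edge_eq hw
    rw [← deg_curve_midpoint hz, deg_curve]
    congr 2
    ext w
    simp only [Set.mem_singleton_iff, Set.mem_ofPred_eq, Sum.inl.injEq, Sum.inr.injEq,
      reduceCtorEq, or_false]
    exact and_congr_right fun hw => iff_of_true ((face_eq w hw).trans (face_eq z hz).symm)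
      (hz.trans hw.symm)

lemma face_flipFace_ne (hconn : G.IsConnected) (hb : G.IsBridgeless)
    (hrep : 4 ≤ M.representativity) (x : F) : M.face (M.flipFace x) ≠ M.face x := by
  intro hx
  obtain ⟨X, ⟨u, hu, huX⟩, ⟨v, hv, hvX⟩, hX⟩ :=
    (isCrossedByCurve_singleton hx).exists_crossedOnlyBy (by simp) hrep
  exact hvX (hX.mem_of_singleton hconn hb hu hv huX)

end SurfaceEmbedding

/-! ### The faces of an embedding -/

namespace SurfaceEmbedding

variable {α β F : Type*} {G : Graph α β} {M : SurfaceEmbedding G F} {D : Finset β} {x y : F}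
  {e : β} {hcubic : G.IsCubic} {hb : G.IsBridgeless} {hfin : V(G).Finite}

lemma side_eq_side_iff_of_face_ne (hface : ∀ x, M.face (M.flipFace x) ≠ M.face x) :
    M.side x = M.side y ↔ M.edge x = M.edge y ∧ M.face x = M.face y := by
  refine ⟨edge_eq_and_face_eq_of_side_eq, fun ⟨he, hf⟩ => ?_⟩
  refine (edge_eq_edge_iff.1 he).resolve_right fun hside => hface y ?_
  rw [← hf, (edge_eq_and_face_eq_of_side_eq hside).2]

noncomputable instance [Finite F] : Fintype M.Face := @Fintype.ofFinite _ (Quot.finite _)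

/-- The edges on the boundary of a face. -/
noncomputable def boundary [Finite F] (M : SurfaceEmbedding G F) (φ : M.Face) : Finset β :=
  (Set.toFinite (M.edge '' {x | M.face x = φ})).toFinset

lemma mem_boundary [Finite F] {φ : M.Face} :
    e ∈ M.boundary φ ↔ ∃ x, M.face x = φ ∧ M.edge x = e := by
  simp [boundary]

lemma edge_mem_boundary [Finite F] (x : F) : M.edge x ∈ M.boundary (M.face x) :=
  mem_boundary.2 ⟨x, rfl, rfl⟩

-- The edges in question correspond to the flags at `v` on `φ`, which `flipEdge` matches in pairs.
lemma even_card_boundary_inter_star [Finite F]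
    (hface : ∀ x, M.face (M.flipFace x) ≠ M.face x) (φ : M.Face) (v : α) :
    Even (M.boundary φ ∩ (cubicIncidence hcubic hb hfin).star v).card := by
  cases nonempty_fintype F
  set flags := (Finset.univ : Finset F).filter fun x => M.face x = φ ∧ M.vert x = v
  have mem_flags : ∀ x, x ∈ flags ↔ M.face x = φ ∧ M.vert x = v := by simp [flags]
  have image_eq : flags.image M.edge =
      M.boundary φ ∩ (cubicIncidence hcubic hb hfin).star v := by
    ext e
    simp only [Finset.mem_image, mem_flags, Finset.mem_inter, mem_boundary,
      mem_star_cubicIncidence]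
    constructor
    · rintro ⟨x, ⟨hφ, rfl⟩, rfl⟩
      exact ⟨⟨x, hφ, rfl⟩, (M.isLink x).inc_left⟩
    · rintro ⟨⟨x, hφ, rfl⟩, hv⟩
      rcases hv.eq_or_eq_of_isLink (M.isLink x) with rfl | rfl
      · exact ⟨x, ⟨hφ, rfl⟩, rfl⟩
      · exact ⟨M.flipVert x, ⟨(M.face_flipVert x).trans hφ, rfl⟩, M.edge_flipVert x⟩
  have edge_injOn : Set.InjOn M.edge flags := by
    intro x hx y hy hxy
    rw [Finset.mem_coe, mem_flags] at hx hy
    have hside := (side_eq_side_iff_of_face_ne hface).2 ⟨hxy, hx.1.trans hy.1.symm⟩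
    refine (side_eq_side_iff.1 hside).resolve_right fun hflip => ?_
    have hloop := M.isLink y
    rw [← hflip, hx.2, hy.2] at hloop
    exact not_isLink_self_of_isCubic hcubic hb _ _ hloop
  rw [← image_eq, Finset.card_image_of_injOn edge_injOn]
  refine even_card_of_involutive (fun x hx => ?_) M.flipEdge_invol M.flipEdge_ne
  rwa [mem_flags, M.face_flipEdge, M.vert_flipEdge, ← mem_flags]

lemma isPairOf_faces [Finite F]
    (hface : ∀ x, M.face (M.flipFace x) ≠ M.face x) (x : F) :
    IsPairOf Finset.univ (fun φ => M.edge x ∈ M.boundary φ) (M.face x)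
      (M.face (M.flipFace x)) where
  left_mem := Finset.mem_univ _
  right_mem := Finset.mem_univ _
  ne := (hface x).symm
  iff φ _ := by
    constructor
    · intro h
      obtain ⟨y, rfl, hy⟩ := mem_boundary.1 h
      exact face_eq_or_eq_of_edge_eq hy
    · rintro (rfl | rfl)
      exacts [edge_mem_boundary x, mem_boundary.2 ⟨_, rfl, M.edge_flipFace x⟩]

lemma isEvenDoubleCover_boundary [Finite F]
    (hface : ∀ x, M.face (M.flipFace x) ≠ M.face x) :
    (cubicIncidence hcubic hb hfin).IsEvenDoubleCover Finset.univ M.boundary where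
  isEven φ _ :=
    { subset := fun e he => by
        obtain ⟨x, -, rfl⟩ := mem_boundary.1 he
        exact mem_edges_cubicIncidence.2 (M.edge_mem x)
      even_inter_star := fun v _ => even_card_boundary_inter_star hface φ v }
  card_eq_two e he := by
    obtain ⟨x, rfl⟩ := M.exists_edge e (mem_edges_cubicIncidence.1 he)
    exact (isPairOf_faces hface x).card_filter

lemma encard_sides_eq_two [Finite F] (hface : ∀ x, M.face (M.flipFace x) ≠ M.face x)
    {φ : M.Face} (h : (M.boundary φ ∩ D).card = 2) :
    (M.side '' {x | M.edge x ∈ D ∧ M.face x = φ}).encard = 2 := by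
  obtain ⟨e, g, heg, hpair⟩ := Finset.card_eq_two.1 h
  have mem_pair : ∀ k, k = e ∨ k = g ↔ (∃ x, M.face x = φ ∧ M.edge x = k) ∧ k ∈ D := fun k => by
    rw [← mem_boundary, ← Finset.mem_inter, hpair, Finset.mem_insert, Finset.mem_singleton]
  obtain ⟨⟨x, rfl, rfl⟩, hx⟩ := (mem_pair e).1 (.inl rfl)
  obtain ⟨⟨y, hyx, rfl⟩, hy⟩ := (mem_pair g).1 (.inr rfl)
  refine Set.encard_eq_two.2 ⟨M.side x, M.side y,
    fun hside => heg (edge_eq_and_face_eq_of_side_eq hside).1, Set.ext fun s => ⟨?_, ?_⟩⟩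
  · rintro ⟨w, ⟨hw, hwx⟩, rfl⟩
    simp only [Set.mem_insert_iff, Set.mem_singleton_iff, side_eq_side_iff_of_face_ne hface, hwx,
      hyx, and_true]
    exact (mem_pair _).2 ⟨⟨w, hwx, rfl⟩, hw⟩
  · rintro (rfl | rfl)
    exacts [⟨x, ⟨hx, rfl⟩, rfl⟩, ⟨y, ⟨hy, hyx⟩, rfl⟩]

lemma isCrossedByCurve_of_even [Finite F] (hface : ∀ x, M.face (M.flipFace x) ≠ M.face x)
    (hDE : (D : Set β) ⊆ E(G)) (hne : D.Nonempty) (hcard : D.card ≤ 3)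
    (heven : ∀ φ, Even (M.boundary φ ∩ D).card) : M.IsCrossedByCurve D where
  nonempty := hne
  subset := hDE
  exists_common_face e he g hg := by
    have card_eq_two : ∀ e ∈ D, (Finset.univ.filter fun φ => e ∈ M.boundary φ).card = 2 := by
      intro e he
      obtain ⟨x, rfl⟩ := M.exists_edge e (hDE he)
      exact (isPairOf_faces hface x).card_filter
    obtain ⟨φ, -, heφ, hgφ⟩ :=
      exists_mem_and_mem_of_even hcard card_eq_two (fun φ _ => heven φ) he hg
    obtain ⟨x, rfl, hx⟩ := mem_boundary.1 heφ
    obtain ⟨y, hyx, hy⟩ := mem_boundary.1 hgφ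
    exact ⟨x, y, hx, hy, hyx.symm⟩
  encard_sides z hz := encard_sides_eq_two hface <| card_inter_eq_two_of_even hcard
    (heven (M.face z)) ⟨_, Finset.mem_inter.2 ⟨edge_mem_boundary z, hz⟩⟩

-- A curve through the edges of `D` separates the surface, so some cut is contained in `D`.
lemma exists_cut_eq_of_even [Finite F] (hconn : G.IsConnected) (hrep : 4 ≤ M.representativity)
    (hD : D ⊆ (cubicIncidence hcubic hb hfin).edges) (hne : D.Nonempty) (hcard : D.card ≤ 3)
    (heven : ∀ φ, Even (M.boundary φ ∩ D).card) :
    ∃ Y ⊆ (cubicIncidence hcubic hb hfin).verts, (cubicIncidence hcubic hb hfin).cut Y = D := by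
  set K := cubicIncidence hcubic hb hfin
  have hface := face_flipFace_ne hconn hb hrep
  have hcover : K.IsEvenDoubleCover Finset.univ M.boundary := isEvenDoubleCover_boundary hface
  have hDE : (D : Set β) ⊆ E(G) := fun e he => mem_edges_cubicIncidence.1 (hD he)
  obtain ⟨X, ⟨u, hu, huX⟩, ⟨v, hv, hvX⟩, hX⟩ :=
    (isCrossedByCurve_of_even hface hDE hne hcard heven).exists_crossedOnlyBy
      (by simpa using hcard) hrep
  set Y := K.verts.filter (· ∈ X)
  have hY : Y ⊆ K.verts := Finset.filter_subset _ _
  have cut_nonempty : (K.cut Y).Nonempty := by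
    rw [Finset.nonempty_iff_ne_empty]
    intro hempty
    rcases isConnected_cubicIncidence hconn Y hY hempty with h | h
    · exact Finset.notMem_empty u
        (h ▸ Finset.mem_filter.2 ⟨mem_verts_cubicIncidence.2 hu, huX⟩)
    · exact hvX (Finset.mem_filter.1 (h.symm ▸ mem_verts_cubicIncidence.2 hv)).2
  have cut_even : ∀ φ ∈ Finset.univ, Even (M.boundary φ ∩ K.cut Y).card := fun φ hφ =>
    even_card_inter_oddPart (hcover.isEven φ hφ).subset fun v hv => by
      rw [Finset.inter_comm]
      exact (hcover.isEven φ hφ).even_inter_star v (hY hv)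
  refine ⟨Y, hY, eq_of_subset_of_even hcard (fun e he => ?_) (fun φ _ => heven φ)
    (fun e he => hX.mem_of_mem_cut he) cut_nonempty cut_even⟩
  obtain ⟨x, rfl⟩ := M.exists_edge e (hDE he)
  exact ⟨M.face x, Finset.mem_univ _, edge_mem_boundary x⟩

/-- A cubic graph with the faces of an embedding of representativity at least four. -/
noncomputable def facedCubic [Finite F] (M : SurfaceEmbedding G F) (hcubic : G.IsCubic)
    (hb : G.IsBridgeless) (hfin : V(G).Finite) (hconn : G.IsConnected)
    (hrep : 4 ≤ M.representativity) : FacedCubic α β M.Face where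
  toCubicIncidence := cubicIncidence hcubic hb hfin
  faces := Finset.univ
  bd := M.boundary
  bd_nonempty φ _ := by
    obtain ⟨x, rfl⟩ := Quot.exists_rep φ
    exact ⟨M.edge x, edge_mem_boundary x⟩
  isEvenDoubleCover := isEvenDoubleCover_boundary (face_flipFace_ne hconn hb hrep)
  isConnected := isConnected_cubicIncidence hconn
  exists_cut D hD hcard heven := exists_cut_eq_of_even hconn hrep hD
    (Finset.card_pos.1 (by omega)) (by omega) fun φ => heven φ (Finset.mem_univ φ)

end SurfaceEmbedding

-- For a cubic graph `2 * |E| = 3 * |V|`, so `|V| + 2 * χ = 3 * |V| - 2 * |E| + 2 * |faces|`.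
lemma SurfaceEmbedding.ncard_add_two_mul_eulerChar {α β F : Type*} {G : Graph α β}
    (M : SurfaceEmbedding G F) (hcubic : G.IsCubic) (hb : G.IsBridgeless) (hfin : V(G).Finite) :
    (V(G).ncard : ℤ) + 2 * M.eulerChar = 2 * Nat.card M.Face := by
  have handshake : 3 * V(G).ncard = 2 * E(G).ncard := by
    rw [Set.ncard_eq_toFinset_card _ hfin,
      Set.ncard_eq_toFinset_card _ (finite_edgeSet_of_isCubic hcubic hfin)]
    exact (cubicIncidence hcubic hb hfin).three_mul_card_verts
  rw [eulerChar]
  omega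

lemma rpow_one_third_div_le {x : ℝ} {k m : ℕ} (hx : 0 ≤ x) (h : x ≤ (k * m : ℕ) ^ 3)
    (hk : 0 < k) : x ^ ((1 : ℝ) / 3) / k ≤ m := by
  have hroot : x ^ ((1 : ℝ) / 3) ≤ (k * m : ℕ) := by
    rw [one_div, Real.rpow_inv_le_iff_of_pos hx (Nat.cast_nonneg _) three_pos]
    exact_mod_cast h
  rw [div_le_iff₀' (Nat.cast_pos.2 hk)]
  exact_mod_cast hroot

end

theorem theorem4p3 {α β F : Type*} (G : Graph α β)
    (hfin : V(G).Finite) (hconn : G.IsConnected) (hcubic : G.IsCubic) (hbridge : G.IsBridgeless)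
    (hn : 4 ≤ V(G).ncard)
    (M : SurfaceEmbedding G F) (χ : ℤ) (hχ : M.eulerChar = χ) (hrep : 4 ≤ M.representativity) :
    (2 : ℝ) ^ (((V(G).ncard : ℝ) + 2 * (χ : ℝ)) ^ ((1 : ℝ) / 3) / 100) ≤
      (G.numCircuitDoubleCovers : ℝ) := by
  have : Finite F := M.finite_flags (finite_edgeSet_of_isCubic hcubic hfin)
  set K := M.facedCubic hcubic hbridge hfin hconn hrep
  have card_verts : V(G).ncard = K.verts.card := Set.ncard_eq_toFinset_card _ hfin
  have card_faces : Nat.card M.Face = K.faces.card := Nat.card_eq_fintype_card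
  obtain ⟨m, faces_le, two_pow_le⟩ := K.exists_two_pow_le_card_cdcs (card_verts ▸ hn)
  have euler : (V(G).ncard : ℝ) + 2 * (χ : ℝ) = (2 * K.faces.card : ℕ) := by
    rw [← hχ, ← card_faces]
    exact_mod_cast M.ncard_add_two_mul_eulerChar hcubic hbridge hfin
  have exponent_le : ((V(G).ncard : ℝ) + 2 * (χ : ℝ)) ^ ((1 : ℝ) / 3) / 100 ≤ m := by
    rw [euler]
    refine rpow_one_third_div_le (k := 100) (Nat.cast_nonneg _) ?_ (by norm_num)
    exact_mod_cast faces_le.trans (Nat.pow_le_pow_left (Nat.mul_le_mul_right m (by norm_num)) 3)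
  calc (2 : ℝ) ^ (((V(G).ncard : ℝ) + 2 * (χ : ℝ)) ^ ((1 : ℝ) / 3) / 100)
      ≤ (2 : ℝ) ^ (m : ℝ) := Real.rpow_le_rpow_of_exponent_le one_le_two exponent_le
    _ = (2 ^ m : ℕ) := by rw [Real.rpow_natCast, Nat.cast_pow, Nat.cast_ofNat]
    _ ≤ G.numCircuitDoubleCovers := mod_cast two_pow_le.trans
      (card_cdcs_le_numCircuitDoubleCovers (hG := hcubic) (hb := hbridge))
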